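/- Let $(M,g)$ be a smooth 4-dimensional spacetime of signature $(-,+,+,+)$, oriented by its volume form $\varepsilon_{\alpha\beta\mu\nu}$, satisfying the Einstein vacuum equations with cosmological constant $$R_{\mu\nu}-\tfrac12 R\,g_{\mu\nu}+\Lambda g_{\mu\nu}=0,$$ where $(\nabla_\alpha\nabla_\beta-\nabla_\beta\nabla_\alpha)v^\gamma=R^\gamma{}_{\mu\alpha\beta}v^\mu$ and $R_{\mu\nu}=R^{\alpha}{}_{\mu\alpha\nu}$. Let $\Sigma$ be an immersed spacelike hypersurface with smooth unit normal field $n$ ($g_{\mu\nu}n^\mu n^\nu=-1$), induced metric $\gamma_{ij}$, extrinsic curvature $K(u,v)=-g(\nabla_u n,v)$ for $u,v$ tangent to $\Sigma$, and volume form $\varepsilon_{abc}=n^\nu\varepsilon_{\nu abc}$. Let $W_{\alpha\beta\mu\nu}$ be the Weyl tensor, $W^*{}_{\alpha\beta\mu\nu}=\tfrac12W_{\alpha\beta\lambda\delta}\varepsilon^{\lambda\delta}{}_{\mu\nu}$, and let $$E_{\alpha\beta}=W_{\alpha\mu\nu\beta}n^\mu n^\nu,\qquad B_{\alpha\beta}=W^*{}_{\alpha\mu\nu\beta}n^\mu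 n^\nu,$$ regarded as tensors $E_{ij}$, $B_{ij}$ on $\Sigma$. For 2-tensors $A,C$ on $\Sigma$ put $(A\wedge C)_a=\varepsilon_a{}^{bc}A_b{}^dC_{dc}$, and let $|$ denote the Levi-Civita covariant derivative of $\gamma$. Then, everywhere on $\Sigma$, $$E^i{}_{j|i}=(K\wedge B)_j,\qquad B^i{}_{j|i}=-(K\wedge E)_j .$$ Consequently, let $X$ be a smooth conformal Killing vector field of $(\Sigma,\gamma)$, i.e. $X_{i|j}+X_{j|i}=\lambda\gamma_{ij}$ for some function $\lambda$. For $T=E$ or $T=B$ and a smooth oriented surface $A$ in $\Sigma$ define the charge $$Q(T,X)[A]=\int_A T^i{}_jX^j\,dS_i,\qquad dS_i=\tfrac12\varepsilon_{ikl}\,dx^k\wedge dx^l .$$ Suppose that two surfaces $A_1,A_2$ bound a region $V$ in $\Sigma$: $\partial V=A_1-A_2$, where surfaces and regions are smooth singular cubical chains with integer coefficients (finite formal sums of smooth maps $[0,1]^k\to\Sigma$, with the usual alternating-sum-of-faces boundary). If $K\wedge B=0$ along $V$, then $Q(E,X)[A_1]=Q(E,X)[A_2]$. If $K\wedge E=0$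 along $V$, then $Q(B,X)[A_1]=Q(B,X)[A_2]$. -/

import Mathlib

open scoped Manifold ContDiff Bundle

noncomputable section

namespace WeylCharge

/-! Manifolds are modelled on `EuclideanSpace ℝ (Fin n)`. The space `TangentSpace (𝓡 n) p` is
`EuclideanSpace ℝ (Fin n)` itself, and a tangent vector at `p` is the tuple of its components with
respect to the coordinate basis at `p` of the preferred chart `extChartAt (𝓡 n) p`. -/

/-- The components of a tangent vector at `p` in the preferred chart at `p`. -/
def coord {n : ℕ} {M : Type*} [TopologicalSpace M] [ChartedSpace (EuclideanSpace ℝ (Fin n)) M]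
    {p : M} (u : TangentSpace (𝓡 n) p) (i : Fin n) : ℝ :=
  (show EuclideanSpace ℝ (Fin n) from u) i

/-- The coordinate basis vector `∂_i` at `p` of the preferred chart at `p`. -/
def bvec {n : ℕ} {M : Type*} [TopologicalSpace M] [ChartedSpace (EuclideanSpace ℝ (Fin n)) M]
    (p : M) (i : Fin n) : TangentSpace (𝓡 n) p :=
  (EuclideanSpace.single i (1 : ℝ) : EuclideanSpace ℝ (Fin n))

/-- The coordinate vector field `∂_i` of the preferred chart at `p`, at the point with
coordinates `y` in that chart. -/
def frame {n : ℕ} {M : Type*} [TopologicalSpace M] [ChartedSpace (EuclideanSpace ℝ (Fin n)) M]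
    (p : M) (y : EuclideanSpace ℝ (Fin n)) (i : Fin n) :
    TangentSpace (𝓡 n) ((extChartAt (𝓡 n) p).symm y) :=
  mfderiv 𝓘(ℝ, EuclideanSpace ℝ (Fin n)) (𝓡 n) (extChartAt (𝓡 n) p).symm y
    (EuclideanSpace.single i (1 : ℝ) : EuclideanSpace ℝ (Fin n))

/-- A field of functions of two tangent vectors (all those used below are bilinear). -/
abbrev Tensor2 (n : ℕ) (M : Type*) [TopologicalSpace M]
    [ChartedSpace (EuclideanSpace ℝ (Fin n)) M] : Type _ :=
  ∀ p : M, TangentSpace (𝓡 n) p → TangentSpace (𝓡 n) p → ℝ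

/-- The component functions `T_ij(y)` of `T` in the preferred chart at `p`. -/
def chartComp {n : ℕ} {M : Type*} [TopologicalSpace M]
    [ChartedSpace (EuclideanSpace ℝ (Fin n)) M] (T : Tensor2 n M) (p : M)
    (y : EuclideanSpace ℝ (Fin n)) : Matrix (Fin n) (Fin n) ℝ :=
  Matrix.of fun i j => T ((extChartAt (𝓡 n) p).symm y) (frame p y i) (frame p y j)

/-- The components `T_ij` of `T` at the point `p` itself. -/
def comp {n : ℕ} {M : Type*} [TopologicalSpace M]
    [ChartedSpace (EuclideanSpace ℝ (Fin n)) M] (T : Tensor2 n M) (p : M) :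
    Matrix (Fin n) (Fin n) ℝ :=
  Matrix.of fun i j => T p (bvec p i) (bvec p j)

/-! ### Levi-Civita connection and curvature -/

/-- The partial derivative `∂_i f`. -/
def pd {n : ℕ} (i : Fin n) (f : EuclideanSpace ℝ (Fin n) → ℝ) (y : EuclideanSpace ℝ (Fin n)) : ℝ :=
  fderiv ℝ f y (EuclideanSpace.single i (1 : ℝ))

/-- The Christoffel symbol `Γ^k_{ij}` of a metric given by its component matrix `G` in coordinates. -/
def christoffel {n : ℕ} (G : EuclideanSpace ℝ (Fin n) → Matrix (Fin n) (Fin n) ℝ) (k i j : Fin n)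
    (y : EuclideanSpace ℝ (Fin n)) : ℝ :=
  (1 / 2) * ∑ l, (G y)⁻¹ k l *
    (pd i (fun z => G z j l) y + pd j (fun z => G z i l) y - pd l (fun z => G z i j) y)

/-- `R^a_{bcd}`, with the sign for which `(∇_c ∇_d - ∇_d ∇_c) v^a = R^a_{bcd} v^b`. -/
def riemannUp {n : ℕ} (G : EuclideanSpace ℝ (Fin n) → Matrix (Fin n) (Fin n) ℝ) (a b c d : Fin n)
    (y : EuclideanSpace ℝ (Fin n)) : ℝ :=
  pd c (christoffel G a d b) y - pd d (christoffel G a c b) y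
    + ∑ e, (christoffel G a c e y * christoffel G e d b y
        - christoffel G a d e y * christoffel G e c b y)

section Curvature

variable {n : ℕ} {M : Type*} [TopologicalSpace M] [ChartedSpace (EuclideanSpace ℝ (Fin n)) M]

/-- `Γ^k_{ij}` at `p`, in the preferred chart at `p`. -/
def christoffelAt (g : Tensor2 n M) (p : M) (k i j : Fin n) : ℝ :=
  christoffel (chartComp g p) k i j (extChartAt (𝓡 n) p p)

/-- The Riemann tensor `R_{abcd}` at `p`. -/
def riemann (g : Tensor2 n M) (p : M) (a b c d : Fin n) : ℝ :=
  ∑ e, comp g p a e * riemannUp (chartComp g p) e b c d (extChartAt (𝓡 n) p p)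

/-- The Ricci tensor `R_{bd} = R^a_{bad}` at `p`. -/
def ricci (g : Tensor2 n M) (p : M) (b d : Fin n) : ℝ :=
  ∑ a, riemannUp (chartComp g p) a b a d (extChartAt (𝓡 n) p p)

/-- The scalar curvature `R = g^{bd} R_{bd}` at `p`. -/
def scalarCurv (g : Tensor2 n M) (p : M) : ℝ :=
  ∑ b, ∑ d, (comp g p)⁻¹ b d * ricci g p b d

/-- The covariant derivative `∇_k T_{ij}` at `p`. -/
def covDeriv2 (g T : Tensor2 n M) (p : M) (k i j : Fin n) : ℝ :=
  pd k (fun y => chartComp T p y i j) (extChartAt (𝓡 n) p p)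
    - ∑ l, christoffelAt g p l k i * comp T p l j
    - ∑ l, christoffelAt g p l k j * comp T p i l

/-- The covariant divergence `T^i_{j|i} = g^{ki} ∇_k T_{ij}`, evaluated on the vector `v^j`. -/
def divergence (g T : Tensor2 n M) (p : M) (v : TangentSpace (𝓡 n) p) : ℝ :=
  ∑ j, (∑ k, ∑ i, (comp g p)⁻¹ k i * covDeriv2 g T p k i j) * coord v j

/-- `∇_i X_j` at `p`, where `X_j = g_{jk} X^k`. -/
def covDerivLower (g : Tensor2 n M) (X : ∀ p : M, TangentSpace (𝓡 n) p) (p : M)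
    (i j : Fin n) : ℝ :=
  pd i (fun y => g ((extChartAt (𝓡 n) p).symm y) (X ((extChartAt (𝓡 n) p).symm y)) (frame p y j))
      (extChartAt (𝓡 n) p p)
    - ∑ k, christoffelAt g p k i j * g p (X p) (bvec p k)

/-- Smooth conformal Killing fields: `∇_j X_i + ∇_i X_j = lam g_{ij}` for some function `lam`. -/
structure IsConformalKilling [IsManifold (𝓡 n) ∞ M] (g : Tensor2 n M) (X : ∀ p : M, TangentSpace (𝓡 n) p) : Prop where
  smooth : ContMDiff (𝓡 n) (𝓡 n).tangent ∞ (fun p => (⟨p, X p⟩ : TangentBundle (𝓡 n) M))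
  eqn : ∃ lam : M → ℝ, ∀ (p : M) (i j : Fin n),
    covDerivLower g X p j i + covDerivLower g X p i j = lam p * comp g p i j

end Curvature

/-! ### Spacetimes -/

section Spacetime

variable (M : Type*) [TopologicalSpace M] [ChartedSpace (EuclideanSpace ℝ (Fin 4)) M]
  [IsManifold (𝓡 4) ∞ M]

/-- Smooth Lorentzian metrics of signature `(-,+,+,+)`. -/
structure LorentzMetric where
  val : ∀ x : M, TangentSpace (𝓡 4) x →L[ℝ] TangentSpace (𝓡 4) x →L[ℝ] ℝ
  symm : ∀ (x : M) (u v : TangentSpace (𝓡 4) x), val x u v = val x v u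
  lorentz : ∀ x : M, ∃ t : TangentSpace (𝓡 4) x, val x t t < 0 ∧
    ∀ v : TangentSpace (𝓡 4) x, val x t v = 0 → v ≠ 0 → 0 < val x v v
  smooth : ContMDiff (𝓡 4)
    ((𝓡 4).prod 𝓘(ℝ, EuclideanSpace ℝ (Fin 4) →L[ℝ] EuclideanSpace ℝ (Fin 4) →L[ℝ] ℝ)) ∞
    (fun x => Bundle.TotalSpace.mk'
      (EuclideanSpace ℝ (Fin 4) →L[ℝ] EuclideanSpace ℝ (Fin 4) →L[ℝ] ℝ) x (val x))

variable {M}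

/-- The metric as a tensor field. -/
def LorentzMetric.tensor (g : LorentzMetric M) : Tensor2 4 M := fun x u v => g.val x u v

/-- The Einstein vacuum equations with cosmological constant,
`R_{μν} - (1/2) R g_{μν} + Λ g_{μν} = 0`. -/
def EinsteinVacuum (g : LorentzMetric M) (Λ : ℝ) : Prop :=
  ∀ (x : M) (μ ν : Fin 4),
    ricci g.tensor x μ ν - (1 / 2) * scalarCurv g.tensor x * comp g.tensor x μ ν
      + Λ * comp g.tensor x μ ν = 0

/-- An orientation of the spacetime, given as its volume form `ε`: the continuous 4-form with value
`±1` on orthonormal frames. -/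
structure VolumeForm (g : LorentzMetric M) where
  val : ∀ x : M, (TangentSpace (𝓡 4) x) [⋀^Fin 4]→ₗ[ℝ] ℝ
  sq_eq : ∀ (x : M) (v : Fin 4 → TangentSpace (𝓡 4) x),
    (val x v) ^ 2 = -(Matrix.of fun i j => g.val x (v i) (v j)).det
  continuousOn : ∀ p : M, ContinuousOn
    (fun y => val ((extChartAt (𝓡 4) p).symm y) (frame p y)) (extChartAt (𝓡 4) p).target

/-- The components `ε_{αβμν}` at `x`. -/
def VolumeForm.comp {g : LorentzMetric M} (ε : VolumeForm g) (x : M) (α β μ ν : Fin 4) : ℝ :=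
  ε.val x ![bvec x α, bvec x β, bvec x μ, bvec x ν]

/-- The Weyl tensor
`W_{αβμν} = R_{αβμν} - (g_{α[μ}R_{ν]β} - g_{β[μ}R_{ν]α}) + (1/3) R g_{α[μ}g_{ν]β}`. -/
def weyl (g : LorentzMetric M) (x : M) (α β μ ν : Fin 4) : ℝ :=
  let G := WeylCharge.comp g.tensor x
  let Ric := ricci g.tensor x
  riemann g.tensor x α β μ ν
    - ((1 / 2) * (G α μ * Ric ν β - G α ν * Ric μ β)
        - (1 / 2) * (G β μ * Ric ν α - G β ν * Ric μ α))
    + (1 / 3) * scalarCurv g.tensor x * ((1 / 2) * (G α μ * G ν β - G α ν * G μ β))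

/-- The dual `W*_{αβμν} = (1/2) W_{αβλδ} ε^{λδ}_{μν}`. -/
def weylDual (g : LorentzMetric M) (ε : VolumeForm g) (x : M) (α β μ ν : Fin 4) : ℝ :=
  let Ginv := (WeylCharge.comp g.tensor x)⁻¹
  (1 / 2) * ∑ l, ∑ d, ∑ ρ, ∑ σ, weyl g x α β l d * Ginv l ρ * Ginv d σ * ε.comp x ρ σ μ ν

/-! ### Spacelike hypersurfaces -/

variable (S : Type*) [TopologicalSpace S] [ChartedSpace (EuclideanSpace ℝ (Fin 3)) S]

/-- An immersed spacelike hypersurface `ι : S → M` with a smooth unit normal field `n`. -/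
structure SpacelikeHypersurface (g : LorentzMetric M) where
  ι : S → M
  smooth : ContMDiff (𝓡 3) (𝓡 4) ∞ ι
  spacelike : ∀ (s : S) (u : TangentSpace (𝓡 3) s), u ≠ 0 →
    0 < g.val (ι s) (mfderiv (𝓡 3) (𝓡 4) ι s u) (mfderiv (𝓡 3) (𝓡 4) ι s u)
  n : ∀ s : S, TangentSpace (𝓡 4) (ι s)
  smooth_n : ContMDiff (𝓡 3) (𝓡 4).tangent ∞ (fun s => (⟨ι s, n s⟩ : TangentBundle (𝓡 4) M))
  unit_n : ∀ s : S, g.val (ι s) (n s) (n s) = -1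
  normal_n : ∀ (s : S) (u : TangentSpace (𝓡 3) s),
    g.val (ι s) (n s) (mfderiv (𝓡 3) (𝓡 4) ι s u) = 0

namespace SpacelikeHypersurface

variable {S} {g : LorentzMetric M} (H : SpacelikeHypersurface S g)

/-- The differential of the immersion. -/
def push (s : S) (u : TangentSpace (𝓡 3) s) : TangentSpace (𝓡 4) (H.ι s) :=
  mfderiv (𝓡 3) (𝓡 4) H.ι s u

/-- The induced Riemannian metric `γ`. -/
def γ : Tensor2 3 S := fun s u v => g.val (H.ι s) (H.push s u) (H.push s v)

/-- The components in the preferred chart `ψ` of `M` at `ι s` of the covariant derivative of the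
normal field along the hypersurface, `(∇_u n)^α = ∂_u n^α + Γ^α_{μν} u^μ n^ν`; here the components
of `n` at nearby points of `S` are also taken in the chart `ψ`. -/
def nablaNormal (s : S) (u : TangentSpace (𝓡 3) s) (α : Fin 4) : ℝ :=
  (show EuclideanSpace ℝ (Fin 4) from
    mfderiv (𝓡 3) 𝓘(ℝ, EuclideanSpace ℝ (Fin 4))
      (fun s' : S => (show EuclideanSpace ℝ (Fin 4) from
        mfderiv (𝓡 4) 𝓘(ℝ, EuclideanSpace ℝ (Fin 4)) (extChartAt (𝓡 4) (H.ι s)) (H.ι s') (H.n s')))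
      s u) α
  + ∑ μ, ∑ ν, christoffelAt g.tensor (H.ι s) α μ ν * coord (H.push s u) μ * coord (H.n s) ν

/-- The extrinsic curvature `K(u,v) = -g(∇_u n, v)`. -/
def K : Tensor2 3 S := fun s u v =>
  -∑ α, ∑ β, comp g.tensor (H.ι s) α β * H.nablaNormal s u α * coord (H.push s v) β

/-- The electric part `E_{αβ} = W_{αμνβ} n^μ n^ν` of the Weyl tensor, as a tensor on `S`. -/
def E : Tensor2 3 S := fun s u v =>
  ∑ α, ∑ μ, ∑ ν, ∑ β, weyl g (H.ι s) α μ ν β *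
    coord (H.push s u) α * coord (H.n s) μ * coord (H.n s) ν * coord (H.push s v) β

variable (ε : VolumeForm g)

/-- The magnetic part `B_{αβ} = W*_{αμνβ} n^μ n^ν` of the Weyl tensor, as a tensor on `S`. -/
def B : Tensor2 3 S := fun s u v =>
  ∑ α, ∑ μ, ∑ ν, ∑ β, weylDual g ε (H.ι s) α μ ν β *
    coord (H.push s u) α * coord (H.n s) μ * coord (H.n s) ν * coord (H.push s v) β

/-- The volume form of the hypersurface, `ε_{abc} = n^ν ε_{νabc}`. -/
def vol (s : S) (u v w : TangentSpace (𝓡 3) s) : ℝ :=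
  ε.val (H.ι s) ![H.n s, H.push s u, H.push s v, H.push s w]

/-- `(A ∧ C)_a = ε_a^{bc} A_b^d C_{dc}`, evaluated on the vector `v^a`. -/
def wedge (A C : Tensor2 3 S) (s : S) (v : TangentSpace (𝓡 3) s) : ℝ :=
  let γinv := (comp H.γ s)⁻¹
  ∑ b, ∑ c, ∑ b', ∑ c', ∑ d, ∑ d',
    H.vol ε s v (bvec s b') (bvec s c') * γinv b' b * γinv c' c *
      (comp A s b d' * γinv d' d) * comp C s d c

/-- The vector `T^i_j X^j = γ^{ik} T_{kj} X^j`. -/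
def contract (T : Tensor2 3 S) (X : ∀ s : S, TangentSpace (𝓡 3) s) (s : S) :
    TangentSpace (𝓡 3) s :=
  ∑ i, (∑ k, (comp H.γ s)⁻¹ i k * T s (bvec s k) (X s)) • bvec s i

end SpacelikeHypersurface

end Spacetime

/-! ### Oriented surfaces and regions as smooth singular cubical chains -/

/-- Smooth singular `k`-cubes `[0,1]^k → S`. Smoothness up to the boundary is required of the
extension of `toFun` to `ℝ^k` that is constant along the fibres of the projection onto the cube. -/
@[ext]
structure SmoothCube (S : Type*) [TopologicalSpace S] [ChartedSpace (EuclideanSpace ℝ (Fin 3)) S]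
    (k : ℕ) where
  toFun : (Fin k → Set.Icc (0 : ℝ) 1) → S
  smooth : ContMDiffOn 𝓘(ℝ, Fin k → ℝ) (𝓡 3) ∞
    (fun x : Fin k → ℝ => toFun fun i => Set.projIcc (0 : ℝ) 1 zero_le_one (x i))
    (Set.Icc (0 : Fin k → ℝ) 1)

namespace SmoothCube

variable {S : Type*} [TopologicalSpace S] [ChartedSpace (EuclideanSpace ℝ (Fin 3)) S]

/-- The cube as a function on `ℝ^k`; only its values on `[0,1]^k` matter. -/
def ext' {k : ℕ} (c : SmoothCube S k) (x : Fin k → ℝ) : S :=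
  c.toFun fun i => Set.projIcc (0 : ℝ) 1 zero_le_one (x i)

/-- The face of a cube on which the `i`-th coordinate is equal to `a`. -/
def face {k : ℕ} (c : SmoothCube S (k + 1)) (i : Fin (k + 1)) (a : Set.Icc (0 : ℝ) 1) :
    SmoothCube S k where
  toFun t := c.toFun (i.insertNth a t)
  smooth := by
    have h : (fun x : Fin k → ℝ =>
        c.toFun (i.insertNth a fun j => Set.projIcc (0 : ℝ) 1 zero_le_one (x j))) =
        (fun x : Fin (k + 1) → ℝ =>
          c.toFun fun i => Set.projIcc (0 : ℝ) 1 zero_le_one (x i)) ∘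
        (fun x : Fin k → ℝ => (i.insertNth (a : ℝ) x : Fin (k + 1) → ℝ)) := by
      funext x
      simp only [Function.comp]
      congr 1
      funext j
      refine Fin.succAboveCases i ?_ (fun j => ?_) j
      · simp
      · simp
    rw [h]
    refine c.smooth.comp (ContDiff.contMDiff ?_).contMDiffOn ?_
    · rw [contDiff_pi]
      intro j
      refine Fin.succAboveCases i ?_ (fun j => ?_) j
      · simpa using contDiff_const
      · simpa using contDiff_apply ℝ ℝ j
    · intro x hx
      refine ⟨fun j => ?_, fun j => ?_⟩
      · refine Fin.succAboveCases i ?_ (fun j => ?_) j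
        · simpa using a.2.1
        · simpa using hx.1 j
      · refine Fin.succAboveCases i ?_ (fun j => ?_) j
        · simpa using a.2.2
        · simpa using hx.2 j

/-- The tangent vector `∂c/∂t_j`. -/
def velocity {k : ℕ} (c : SmoothCube S k) (t : Fin k → ℝ) (j : Fin k) :
    TangentSpace (𝓡 3) (c.ext' t) :=
  mfderivWithin 𝓘(ℝ, Fin k → ℝ) (𝓡 3) c.ext' (Set.Icc (0 : Fin k → ℝ) 1) t
    (Pi.single j (1 : ℝ) : Fin k → ℝ)

end SmoothCube

/-- Smooth singular cubical `k`-chains with integer coefficients. -/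
abbrev SmoothChain (S : Type*) [TopologicalSpace S] [ChartedSpace (EuclideanSpace ℝ (Fin 3)) S]
    (k : ℕ) : Type _ :=
  SmoothCube S k →₀ ℤ

section Charge

variable {S : Type*} [TopologicalSpace S] [ChartedSpace (EuclideanSpace ℝ (Fin 3)) S]

/-- The boundary of a cube: the alternating sum of its faces. -/
def cubeBoundary {k : ℕ} (c : SmoothCube S (k + 1)) : SmoothChain S k :=
  ∑ i : Fin (k + 1), ((-1 : ℤ) ^ (i : ℕ)) •
    (Finsupp.single (c.face i 1) (1 : ℤ) - Finsupp.single (c.face i 0) (1 : ℤ))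

/-- The boundary of a chain. -/
def boundary {k : ℕ} (V : SmoothChain S (k + 1)) : SmoothChain S k :=
  V.sum fun c m => m • cubeBoundary c

variable {M : Type*} [TopologicalSpace M] [ChartedSpace (EuclideanSpace ℝ (Fin 4)) M]
  [IsManifold (𝓡 4) ∞ M] {g : LorentzMetric M}

/-- The charge `Q(T,X) = ∫_A T^i_j X^j dS_i` over a surface `A`, where
`dS_i = (1/2) ε_{ikl} dx^k ∧ dx^l`. -/
def charge (H : SpacelikeHypersurface S g) (ε : VolumeForm g) (T : Tensor2 3 S)
    (X : ∀ s : S, TangentSpace (𝓡 3) s) (A : SmoothChain S 2) : ℝ :=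
  A.sum fun c m => (m : ℝ) * ∫ t in Set.Icc (0 : Fin 2 → ℝ) 1,
    H.vol ε (c.ext' t) (H.contract T X (c.ext' t)) (c.velocity t 0) (c.velocity t 1)

end Charge

end WeylCharge

end

open WeylCharge

/-! The electric and magnetic parts obey a Maxwell-like system because of the Bianchi identities.
Tracing the Einstein equations gives scalar curvature 4Λ and Ricci tensor Λg
(`EinsteinVacuum.ricci_eq`), so the Weyl tensor is the Riemann tensor minus a constant-curvature
term with coefficient Λ/3 (`weyl_eq`). Hence E is the electric part of the Riemann tensor minus
(Λ/3)γ (`matBil_E`), and B is the spatial dual of the Codazzi part R(u, n, k, l), where the Λ-term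
drops out because n is normal (`matBil_B`).

Since the Ricci tensor is parallel, the second Bianchi identity makes the Riemann tensor
divergence-free (`contracted_bianchi`). Its electric and Codazzi components are differentiated along
the hypersurface with the formulas of Gauss and Weingarten. Summed over a tangential orthonormal
frame, the ambient divergence disappears: its missing normal term is G(N, (∇_N R)(c, d)N) = 0. The
contractions of the symmetric K with an antisymmetric pair of curvature indices disappear too. What
survives is K times the other part (`divergence_electric`, `divergence_codazzi`). In dimension three
a 2-form is the contraction of the volume form with a vector, and the volume form is parallel
(`fderiv_density`), so the Codazzi equation becomes one for the magnetic part and both right-hand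
sides become wedge products. The term (Λ/3)γ contributes nothing: γ is parallel, and K ∧ γ = 0
because K is symmetric.

For the charges, E and B are symmetric and trace-free, by the algebraic symmetries of the curvature
and the Einstein equations. If T is also divergence-free and X is conformal Killing, then (T^i_j
X^j)_{|i} = T^{ij} X_{j|i} = (λ/2) tr T = 0 (`divergence_density_eq_zero`). So the flux 2-form is
closed (`flux_closed`), the divergence theorem kills its integral over the boundary of each cube of
V (`chargeHom_cubeBoundary`), and additivity gives equality of the charges.

The pointwise objects are defined at each point p in the preferred chart at p, whereas derivatives
need one fixed chart on a neighbourhood. Transition maps are isometries between the chart metrics,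
and naturality of the curvature under isometries (`isometry_curvature`, `isometry_ricciTrace`)
bridges the two. -/

open scoped Topology
open Filter

set_option maxSynthPendingDepth 3

noncomputable section

namespace WeylCharge

/-! ### Levi-Civita connection, curvature and Bianchi identities on a normed space -/

section Calculus

variable {V : Type*} [NormedAddCommGroup V] [NormedSpace ℝ V]
  {U : Type*} [NormedAddCommGroup U] [NormedSpace ℝ U]

/-- The composite `(u, v) ↦ A u ∘ B v` of two families of endomorphisms. -/
def compFamily (A B : V →L[ℝ] V →L[ℝ] V) : V →L[ℝ] V →L[ℝ] V →L[ℝ] V :=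
  (ContinuousLinearMap.compL ℝ V V V).bilinearComp A B

@[simp] lemma compFamily_apply (A B : V →L[ℝ] V →L[ℝ] V) (u v w : V) :
    compFamily A B u v w = A u (B v w) := rfl

/-- The curvature `R(u, v) w` of the connection with Christoffel symbols `Γ`. -/
def curvature (Γ : V → V →L[ℝ] V →L[ℝ] V) (x : V) : V →L[ℝ] V →L[ℝ] V →L[ℝ] V :=
  fderiv ℝ Γ x - (fderiv ℝ Γ x).flip + compFamily (Γ x) (Γ x) - (compFamily (Γ x) (Γ x)).flip

lemma curvature_apply (Γ : V → V →L[ℝ] V →L[ℝ] V) (x u v w : V) :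
    curvature Γ x u v w =
      fderiv ℝ Γ x u v w - fderiv ℝ Γ x v u w + Γ x u (Γ x v w) - Γ x v (Γ x u w) := by
  simp [curvature]

lemma curvature_antisymm (Γ : V → V →L[ℝ] V →L[ℝ] V) (x u v w : V) :
    curvature Γ x u v w = -curvature Γ x v u w := by
  simp only [curvature_apply]; abel

/-- Substitution in each of the two slots is a composition of continuous linear maps; the isometric
flips bring the slot concerned to the front. -/
lemma ContDiffAt.compFamily {A B : U → V →L[ℝ] V →L[ℝ] V} {x : U} {n : ℕ∞ω}
    (hA : ContDiffAt ℝ n A x) (hB : ContDiffAt ℝ n B x) :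
    ContDiffAt ℝ n (fun y => compFamily (A y) (B y)) x := by
  have h1 : ContDiffAt ℝ n (fun y => (ContinuousLinearMap.compL ℝ V V V).comp (A y)) x :=
    contDiffAt_const.clm_comp hA
  have h2 := ((ContinuousLinearMap.flipₗᵢ ℝ V (V →L[ℝ] V) (V →L[ℝ] V)).contDiff.contDiffAt
    (x := (ContinuousLinearMap.compL ℝ V V V).comp (A x))).comp x h1
  exact ((ContinuousLinearMap.flipₗᵢ ℝ V V (V →L[ℝ] V)).contDiff.contDiffAt).comp x
    (h2.clm_comp hB)

lemma ContDiffAt.curvature {Γ : V → V →L[ℝ] V →L[ℝ] V} {x : V} (h : ContDiffAt ℝ ∞ Γ x) :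
    ContDiffAt ℝ ∞ (curvature Γ) x := by
  have h1 : ContDiffAt ℝ ∞ (fderiv ℝ Γ) x := h.fderiv_right (by simp)
  have h2 := ContDiffAt.compFamily h h
  have h3 := ((ContinuousLinearMap.flipₗᵢ ℝ V V (V →L[ℝ] V)).contDiff.contDiffAt
    (n := ∞)).comp x h1
  have h4 := ((ContinuousLinearMap.flipₗᵢ ℝ V V (V →L[ℝ] V)).contDiff.contDiffAt
    (n := ∞)).comp x h2
  exact ((h1.sub h3).add h2).sub h4

/-- The covariant derivative `(∇_k R)(c, d) b` of the curvature. -/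
def nablaCurvature (Γ : V → V →L[ℝ] V →L[ℝ] V) (x k c d b : V) : V :=
  fderiv ℝ (curvature Γ) x k c d b + Γ x k (curvature Γ x c d b)
    - curvature Γ x (Γ x k c) d b - curvature Γ x c (Γ x k d) b - curvature Γ x c d (Γ x k b)

/-- `G` is a metric and `Γ` its Levi-Civita connection near `x`, both smooth. -/
structure IsLocalMetric (G : V → V →L[ℝ] V →L[ℝ] ℝ) (Γ : V → V →L[ℝ] V →L[ℝ] V) (x : V) :
    Prop where
  eventually_smooth : ∀ᶠ y in 𝓝 x, ContDiffAt ℝ ∞ G y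
  eventually_smooth_conn : ∀ᶠ y in 𝓝 x, ContDiffAt ℝ ∞ Γ y
  symm : ∀ᶠ y in 𝓝 x, ∀ u v, G y u v = G y v u
  nondeg : ∀ᶠ y in 𝓝 x, ∀ u, (∀ v, G y u v = 0) → u = 0
  koszul : ∀ᶠ y in 𝓝 x, ∀ u v w, 2 * G y (Γ y u v) w =
    fderiv ℝ G y u v w + fderiv ℝ G y v u w - fderiv ℝ G y w u v

variable {G : V → V →L[ℝ] V →L[ℝ] ℝ} {Γ : V → V →L[ℝ] V →L[ℝ] V} {x : V}

lemma _root_.ContDiffAt.eventually_differentiableAt {f : U → V} {y : U}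
    (h : ContDiffAt ℝ ∞ f y) : ∀ᶠ z in 𝓝 y, DifferentiableAt ℝ f z := by
  have h1 : ContDiffAt ℝ 1 f y := h.of_le (by exact_mod_cast le_top)
  exact (h1.eventually (by simp)).mono fun z hz => hz.differentiableAt (by simp)

lemma _root_.ContDiffAt.diffAt {f : U → V} {y : U}
    (h : ContDiffAt ℝ ∞ f y) : DifferentiableAt ℝ f y := h.differentiableAt (by simp)

lemma _root_.ContDiffAt.fderiv_infty {f : U → V} {y : U}
    (h : ContDiffAt ℝ ∞ f y) : ContDiffAt ℝ ∞ (fderiv ℝ f) y := h.fderiv_right (by simp)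

lemma _root_.ContDiffAt.fderiv_fderiv_symm {f : U → V} {y : U}
    (h : ContDiffAt ℝ ∞ f y) (u v : U) :
    fderiv ℝ (fderiv ℝ f) y u v = fderiv ℝ (fderiv ℝ f) y v u :=
  (h.isSymmSndFDerivAt (by simpa using WithTop.coe_le_coe.2 (le_top (a := (2 : ℕ∞))))) u v

lemma fderiv_apply₂ {F : U → V →L[ℝ] V →L[ℝ] ℝ} {y : U} (h : DifferentiableAt ℝ F y) (u : U)
    (v w : V) : fderiv ℝ (fun z => F z v w) y u = fderiv ℝ F y u v w := by
  have := ((h.hasFDerivAt.clm_apply (hasFDerivAt_const v y)).clm_apply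
    (hasFDerivAt_const w y)).fderiv
  rw [this]; simp

lemma fderiv_congr_apply {F H : U → V} {y : U} (h : F =ᶠ[𝓝 y] H) (u : U) :
    fderiv ℝ F y u = fderiv ℝ H y u := by rw [h.fderiv_eq]

namespace IsLocalMetric

lemma smooth (h : IsLocalMetric G Γ x) : ContDiffAt ℝ ∞ G x := h.eventually_smooth.self_of_nhds

lemma smooth_conn (h : IsLocalMetric G Γ x) : ContDiffAt ℝ ∞ Γ x :=
  h.eventually_smooth_conn.self_of_nhds

/-- The predicate is open, so an identity derived from it at one point holds nearby and may be
differentiated. -/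
lemma eventually (h : IsLocalMetric G Γ x) : ∀ᶠ y in 𝓝 x, IsLocalMetric G Γ y := by
  filter_upwards [h.eventually_smooth.eventually_nhds, h.eventually_smooth_conn.eventually_nhds,
    h.symm.eventually_nhds, h.nondeg.eventually_nhds,
    h.koszul.eventually_nhds] with y h1 h2 h3 h4 h5
  exact ⟨h1, h2, h3, h4, h5⟩

lemma eventually_differentiableAt (h : IsLocalMetric G Γ x) :
    ∀ᶠ y in 𝓝 x, DifferentiableAt ℝ G y := h.smooth.eventually_differentiableAt

lemma eventually_fderiv_symm (h : IsLocalMetric G Γ x) :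
    ∀ᶠ y in 𝓝 x, ∀ u v w, fderiv ℝ G y w u v = fderiv ℝ G y w v u := by
  filter_upwards [h.symm.eventually_nhds, h.eventually_differentiableAt] with y hs hd u v w
  rw [← fderiv_apply₂ hd, ← fderiv_apply₂ hd]
  exact fderiv_congr_apply (hs.mono fun z hz => hz u v) w

/-- The right side of the Koszul formula is symmetric in its first two arguments; nondegeneracy
removes the metric. -/
lemma eventually_torsionFree (h : IsLocalMetric G Γ x) :
    ∀ᶠ y in 𝓝 x, ∀ u v, Γ y u v = Γ y v u := by
  filter_upwards [h.eventually_fderiv_symm, h.nondeg, h.koszul] with y hf hn hk u v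
  rw [← sub_eq_zero]
  refine hn _ fun w => ?_
  have h1 := hk u v w
  have h2 := hk v u w
  have h3 := hf u v w
  simp only [map_sub, sub_apply]
  linarith

/-- Add the two Koszul formulas that differ by exchanging the last two arguments. -/
lemma eventually_compat (h : IsLocalMetric G Γ x) :
    ∀ᶠ y in 𝓝 x, ∀ u v w, fderiv ℝ G y w u v = G y (Γ y w u) v + G y u (Γ y w v) := by
  filter_upwards [h.eventually_fderiv_symm, h.symm, h.koszul] with y hf hs hk u v w
  have h1 := hk w u v
  have h2 := hk w v u
  rw [hs u]
  linarith [hf u v w, hf u w v, hf v w u]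

lemma compat (h : IsLocalMetric G Γ x) (u v w : V) :
    fderiv ℝ G x w u v = G x (Γ x w u) v + G x u (Γ x w v) :=
  h.eventually_compat.self_of_nhds u v w

lemma torsionFree (h : IsLocalMetric G Γ x) (u v : V) : Γ x u v = Γ x v u :=
  h.eventually_torsionFree.self_of_nhds u v

lemma symm_self (h : IsLocalMetric G Γ x) (u v : V) : G x u v = G x v u :=
  h.symm.self_of_nhds u v

lemma fderiv_conn_symm (h : IsLocalMetric G Γ x) (w u v : V) :
    fderiv ℝ Γ x w u v = fderiv ℝ Γ x w v u := by
  have hd := h.smooth_conn.diffAt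
  have h1 : (fun y => Γ y u v) =ᶠ[𝓝 x] fun y => Γ y v u :=
    h.eventually_torsionFree.mono fun z hz => hz u v
  have := fderiv_congr_apply h1 w
  have e : ∀ a b, fderiv ℝ (fun y => Γ y a b) x w = fderiv ℝ Γ x w a b := fun a b => by
    rw [((hd.hasFDerivAt.clm_apply (hasFDerivAt_const a x)).clm_apply
      (hasFDerivAt_const b x)).fderiv]; simp
  rwa [e, e] at this

/-- The first Bianchi identity. -/
lemma bianchi_first (h : IsLocalMetric G Γ x) (u v w : V) :
    curvature Γ x u v w + curvature Γ x v w u + curvature Γ x w u v = 0 := by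
  simp only [curvature_apply]
  rw [h.fderiv_conn_symm u v w, h.fderiv_conn_symm v w u, h.fderiv_conn_symm w u v,
    h.torsionFree v w, h.torsionFree u w, h.torsionFree v u]
  abel

/-- This is [∇_z, ∇_w]G = 0: metric compatibility is differentiated once more, and the
antisymmetrisation in z, w kills the second derivative of G. -/
lemma metric_curvature_antisymm (h : IsLocalMetric G Γ x) (z w u v : V) :
    G x (curvature Γ x z w u) v = -G x u (curvature Γ x z w v) := by
  have hG := h.smooth.diffAt
  have hΓ := h.smooth_conn.diffAt
  have key : ∀ z w : V, fderiv ℝ (fderiv ℝ G) x z w u v =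
      fderiv ℝ G x z (Γ x w u) v + G x (fderiv ℝ Γ x z w u) v
        + (fderiv ℝ G x z u (Γ x w v) + G x u (fderiv ℝ Γ x z w v)) := by
    intro z w
    have h1 : (fun y => fderiv ℝ G y w u v) =ᶠ[𝓝 x]
        fun y => G y (Γ y w u) v + G y u (Γ y w v) :=
      h.eventually_compat.mono fun y hy => hy u v w
    have h2 := fderiv_congr_apply h1 z
    have hΓa : ∀ b, HasFDerivAt (fun y => Γ y w b) _ x := fun b =>
      (hΓ.hasFDerivAt.clm_apply (hasFDerivAt_const w x)).clm_apply (hasFDerivAt_const b x)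
    have hR := ((hG.hasFDerivAt.clm_apply (hΓa u)).clm_apply (hasFDerivAt_const v x)).add
      ((hG.hasFDerivAt.clm_apply (hasFDerivAt_const u x)).clm_apply (hΓa v))
    have hL := ((h.smooth.fderiv_infty.diffAt.hasFDerivAt.clm_apply
      (hasFDerivAt_const w x)).clm_apply (hasFDerivAt_const u x)).clm_apply
        (hasFDerivAt_const v x)
    rw [hL.fderiv] at h2
    erw [hR.fderiv] at h2
    simp at h2
    rw [h2]; ring
  have k1 := key z w
  have k2 := key w z
  have hs := congrArg (fun L => L u v) (h.smooth.fderiv_fderiv_symm z w)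
  simp only [h.compat] at k1 k2
  simp only [curvature_apply, map_sub, map_add, sub_apply,
    add_apply]
  linarith

lemma metric_curvature_self (h : IsLocalMetric G Γ x) (z w u : V) :
    G x u (curvature Γ x z w u) = 0 := by
  have := h.metric_curvature_antisymm z w u u
  rw [h.symm_self] at this
  linarith

lemma metric_curvature_antisymm' (h : IsLocalMetric G Γ x) (z w u v : V) :
    G x u (curvature Γ x z w v) = -G x v (curvature Γ x z w u) := by
  rw [h.symm_self v, h.metric_curvature_antisymm z w u v]; ring

/-- Symmetry of the Riemann tensor under exchange of the two pairs. -/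
lemma metric_curvature_pair (h : IsLocalMetric G Γ x) (a b c d : V) :
    G x a (curvature Γ x c d b) = G x c (curvature Γ x a b d) := by
  have B : ∀ a b c d, G x a (curvature Γ x b c d) + G x a (curvature Γ x c d b)
      + G x a (curvature Γ x d b c) = 0 := fun a b c d => by
    rw [← map_add, ← map_add, h.bianchi_first]; simp
  have A1 := h.metric_curvature_antisymm'
  have A2 : ∀ a b c d, G x a (curvature Γ x b c d) = -G x a (curvature Γ x c b d) :=
    fun a b c d => by rw [curvature_antisymm]; simp
  -- The octahedron argument: the four first Bianchi identities with one index in front combine with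
  -- the two antisymmetries to give pair symmetry.
  have b1 := B a b c d
  have b2 := B b c d a
  have b3 := B c d a b
  have b4 := B d a b c
  linarith [A1 a b c d, A1 c d a b, A1 a c b d, A1 b d a c, A1 d a b c, A1 d b c a, A1 c a b d,
    A1 b c d a, A1 a d b c, A1 b a c d, A2 a b c d, A2 a c d b, A2 a b d c, A2 b c d a, A2 b d a c,
    A2 b a c d, A2 c d a b, A2 c a b d, A2 c b d a, A2 d a b c, A2 d b c a, A2 d c a b,
    A1 a b d c, A1 a c d b, A1 a d c b, A1 c a d b, A1 d c a b, A1 c d b a, A1 b c a d, A1 d b a c,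
    A1 d a c b, A1 b d c a, A1 b a d c, A1 c b d a, A1 c b a d, A1 d c b a]

lemma _root_.WeylCharge.fderiv_curvature_apply (hΓ : ContDiffAt ℝ ∞ Γ x) (k c d b : V) :
    fderiv ℝ (fun y => curvature Γ y c d b) x k = fderiv ℝ (curvature Γ) x k c d b := by
  have hL := (((ContDiffAt.curvature hΓ).diffAt.hasFDerivAt.clm_apply
      (hasFDerivAt_const c x)).clm_apply (hasFDerivAt_const d x)).clm_apply
        (hasFDerivAt_const b x)
  rw [hL.fderiv]; simp

lemma _root_.WeylCharge.fderiv_curvature_eq (hΓ : ContDiffAt ℝ ∞ Γ x) (k c d b : V) :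
    fderiv ℝ (curvature Γ) x k c d b =
      fderiv ℝ (fderiv ℝ Γ) x k c d b - fderiv ℝ (fderiv ℝ Γ) x k d c b
      + (fderiv ℝ Γ x k c (Γ x d b) + Γ x c (fderiv ℝ Γ x k d b))
      - (fderiv ℝ Γ x k d (Γ x c b) + Γ x d (fderiv ℝ Γ x k c b)) := by
  rw [← fderiv_curvature_apply hΓ]
  simp only [curvature_apply]
  have hd := hΓ.diffAt.hasFDerivAt
  have hΓa : ∀ a b, HasFDerivAt (fun y => Γ y a b) _ x := fun a b =>
      (hd.clm_apply (hasFDerivAt_const a x)).clm_apply (hasFDerivAt_const b x)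
  have hD : ∀ a b c, HasFDerivAt (fun y => fderiv ℝ Γ y a b c) _ x := fun a b c =>
    ((hΓ.fderiv_infty.diffAt.hasFDerivAt.clm_apply
      (hasFDerivAt_const a x)).clm_apply (hasFDerivAt_const b x)).clm_apply
        (hasFDerivAt_const c x)
  have h2 : ∀ a c b, HasFDerivAt (fun y => Γ y a (Γ y c b)) _ x := fun a c b =>
    (hd.clm_apply (hasFDerivAt_const a x)).clm_apply (hΓa c b)
  rw [((((hD c d b).fun_sub (hD d c b)).fun_add (h2 c d b)).fun_sub (h2 d c b)).fderiv]
  simp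
  abel

/-- The second Bianchi identity. -/
lemma bianchi_second (h : IsLocalMetric G Γ x) (k c d b : V) :
    nablaCurvature Γ x k c d b + nablaCurvature Γ x c d k b + nablaCurvature Γ x d k c b = 0 := by
  have hs : ∀ u v a b, fderiv ℝ (fderiv ℝ Γ) x u v a b = fderiv ℝ (fderiv ℝ Γ) x v u a b :=
    fun u v a b => by rw [h.smooth_conn.fderiv_fderiv_symm u v]
  simp only [nablaCurvature, fderiv_curvature_eq h.smooth_conn]
  -- Torsion-freeness and antisymmetry pair off the corrections in the first two curvature slots.
  -- The remaining terms cancel after expansion, the second derivatives of Γ by their symmetry.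
  rw [h.torsionFree c k, h.torsionFree d k, h.torsionFree d c,
    curvature_antisymm Γ x c (Γ x k d), curvature_antisymm Γ x d (Γ x k c),
    curvature_antisymm Γ x k (Γ x c d)]
  rw [hs c k, hs d k, hs d c]
  simp only [curvature_apply Γ x c d, curvature_apply Γ x d k, curvature_apply Γ x k c,
    map_add, map_sub]
  abel

/-- Differentiate G(u, R(c, d)u) = 0. With u = N this is what later reduces the ambient divergence
to a sum over tangential directions. -/
lemma metric_nablaCurvature_self (h : IsLocalMetric G Γ x) (k c d u : V) :
    G x u (nablaCurvature Γ x k c d u) = 0 := by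
  have h1 : (fun y => G y u (curvature Γ y c d u)) =ᶠ[𝓝 x] fun _ => 0 :=
    h.eventually.mono fun y hy => hy.metric_curvature_self c d u
  have h2 := fderiv_congr_apply h1 k
  have hR := (((ContDiffAt.curvature h.smooth_conn).diffAt.hasFDerivAt.clm_apply
      (hasFDerivAt_const c x)).clm_apply (hasFDerivAt_const d x)).clm_apply
        (hasFDerivAt_const u x)
  rw [((h.smooth.diffAt.hasFDerivAt.clm_apply (hasFDerivAt_const u x)).clm_apply hR).fderiv] at h2
  simp [h.compat] at h2
  simp only [nablaCurvature, map_add, map_sub, h.metric_curvature_self]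
  linarith [h.metric_curvature_antisymm' c d u (Γ x k u), h.metric_curvature_self (Γ x k c) d u,
    h.metric_curvature_self c (Γ x k d) u]

end IsLocalMetric

/-! ### Traces, Ricci tensor and the contracted Bianchi identity -/

section Trace

variable [FiniteDimensional ℝ V]

/-- The trace as a continuous linear functional. -/
def traceL (V : Type*) [NormedAddCommGroup V] [NormedSpace ℝ V] [FiniteDimensional ℝ V] :
    (V →L[ℝ] V) →L[ℝ] ℝ :=
  LinearMap.toContinuousLinearMap (LinearMap.trace ℝ V ∘ₗ ContinuousLinearMap.coeLM ℝ)

lemma traceL_apply (L : V →L[ℝ] V) : traceL V L = LinearMap.trace ℝ V L := rfl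

lemma traceL_comp_comm (A B : V →L[ℝ] V) : traceL V (A.comp B) = traceL V (B.comp A) := by
  simp only [traceL_apply, ContinuousLinearMap.toLinearMap_comp]
  exact LinearMap.trace_mul_comm ℝ _ _

lemma traceL_euclidean {n : ℕ} (L : EuclideanSpace ℝ (Fin n) →L[ℝ] EuclideanSpace ℝ (Fin n)) :
    traceL _ L = ∑ a, L (EuclideanSpace.single a 1) a := by
  rw [traceL_apply, LinearMap.trace_eq_matrix_trace ℝ (EuclideanSpace.basisFun (Fin n) ℝ).toBasis]
  simp [Matrix.trace, LinearMap.toMatrix_apply]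

/-- The Ricci tensor `tr (w ↦ R(w, d) b)`. -/
def ricciTrace (Γ : V → V →L[ℝ] V →L[ℝ] V) (x b d : V) : ℝ :=
  traceL V (((curvature Γ x).flip d).flip b)

/-- Orthonormal frames of a bilinear form. -/
structure IsOrthoFrame {ι : Type*} [Fintype ι] [DecidableEq ι] (g : V →L[ℝ] V →L[ℝ] ℝ)
    (e : ι → V) (s : ι → ℝ) : Prop where
  sq : ∀ i, s i * s i = 1
  orth : ∀ i j, g (e i) (e j) = if i = j then s i else 0
  complete : ∀ z, z = ∑ i, (s i * g (e i) z) • e i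

/-- The functionals s_i G(e_i, ·) form the basis dual to the frame. -/
lemma IsOrthoFrame.trace {ι : Type*} [Fintype ι] [DecidableEq ι] {g : V →L[ℝ] V →L[ℝ] ℝ}
    {e : ι → V} {s : ι → ℝ} (h : IsOrthoFrame g e s) (L : V →L[ℝ] V) :
    traceL V L = ∑ i, s i * g (e i) (L (e i)) := by
  have hli : LinearIndependent ℝ e := by
    rw [Fintype.linearIndependent_iff]
    intro c hc i
    have := congrArg (fun z => s i * g (e i) z) hc
    simp only [map_sum, map_smul, h.orth, smul_eq_mul, map_zero, mul_zero] at this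
    simp at this
    rcases this with h0 | h0 | h0
    · have := h.sq i; simp [h0] at this
    · exact h0
    · have := h.sq i; simp [h0] at this
  have hsp : ⊤ ≤ Submodule.span ℝ (Set.range e) := fun z _ => by
    rw [h.complete z]
    exact Submodule.sum_mem _ fun i _ => Submodule.smul_mem _ _ (Submodule.subset_span ⟨i, rfl⟩)
  let b := Module.Basis.mk hli hsp
  have hrepr : ∀ z i, b.repr z i = s i * g (e i) z := by
    intro z i
    have : z = ∑ i, (s i * g (e i) z) • b i := by
      conv_lhs => rw [h.complete z]
      simp [b]
    conv_lhs => rw [this]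
    rw [b.repr_sum_self]
  rw [traceL_apply, LinearMap.trace_eq_matrix_trace ℝ b, Matrix.trace]
  refine Finset.sum_congr rfl fun i _ => ?_
  simp only [Matrix.diag_apply, LinearMap.toMatrix_apply, hrepr]
  simp [b]

lemma fderiv_ricciTrace (hΓ : ContDiffAt ℝ ∞ Γ x) (k b d : V) :
    fderiv ℝ (fun y => ricciTrace Γ y b d) x k =
      traceL V (((fderiv ℝ (curvature Γ) x k).flip d).flip b) := by
  have h1 := (ContDiffAt.curvature hΓ).diffAt.hasFDerivAt
  let F : (V →L[ℝ] V →L[ℝ] V →L[ℝ] V) →L[ℝ] ℝ := (traceL V).comp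
    (((ContinuousLinearMap.apply ℝ (V →L[ℝ] V) b).comp
      (ContinuousLinearMap.flipₗᵢ ℝ V V V : (V →L[ℝ] V →L[ℝ] V) →L[ℝ] _)).comp
    ((ContinuousLinearMap.apply ℝ (V →L[ℝ] V →L[ℝ] V) d).comp
      (ContinuousLinearMap.flipₗᵢ ℝ V V (V →L[ℝ] V) :
        (V →L[ℝ] V →L[ℝ] V →L[ℝ] V) →L[ℝ] _)))
  have h2 : (fun y => ricciTrace Γ y b d) = fun y => F (curvature Γ y) := rfl
  rw [h2]
  exact congrArg (fun L => L k) (F.hasFDerivAt.comp x h1).fderiv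

/-- If the Ricci tensor is a constant multiple of the metric, the curvature is divergence free. -/
lemma IsLocalMetric.contracted_bianchi (h : IsLocalMetric G Γ x) {Λ : ℝ}
    (hric : ∀ᶠ y in 𝓝 x, ∀ b d, ricciTrace Γ y b d = Λ * G y b d)
    {ι : Type*} [Fintype ι] [DecidableEq ι] {e : ι → V} {s : ι → ℝ}
    (he : IsOrthoFrame (G x) e s) (c d b : V) :
    ∑ i, s i * G x (e i) (nablaCurvature Γ x (e i) c d b) = 0 := by
  have key : ∀ k d, ∑ i, s i * G x (e i) (nablaCurvature Γ x k (e i) d b) = 0 := by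
    intro k d
    have h1 : (fun y => ricciTrace Γ y b d) =ᶠ[𝓝 x] fun y => Λ * G y b d :=
      hric.mono fun y hy => hy b d
    have h2 := fderiv_congr_apply h1 k
    rw [fderiv_ricciTrace h.smooth_conn, fderiv_const_mul, smul_apply,
      fderiv_apply₂ h.smooth.diffAt, h.compat, smul_eq_mul, mul_add, ← hric.self_of_nhds,
      ← hric.self_of_nhds] at h2
    -- Cyclicity of the trace cancels the two terms in which Γ_k acts on the index being traced, so
    -- the trace of ∇R is ∇Ric, which vanishes for Ric = ΛG.
    · have h3 := traceL_comp_comm (Γ x k) (((curvature Γ x).flip d).flip b)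
      simp only [ricciTrace] at h2
      rw [he.trace, he.trace, he.trace] at h2
      rw [he.trace, he.trace] at h3
      simp only [ContinuousLinearMap.flip_apply, ContinuousLinearMap.comp_apply] at h2 h3
      simp only [nablaCurvature, map_add, map_sub, mul_add, mul_sub, Finset.sum_add_distrib,
        Finset.sum_sub_distrib]
      linarith
    · have := ((h.smooth.diffAt.hasFDerivAt.clm_apply (hasFDerivAt_const b x)).clm_apply
        (hasFDerivAt_const d x))
      exact this.differentiableAt
  have h1 := key c d
  have h2 := key d c
  -- The second Bianchi identity moves the frame vector from the differentiating slot into a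
  -- curvature slot, where its trace is a derivative of the Ricci tensor.
  have h3 : ∀ i, s i * G x (e i) (nablaCurvature Γ x (e i) c d b) =
      s i * G x (e i) (nablaCurvature Γ x c (e i) d b)
        - s i * G x (e i) (nablaCurvature Γ x d (e i) c b) := by
    intro i
    have hb := h.bianchi_second (e i) c d b
    have ha : nablaCurvature Γ x c d (e i) b = -nablaCurvature Γ x c (e i) d b := by
      have : fderiv ℝ (curvature Γ) x c d (e i) b = -fderiv ℝ (curvature Γ) x c (e i) d b := by
        rw [fderiv_curvature_eq h.smooth_conn, fderiv_curvature_eq h.smooth_conn]; abel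
      simp only [nablaCurvature]
      rw [this, curvature_antisymm Γ x d (e i), curvature_antisymm Γ x (Γ x c d) (e i),
        curvature_antisymm Γ x d (Γ x c (e i)), curvature_antisymm Γ x d (e i)]
      simp only [map_neg]
      abel
    rw [ha] at hb
    have : nablaCurvature Γ x (e i) c d b =
        nablaCurvature Γ x c (e i) d b - nablaCurvature Γ x d (e i) c b := by
      rw [← sub_eq_zero, ← hb]; abel
    rw [this, map_sub, mul_sub]
  simp only [h3, Finset.sum_sub_distrib, h1, h2, sub_zero]

end Trace

/-! ### Induced connections and naturality of the curvature -/

section Pullback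

variable {f : U → V} {γ : U → U →L[ℝ] U →L[ℝ] ℝ} {Γ' : U → U →L[ℝ] U →L[ℝ] U} {y : U}

/-- The tangential part of the second derivative of `f` is given by the induced connection. -/
lemma metric_gauss (h : IsLocalMetric G Γ (f y)) (h' : IsLocalMetric γ Γ' y)
    (hf : ContDiffAt ℝ ∞ f y)
    (hγ : ∀ᶠ z in 𝓝 y, ∀ u v, γ z u v = G (f z) (fderiv ℝ f z u) (fderiv ℝ f z v)) (u v w : U) :
    G (f y) (fderiv ℝ (fderiv ℝ f) y u v + Γ (f y) (fderiv ℝ f y u) (fderiv ℝ f y v))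
      (fderiv ℝ f y w) = γ y (Γ' y u v) w := by
  have hG : HasFDerivAt (fun z => G (f z)) _ y := h.smooth.diffAt.hasFDerivAt.comp y
    hf.diffAt.hasFDerivAt
  have hf' : ∀ u, HasFDerivAt (fun z => fderiv ℝ f z u) _ y := fun u =>
    hf.fderiv_infty.diffAt.hasFDerivAt.clm_apply (hasFDerivAt_const u y)
  have key : ∀ w u v, fderiv ℝ γ y w u v =
      fderiv ℝ G (f y) (fderiv ℝ f y w) (fderiv ℝ f y u) (fderiv ℝ f y v)
      + G (f y) (fderiv ℝ (fderiv ℝ f) y w u) (fderiv ℝ f y v)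
      + G (f y) (fderiv ℝ f y u) (fderiv ℝ (fderiv ℝ f) y w v) := by
    intro w u v
    rw [← fderiv_apply₂ h'.smooth.diffAt,
      fderiv_congr_apply (hγ.mono fun z hz => hz u v) w,
      ((hG.clm_apply (hf' u)).clm_apply (hf' v)).fderiv]
    simp
    abel
  -- With the derivatives of γ expanded, its Koszul formula is that of G on pushed-forward vectors
  -- plus second derivatives of f; symmetry of the latter leaves just 2 G(f_uv, f_w).
  have k := h'.koszul.self_of_nhds u v w
  have k' := h.koszul.self_of_nhds (fderiv ℝ f y u) (fderiv ℝ f y v) (fderiv ℝ f y w)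
  simp only [key] at k
  have s := fun a b => hf.fderiv_fderiv_symm a b
  rw [s v u, s w u, s w v] at k
  simp only [map_add, add_apply]
  have e1 := h.symm_self (fderiv ℝ f y u) (fderiv ℝ (fderiv ℝ f) y v w)
  have e2 := h.symm_self (fderiv ℝ f y v) (fderiv ℝ (fderiv ℝ f) y u w)
  linarith

/-- The hypothesis `hI` says that f is affine, ∇df = 0. Differentiating it once and antisymmetrising
eliminates the third derivatives of f and leaves the curvatures. -/
lemma curvature_pullback (hΓ : ContDiffAt ℝ ∞ Γ (f y))
    (hΓ' : ContDiffAt ℝ ∞ Γ' y) (hf : ContDiffAt ℝ ∞ f y)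
    (hI : ∀ᶠ z in 𝓝 y, ∀ u v, fderiv ℝ (fderiv ℝ f) z u v
      + Γ (f z) (fderiv ℝ f z u) (fderiv ℝ f z v) = fderiv ℝ f z (Γ' z u v)) (u v w : U) :
    curvature Γ (f y) (fderiv ℝ f y u) (fderiv ℝ f y v) (fderiv ℝ f y w) =
      fderiv ℝ f y (curvature Γ' y u v w) := by
  have hΓf : HasFDerivAt (fun z => Γ (f z)) _ y := hΓ.diffAt.hasFDerivAt.comp y
    hf.diffAt.hasFDerivAt
  have hf' : ∀ u, HasFDerivAt (fun z => fderiv ℝ f z u) _ y := fun u =>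
    hf.fderiv_infty.diffAt.hasFDerivAt.clm_apply (hasFDerivAt_const u y)
  have hf2 : ∀ u v, HasFDerivAt (fun z => fderiv ℝ (fderiv ℝ f) z u v) _ y := fun u v =>
    (hf.fderiv_infty.fderiv_infty.diffAt.hasFDerivAt.clm_apply (hasFDerivAt_const u y)).clm_apply
      (hasFDerivAt_const v y)
  have key : ∀ w u v, fderiv ℝ (fderiv ℝ (fderiv ℝ f)) y w u v
      + (fderiv ℝ Γ (f y) (fderiv ℝ f y w) (fderiv ℝ f y u) (fderiv ℝ f y v)
        + Γ (f y) (fderiv ℝ (fderiv ℝ f) y w u) (fderiv ℝ f y v)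
        + Γ (f y) (fderiv ℝ f y u) (fderiv ℝ (fderiv ℝ f) y w v)) =
      fderiv ℝ (fderiv ℝ f) y w (Γ' y u v) + fderiv ℝ f y (fderiv ℝ Γ' y w u v) := by
    intro w u v
    have h1 := fderiv_congr_apply (hI.mono fun z hz => hz u v) w
    have hL := (hf2 u v).fun_add ((hΓf.clm_apply (hf' u)).clm_apply (hf' v))
    have hR := hf.fderiv_infty.diffAt.hasFDerivAt.clm_apply
      ((hΓ'.diffAt.hasFDerivAt.clm_apply (hasFDerivAt_const u y)).clm_apply
        (hasFDerivAt_const v y))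
    rw [hL.fderiv, hR.fderiv] at h1
    simp at h1
    rw [add_comm (fderiv ℝ (fderiv ℝ f) y w (Γ' y u v)), ← h1]
    abel
  have e : ∀ u v, fderiv ℝ (fderiv ℝ f) y u v = fderiv ℝ f y (Γ' y u v)
      - Γ (f y) (fderiv ℝ f y u) (fderiv ℝ f y v) := fun u v => by
    rw [← hI.self_of_nhds u v]; abel
  have k1 := key u v w
  have k2 := key v u w
  rw [hf.fderiv_infty.fderiv_fderiv_symm v u, hf.fderiv_fderiv_symm v u] at k2
  simp only [e, map_sub] at k1 k2
  simp only [curvature_apply, map_sub, map_add]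
  have k3 := congrArg₂ (· - ·) k1 k2

  rw [← sub_eq_zero] at k3 ⊢
  rw [← k3]
  abel

end Pullback

end Calculus

/-! ### Gauss and Weingarten formulas; divergences of the electric and Codazzi parts -/

section Hypersurface

variable {V : Type*} [NormedAddCommGroup V] [NormedSpace ℝ V]
  {U : Type*} [NormedAddCommGroup U] [NormedSpace ℝ U]

/-- Orthonormality forces linear independence, so the dimension count makes the family a basis, and
pairing with e_i reads off the coordinates. -/
lemma IsOrthoFrame.of_orth {ι : Type*} [Fintype ι] [DecidableEq ι] {g : V →L[ℝ] V →L[ℝ] ℝ}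
    [FiniteDimensional ℝ V]
    {e : ι → V} {s : ι → ℝ} (sq : ∀ i, s i * s i = 1)
    (orth : ∀ i j, g (e i) (e j) = if i = j then s i else 0)
    (hcard : Fintype.card ι = Module.finrank ℝ V) : IsOrthoFrame g e s := by
  refine ⟨sq, orth, ?_⟩
  have hli : LinearIndependent ℝ e := by
    rw [Fintype.linearIndependent_iff]
    intro c hc i
    have := congrArg (fun z => g (e i) z) hc
    simp only [map_sum, map_smul, orth, smul_eq_mul, map_zero] at this
    simp at this
    rcases this with h0 | h0
    · exact h0
    · have := sq i; simp [h0] at this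
  intro z
  rcases isEmpty_or_nonempty ι with hι | hι
  · have : Subsingleton V := by
      rw [← Module.finrank_zero_iff (R := ℝ), ← hcard, Fintype.card_eq_zero]
    exact Subsingleton.elim _ _
  let b := basisOfLinearIndependentOfCardEqFinrank hli hcard
  have hb : ∀ i, b i = e i := fun i => by simp [b]
  have hz : z = ∑ i, b.repr z i • e i := by
    conv_lhs => rw [← b.sum_repr z]
    simp [hb]
  have hr : ∀ i, s i * g (e i) z = b.repr z i := by
    intro i
    conv_lhs => rw [hz]
    simp only [map_sum, map_smul, orth, smul_eq_mul]
    simp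
    rw [mul_left_comm, sq, mul_one]
  simp only [hr]
  exact hz

/-- A nondegenerate hypersurface with timelike unit normal field in a local metric. -/
structure IsLocalHypersurface (G : V → V →L[ℝ] V →L[ℝ] ℝ) (Γ : V → V →L[ℝ] V →L[ℝ] V)
    (γ : U → U →L[ℝ] U →L[ℝ] ℝ) (Γ' : U → U →L[ℝ] U →L[ℝ] U) (f N : U → V) (y : U) : Prop where
  ambient : IsLocalMetric G Γ (f y)
  induced : IsLocalMetric γ Γ' y
  smooth : ContDiffAt ℝ ∞ f y
  smooth_normal : ContDiffAt ℝ ∞ N y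
  induced_eq : ∀ᶠ z in 𝓝 y, ∀ u v, γ z u v = G (f z) (fderiv ℝ f z u) (fderiv ℝ f z v)
  unit : ∀ᶠ z in 𝓝 y, G (f z) (N z) (N z) = -1
  normal : ∀ᶠ z in 𝓝 y, ∀ u, G (f z) (N z) (fderiv ℝ f z u) = 0
  finrank : Module.finrank ℝ V = Module.finrank ℝ U + 1

/-- The covariant derivative along `f` of the vector field `A`. -/
def covAlong (Γ : V → V →L[ℝ] V →L[ℝ] V) (f A : U → V) (y w : U) : V :=
  fderiv ℝ A y w + Γ (f y) (fderiv ℝ f y w) (A y)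

/-- The extrinsic curvature. -/
def extrinsic (G : V → V →L[ℝ] V →L[ℝ] ℝ) (Γ : V → V →L[ℝ] V →L[ℝ] V) (f N : U → V)
    (y u v : U) : ℝ :=
  -G (f y) (covAlong Γ f N y u) (fderiv ℝ f y v)

/-- The electric part of the curvature. -/
def electric (G : V → V →L[ℝ] V →L[ℝ] ℝ) (Γ : V → V →L[ℝ] V →L[ℝ] V) (f N : U → V)
    (y u v : U) : ℝ :=
  G (f y) (fderiv ℝ f y u) (curvature Γ (f y) (N y) (fderiv ℝ f y v) (N y))

/-- The Codazzi part of the curvature. -/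
def codazzi (G : V → V →L[ℝ] V →L[ℝ] ℝ) (Γ : V → V →L[ℝ] V →L[ℝ] V) (f N : U → V)
    (y u k l : U) : ℝ :=
  G (f y) (fderiv ℝ f y u) (curvature Γ (f y) (fderiv ℝ f y k) (fderiv ℝ f y l) (N y))

variable {G : V → V →L[ℝ] V →L[ℝ] ℝ} {Γ : V → V →L[ℝ] V →L[ℝ] V}
  {γ : U → U →L[ℝ] U →L[ℝ] ℝ} {Γ' : U → U →L[ℝ] U →L[ℝ] U} {f N : U → V} {y : U}

lemma IsLocalMetric.fderiv_metric_along (h : IsLocalMetric G Γ (f y)) (hf : ContDiffAt ℝ ∞ f y)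
    {A B : U → V} (hA : ContDiffAt ℝ ∞ A y) (hB : ContDiffAt ℝ ∞ B y) (w : U) :
    fderiv ℝ (fun z => G (f z) (A z) (B z)) y w =
      G (f y) (covAlong Γ f A y w) (B y) + G (f y) (A y) (covAlong Γ f B y w) := by
  have hG : HasFDerivAt (fun z => G (f z)) _ y := h.smooth.diffAt.hasFDerivAt.comp y
    hf.diffAt.hasFDerivAt
  rw [((hG.clm_apply hA.diffAt.hasFDerivAt).clm_apply hB.diffAt.hasFDerivAt).fderiv]
  simp [h.compat, covAlong]
  ring

lemma covAlong_curvature (hΓ : ContDiffAt ℝ ∞ Γ (f y)) (hf : ContDiffAt ℝ ∞ f y)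
    {A B C : U → V} (hA : ContDiffAt ℝ ∞ A y) (hB : ContDiffAt ℝ ∞ B y)
    (hC : ContDiffAt ℝ ∞ C y) (w : U) :
    covAlong Γ f (fun z => curvature Γ (f z) (A z) (B z) (C z)) y w =
      nablaCurvature Γ (f y) (fderiv ℝ f y w) (A y) (B y) (C y)
      + curvature Γ (f y) (covAlong Γ f A y w) (B y) (C y)
      + curvature Γ (f y) (A y) (covAlong Γ f B y w) (C y)
      + curvature Γ (f y) (A y) (B y) (covAlong Γ f C y w) := by
  have hG : HasFDerivAt (fun z => curvature Γ (f z)) _ y :=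
    (ContDiffAt.curvature hΓ).diffAt.hasFDerivAt.comp y hf.diffAt.hasFDerivAt
  simp only [covAlong]
  rw [(((hG.clm_apply hA.diffAt.hasFDerivAt).clm_apply hB.diffAt.hasFDerivAt).clm_apply
    hC.diffAt.hasFDerivAt).fderiv]
  simp [nablaCurvature]
  abel

lemma ContDiffAt.curvature_along (hΓ : ContDiffAt ℝ ∞ Γ (f y)) (hf : ContDiffAt ℝ ∞ f y)
    {A B C : U → V} (hA : ContDiffAt ℝ ∞ A y) (hB : ContDiffAt ℝ ∞ B y)
    (hC : ContDiffAt ℝ ∞ C y) :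
    ContDiffAt ℝ ∞ (fun z => WeylCharge.curvature Γ (f z) (A z) (B z) (C z)) y :=
  ((((ContDiffAt.curvature hΓ).comp y hf).clm_apply hA).clm_apply hB).clm_apply hC

namespace IsLocalHypersurface

variable (h : IsLocalHypersurface G Γ γ Γ' f N y)
include h

lemma eventually_contDiffAt_tangent (u : U) : ContDiffAt ℝ ∞ (fun z => fderiv ℝ f z u) y :=
  h.smooth.fderiv_infty.clm_apply contDiffAt_const

lemma covAlong_tangent (w u : U) : covAlong Γ f (fun z => fderiv ℝ f z u) y w =
    fderiv ℝ (fderiv ℝ f) y w u + Γ (f y) (fderiv ℝ f y w) (fderiv ℝ f y u) := by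
  rw [covAlong, (h.smooth.fderiv_infty.diffAt.hasFDerivAt.clm_apply
    (hasFDerivAt_const u y)).fderiv]
  simp

/-- Differentiate G(N, df u) = 0. Symmetry of the extrinsic curvature follows, since ∇_w(df u) is
symmetric in w and u. -/
lemma metric_normal_covAlong_tangent (w u : U) :
    G (f y) (N y) (covAlong Γ f (fun z => fderiv ℝ f z u) y w) = extrinsic G Γ f N y w u := by
  have h1 := fderiv_congr_apply (h.normal.mono fun z hz => hz u) w
  rw [h.ambient.fderiv_metric_along h.smooth h.smooth_normal
    (h.eventually_contDiffAt_tangent u)] at h1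
  simp at h1
  rw [extrinsic]
  linarith

lemma extrinsic_symm (u v : U) : extrinsic G Γ f N y u v = extrinsic G Γ f N y v u := by
  rw [← h.metric_normal_covAlong_tangent, ← h.metric_normal_covAlong_tangent,
    h.covAlong_tangent, h.covAlong_tangent, h.smooth.fderiv_fderiv_symm, h.ambient.torsionFree]

lemma metric_normal_covAlong_normal (w : U) :
    G (f y) (N y) (covAlong Γ f N y w) = 0 := by
  have h1 := fderiv_congr_apply h.unit w
  rw [h.ambient.fderiv_metric_along h.smooth h.smooth_normal h.smooth_normal,
    h.ambient.symm_self _ (N y)] at h1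
  simp at h1
  linarith

variable [FiniteDimensional ℝ V] {ι : Type*} [Fintype ι] [DecidableEq ι] {e : ι → U}
  (he : IsOrthoFrame (γ y) e 1) (hι : Fintype.card ι = Module.finrank ℝ U)
include he hι

/-- The adapted orthonormal frame. -/
lemma ambient_frame : IsOrthoFrame (G (f y))
    (fun o : Option ι => o.elim (N y) fun i => fderiv ℝ f y (e i))
    (fun o : Option ι => o.elim (-1) fun _ => 1) := by
  have hn := h.normal.self_of_nhds
  refine IsOrthoFrame.of_orth ?_ ?_ (by rw [Fintype.card_option, hι, h.finrank])
  · rintro (_ | i) <;> simp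
  · rintro (_ | i) (_ | j)
    · simpa using h.unit.self_of_nhds
    · simpa using hn (e j)
    · simpa [h.ambient.symm_self] using hn (e i)
    · simpa [h.induced_eq.self_of_nhds] using he.orth i j

lemma ambient_ext {z z' : V} (h0 : G (f y) (N y) z = G (f y) (N y) z')
    (h1 : ∀ u, G (f y) (fderiv ℝ f y u) z = G (f y) (fderiv ℝ f y u) z') : z = z' := by
  rw [(h.ambient_frame he hι).complete z, (h.ambient_frame he hι).complete z']
  simp [Fintype.sum_option, h0, h1]

/-- The Gauss formula. -/
lemma gauss_formula (w u : U) : covAlong Γ f (fun z => fderiv ℝ f z u) y w =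
    fderiv ℝ f y (Γ' y w u) - extrinsic G Γ f N y w u • N y := by
  have hn := h.normal.self_of_nhds
  refine h.ambient_ext he hι ?_ fun v => ?_
  · rw [h.metric_normal_covAlong_tangent, map_sub, hn, map_smul, h.unit.self_of_nhds]
    simp
  · rw [h.covAlong_tangent, h.ambient.symm_self,
      metric_gauss h.ambient h.induced h.smooth h.induced_eq, map_sub, map_smul,
      h.ambient.symm_self _ (N y), hn, h.induced_eq.self_of_nhds, h.ambient.symm_self]
    simp

/-- The Weingarten formula. -/
lemma weingarten_formula (w : U) : covAlong Γ f N y w =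
    -∑ i, extrinsic G Γ f N y w (e i) • fderiv ℝ f y (e i) := by
  rw [(h.ambient_frame he hι).complete (covAlong Γ f N y w)]
  simp [Fintype.sum_option, h.metric_normal_covAlong_normal, extrinsic,
    h.ambient.symm_self (fderiv ℝ f y _)]

/-- The normal parts in the Gauss formula contribute nothing here: in the first slot they give G(N,
R(N, ·)N) = 0 and in the third R(N, N)N = 0. Only the Weingarten terms of the two normals bring in
K. -/
lemma fderiv_electric (w u v : U) : fderiv ℝ (fun z => electric G Γ f N z u v) y w =
    electric G Γ f N y (Γ' y w u) v + electric G Γ f N y u (Γ' y w v)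
    + (G (f y) (fderiv ℝ f y u)
        (nablaCurvature Γ (f y) (fderiv ℝ f y w) (N y) (fderiv ℝ f y v) (N y))
      - ∑ i, extrinsic G Γ f N y w (e i) * codazzi G Γ f N y u (e i) v
      - ∑ i, extrinsic G Γ f N y w (e i) *
        G (f y) (fderiv ℝ f y u) (curvature Γ (f y) (N y) (fderiv ℝ f y v)
          (fderiv ℝ f y (e i)))) := by
  simp only [electric, codazzi]
  rw [h.ambient.fderiv_metric_along h.smooth (h.eventually_contDiffAt_tangent u)
    (ContDiffAt.curvature_along h.ambient.smooth_conn h.smooth h.smooth_normal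
      (h.eventually_contDiffAt_tangent v) h.smooth_normal),
    covAlong_curvature h.ambient.smooth_conn h.smooth h.smooth_normal
      (h.eventually_contDiffAt_tangent v) h.smooth_normal, h.gauss_formula he hι,
    h.gauss_formula he hι, h.weingarten_formula he hι]
  have z1 := h.ambient.metric_curvature_self (N y) (fderiv ℝ f y v) (N y)
  have z2 : curvature Γ (f y) (N y) (N y) (N y) = 0 := by
    have := curvature_antisymm Γ (f y) (N y) (N y) (N y)
    rw [eq_neg_iff_add_eq_zero, ← two_smul ℝ] at this
    simpa using this
  simp only [map_sub, map_add, map_neg, map_smul, map_sum, sub_apply, neg_apply, smul_apply,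
    sum_apply, z1, z2, smul_eq_mul, mul_zero, smul_zero, sub_zero]
  ring

/-- Now the normal parts in the two slots of the 2-form survive and produce K times the electric
part; the one in the first slot still vanishes by antisymmetry. -/
lemma fderiv_codazzi (w u k l : U) : fderiv ℝ (fun z => codazzi G Γ f N z u k l) y w =
    codazzi G Γ f N y (Γ' y w u) k l + codazzi G Γ f N y u (Γ' y w k) l
      + codazzi G Γ f N y u k (Γ' y w l)
    + (G (f y) (fderiv ℝ f y u)
        (nablaCurvature Γ (f y) (fderiv ℝ f y w) (fderiv ℝ f y k) (fderiv ℝ f y l) (N y))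
      - extrinsic G Γ f N y w k * electric G Γ f N y u l
      + extrinsic G Γ f N y w l * electric G Γ f N y u k
      - ∑ i, extrinsic G Γ f N y w (e i) *
        G (f y) (fderiv ℝ f y u) (curvature Γ (f y) (fderiv ℝ f y k) (fderiv ℝ f y l)
          (fderiv ℝ f y (e i)))) := by
  simp only [electric, codazzi]
  rw [h.ambient.fderiv_metric_along h.smooth (h.eventually_contDiffAt_tangent u)
    (ContDiffAt.curvature_along h.ambient.smooth_conn h.smooth (h.eventually_contDiffAt_tangent k)
      (h.eventually_contDiffAt_tangent l) h.smooth_normal),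
    covAlong_curvature h.ambient.smooth_conn h.smooth (h.eventually_contDiffAt_tangent k)
      (h.eventually_contDiffAt_tangent l) h.smooth_normal, h.gauss_formula he hι,
    h.gauss_formula he hι, h.gauss_formula he hι, h.weingarten_formula he hι]
  have z1 := h.ambient.metric_curvature_self (fderiv ℝ f y k) (fderiv ℝ f y l) (N y)
  rw [curvature_antisymm Γ (f y) (N y) (fderiv ℝ f y k) (N y)]
  simp only [map_sub, map_add, map_neg, map_smul, map_sum, sub_apply, smul_apply,
    z1, smul_eq_mul, mul_zero]
  rw [curvature_antisymm Γ (f y) (fderiv ℝ f y k) (N y) (N y)]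
  simp only [map_neg]
  ring

/-- The contracted Bianchi identity in the adapted frame has one more term, in the normal direction,
and that term is G(N, (∇_N R)(c, d)N) = 0. -/
lemma sum_metric_nablaCurvature {Λ : ℝ}
    (hric : ∀ᶠ x in 𝓝 (f y), ∀ b d, ricciTrace Γ x b d = Λ * G x b d) (c d : V) :
    ∑ i, G (f y) (fderiv ℝ f y (e i))
      (nablaCurvature Γ (f y) (fderiv ℝ f y (e i)) c d (N y)) = 0 := by
  have h1 := h.ambient.contracted_bianchi hric (h.ambient_frame he hι) c d (N y)
  simpa [Fintype.sum_option, h.ambient.metric_nablaCurvature_self] using h1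

omit [FiniteDimensional ℝ V] [DecidableEq ι] he hι in
-- A symmetric tensor is contracted with an antisymmetric one.
lemma sum_extrinsic_antisymm (c d : V) :
    ∑ i, ∑ j, extrinsic G Γ f N y (e i) (e j) *
        G (f y) (fderiv ℝ f y (e i)) (curvature Γ (f y) c d (fderiv ℝ f y (e j))) = 0 := by
  have h1 : ∑ i, ∑ j, extrinsic G Γ f N y (e i) (e j) *
        G (f y) (fderiv ℝ f y (e i)) (curvature Γ (f y) c d (fderiv ℝ f y (e j))) =
      -∑ i, ∑ j, extrinsic G Γ f N y (e i) (e j) *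
        G (f y) (fderiv ℝ f y (e i)) (curvature Γ (f y) c d (fderiv ℝ f y (e j))) := by
    conv_lhs => rw [Finset.sum_comm]
    simp only [← Finset.sum_neg_distrib]
    refine Finset.sum_congr rfl fun i _ => Finset.sum_congr rfl fun j _ => ?_
    rw [h.extrinsic_symm (e j), h.ambient.metric_curvature_antisymm']
    ring
  linarith

/-- The divergence of the electric part. -/
lemma divergence_electric {Λ : ℝ}
    (hric : ∀ᶠ x in 𝓝 (f y), ∀ b d, ricciTrace Γ x b d = Λ * G x b d) (v : U) :
    ∑ i, (fderiv ℝ (fun z => electric G Γ f N z (e i) v) y (e i)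
      - electric G Γ f N y (Γ' y (e i) (e i)) v - electric G Γ f N y (e i) (Γ' y (e i) v)) =
    -∑ i, ∑ j, extrinsic G Γ f N y (e i) (e j) * codazzi G Γ f N y (e i) (e j) v := by
  have h1 := h.sum_metric_nablaCurvature he hι hric (N y) (fderiv ℝ f y v)
  have h2 := h.sum_extrinsic_antisymm (e := e) (N y) (fderiv ℝ f y v)
  simp only [h.fderiv_electric he hι]
  -- Both the ambient divergence and the contraction of K with the antisymmetric index pair vanish;
  -- removing them from the differentiated expression leaves only K against the Codazzi part.
  have h3 := congrArg₂ (· - ·) h1 h2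
  simp only [sub_self] at h3
  rw [← sub_eq_zero, ← h3, sub_neg_eq_add]
  simp only [← Finset.sum_sub_distrib, ← Finset.sum_add_distrib]
  refine Finset.sum_congr rfl fun i _ => ?_
  ring

/-- The divergence of the Codazzi part. -/
lemma divergence_codazzi {Λ : ℝ}
    (hric : ∀ᶠ x in 𝓝 (f y), ∀ b d, ricciTrace Γ x b d = Λ * G x b d) (k l : U) :
    ∑ i, (fderiv ℝ (fun z => codazzi G Γ f N z (e i) k l) y (e i)
      - codazzi G Γ f N y (Γ' y (e i) (e i)) k l - codazzi G Γ f N y (e i) (Γ' y (e i) k) l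
      - codazzi G Γ f N y (e i) k (Γ' y (e i) l)) =
    ∑ i, (extrinsic G Γ f N y (e i) l * electric G Γ f N y (e i) k
      - extrinsic G Γ f N y (e i) k * electric G Γ f N y (e i) l) := by
  have h1 := h.sum_metric_nablaCurvature he hι hric (fderiv ℝ f y k) (fderiv ℝ f y l)
  have h2 := h.sum_extrinsic_antisymm (e := e) (fderiv ℝ f y k) (fderiv ℝ f y l)
  simp only [h.fderiv_codazzi he hι]
  have h3 := congrArg₂ (· - ·) h1 h2
  simp only [sub_self] at h3
  rw [← sub_eq_zero, ← h3]
  simp only [← Finset.sum_sub_distrib]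
  refine Finset.sum_congr rfl fun i _ => ?_
  ring

end IsLocalHypersurface

end Hypersurface

/-! ### Dictionary between component matrices and multilinear maps -/

section Coordinates

variable {n : ℕ}

local notation "𝔼" => EuclideanSpace ℝ (Fin n)

/-- The standard basis vector. -/
abbrev stdVec {n : ℕ} (i : Fin n) : EuclideanSpace ℝ (Fin n) := EuclideanSpace.single i 1

lemma euclidean_sum (u : 𝔼) : u = ∑ i, u i • stdVec i := by
  ext j
  simp [stdVec, Pi.single_apply]

lemma euclidean_induction {P : 𝔼 → Prop} (h0 : P 0) (hs : ∀ i, P (stdVec i))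
    (ha : ∀ u v, P u → P v → P (u + v)) (hc : ∀ (c : ℝ) u, P u → P (c • u)) (u : 𝔼) : P u := by
  rw [euclidean_sum u]
  exact Finset.sum_induction _ P ha h0 fun i _ => hc _ _ (hs i)

/-- The bilinear form with a given matrix. -/
def matBil (m : Matrix (Fin n) (Fin n) ℝ) : 𝔼 →L[ℝ] 𝔼 →L[ℝ] ℝ :=
  ∑ i, ∑ j, m i j • (EuclideanSpace.proj i : 𝔼 →L[ℝ] ℝ).smulRight
    (EuclideanSpace.proj j : 𝔼 →L[ℝ] ℝ)

lemma matBil_apply (m : Matrix (Fin n) (Fin n) ℝ) (u v : 𝔼) :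
    matBil m u v = ∑ i, ∑ j, m i j * (u i * v j) := by
  simp [matBil, sum_apply]

@[simp] lemma matBil_stdVec (m : Matrix (Fin n) (Fin n) ℝ) (i j : Fin n) :
    matBil m (stdVec i) (stdVec j) = m i j := by
  simp [matBil_apply, stdVec]

lemma matBil_eq_of_stdVec {m : Matrix (Fin n) (Fin n) ℝ} {B : 𝔼 →ₗ[ℝ] 𝔼 →ₗ[ℝ] ℝ}
    (h : ∀ i j, m i j = B (stdVec i) (stdVec j)) (u v : 𝔼) : matBil m u v = B u v := by
  conv_rhs => rw [euclidean_sum u, euclidean_sum v]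
  simp only [map_sum, map_smul, LinearMap.sum_apply, LinearMap.smul_apply, smul_eq_mul, matBil_apply, h,
    Finset.mul_sum]
  rw [Finset.sum_comm]
  refine Finset.sum_congr rfl fun i _ => Finset.sum_congr rfl fun j _ => ?_
  ring

/-- The connection with the Christoffel symbols of a metric. -/
def matConn (Gm : 𝔼 → Matrix (Fin n) (Fin n) ℝ) (y : 𝔼) : 𝔼 →L[ℝ] 𝔼 →L[ℝ] 𝔼 :=
  ∑ k, ∑ i, ∑ j, christoffel Gm k i j y • (EuclideanSpace.proj i : 𝔼 →L[ℝ] ℝ).smulRight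
    ((EuclideanSpace.proj j : 𝔼 →L[ℝ] ℝ).smulRight (stdVec k))

lemma matConn_apply (Gm : 𝔼 → Matrix (Fin n) (Fin n) ℝ) (y u v : 𝔼) (k : Fin n) :
    matConn Gm y u v k = ∑ i, ∑ j, christoffel Gm k i j y * (u i * v j) := by
  simp [matConn, sum_apply, Pi.single_apply, stdVec]

@[simp] lemma matConn_stdVec (Gm : 𝔼 → Matrix (Fin n) (Fin n) ℝ) (y : 𝔼) (i j k : Fin n) :
    matConn Gm y (stdVec i) (stdVec j) k = christoffel Gm k i j y := by
  simp [matConn_apply, stdVec]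

lemma contDiffAt_matBil {U : Type*} [NormedAddCommGroup U] [NormedSpace ℝ U]
    {Gm : U → Matrix (Fin n) (Fin n) ℝ} {y : U}
    (h : ∀ i j, ContDiffAt ℝ ∞ (fun z => Gm z i j) y) :
    ContDiffAt ℝ ∞ (fun z => matBil (Gm z)) y := by
  unfold matBil
  exact ContDiffAt.sum fun i _ => ContDiffAt.sum fun j _ => (h i j).smul contDiffAt_const

lemma contDiffAt_det {U : Type*} [NormedAddCommGroup U] [NormedSpace ℝ U]
    {Gm : U → Matrix (Fin n) (Fin n) ℝ} {y : U}
    (h : ∀ i j, ContDiffAt ℝ ∞ (fun z => Gm z i j) y) :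
    ContDiffAt ℝ ∞ (fun z => (Gm z).det) y := by
  simp only [Matrix.det_apply']
  exact ContDiffAt.sum fun σ _ => contDiffAt_const.mul (contDiffAt_prod fun i _ => h _ _)

/-- Cramer's rule: the entries are determinants divided by the nonvanishing determinant. -/
lemma contDiffAt_matrix_inv {U : Type*} [NormedAddCommGroup U] [NormedSpace ℝ U]
    {Gm : U → Matrix (Fin n) (Fin n) ℝ} {y : U}
    (h : ∀ i j, ContDiffAt ℝ ∞ (fun z => Gm z i j) y) (hd : (Gm y).det ≠ 0) (i j : Fin n) :
    ContDiffAt ℝ ∞ (fun z => (Gm z)⁻¹ i j) y := by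
  have h1 : (fun z => (Gm z)⁻¹ i j) = fun z => ((Gm z).det)⁻¹ * (Gm z).adjugate i j := by
    funext z
    simp [Matrix.inv_def, Ring.inverse_eq_inv']
  rw [h1]
  refine ((contDiffAt_det h).inv hd).mul ?_
  simp only [Matrix.adjugate_apply]
  refine contDiffAt_det fun a b => ?_
  simp only [Matrix.updateRow_apply]
  split_ifs
  · exact contDiffAt_const
  · exact h a b

lemma contDiffAt_pd {F : 𝔼 → ℝ} {y : 𝔼} (h : ContDiffAt ℝ ∞ F y) (i : Fin n) :
    ContDiffAt ℝ ∞ (pd i F) y :=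
  h.fderiv_infty.clm_apply contDiffAt_const

lemma contDiffAt_christoffel {Gm : 𝔼 → Matrix (Fin n) (Fin n) ℝ} {y : 𝔼}
    (h : ∀ i j, ContDiffAt ℝ ∞ (fun z => Gm z i j) y) (hd : (Gm y).det ≠ 0) (k i j : Fin n) :
    ContDiffAt ℝ ∞ (christoffel Gm k i j) y := by
  unfold christoffel
  exact contDiffAt_const.mul (ContDiffAt.sum fun l _ => (contDiffAt_matrix_inv h hd k l).mul
    (((contDiffAt_pd (h j l) i).add (contDiffAt_pd (h i l) j)).sub (contDiffAt_pd (h i j) l)))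

lemma contDiffAt_matConn {Gm : 𝔼 → Matrix (Fin n) (Fin n) ℝ} {y : 𝔼}
    (h : ∀ i j, ContDiffAt ℝ ∞ (fun z => Gm z i j) y) (hd : (Gm y).det ≠ 0) :
    ContDiffAt ℝ ∞ (matConn Gm) y := by
  unfold matConn
  exact ContDiffAt.sum fun k _ => ContDiffAt.sum fun i _ => ContDiffAt.sum fun j _ =>
    (contDiffAt_christoffel h hd k i j).smul contDiffAt_const

lemma pd_eq_fderiv_matBil {Gm : 𝔼 → Matrix (Fin n) (Fin n) ℝ} {y : 𝔼}
    (h : ∀ i j, ContDiffAt ℝ ∞ (fun z => Gm z i j) y) (i j k : Fin n) :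
    pd i (fun z => Gm z j k) y =
      fderiv ℝ (fun z => matBil (Gm z)) y (stdVec i) (stdVec j) (stdVec k) := by
  rw [← fderiv_apply₂ (contDiffAt_matBil h).diffAt, pd]
  simp only [matBil_stdVec]

/-- On basis vectors lowering the upper Christoffel index cancels the inverse matrix; trilinearity
extends the formula to all vectors. -/
lemma koszul_matConn {Gm : 𝔼 → Matrix (Fin n) (Fin n) ℝ} {y : 𝔼}
    (h : ∀ i j, ContDiffAt ℝ ∞ (fun z => Gm z i j) y) (hd : (Gm y).det ≠ 0)
    (hs : ∀ i j, Gm y i j = Gm y j i) (u v w : 𝔼) :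
    2 * matBil (Gm y) (matConn Gm y u v) w =
    fderiv ℝ (fun z => matBil (Gm z)) y u v w + fderiv ℝ (fun z => matBil (Gm z)) y v u w
      - fderiv ℝ (fun z => matBil (Gm z)) y w u v := by
  have hb : ∀ i j l, 2 * matBil (Gm y) (matConn Gm y (stdVec i) (stdVec j)) (stdVec l) =
    fderiv ℝ (fun z => matBil (Gm z)) y (stdVec i) (stdVec j) (stdVec l)
      + fderiv ℝ (fun z => matBil (Gm z)) y (stdVec j) (stdVec i) (stdVec l)
      - fderiv ℝ (fun z => matBil (Gm z)) y (stdVec l) (stdVec i) (stdVec j) := by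
    intro i j l
    simp only [← pd_eq_fderiv_matBil h]
    have h1 : matBil (Gm y) (matConn Gm y (stdVec i) (stdVec j)) (stdVec l) =
        ∑ k, Gm y l k * christoffel Gm k i j y := by
      rw [matBil_apply]
      refine Finset.sum_congr rfl fun k _ => ?_
      simp [stdVec]
      rw [hs k l]; simp
    set D : Fin n → ℝ := fun m => pd i (fun z => Gm z j m) y + pd j (fun z => Gm z i m) y
      - pd m (fun z => Gm z i j) y with hD
    have h2 : (fun k => christoffel Gm k i j y) = (1 / 2 : ℝ) • (Gm y)⁻¹.mulVec D := by
      funext k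
      simp [christoffel, Matrix.mulVec, dotProduct, hD]
    have h3 : (Gm y).mulVec (fun k => christoffel Gm k i j y) l = (1 / 2) * D l := by
      rw [h2, Matrix.mulVec_smul, Matrix.mulVec_mulVec, Matrix.mul_nonsing_inv _
        (isUnit_iff_ne_zero.2 hd)]
      simp
    rw [h1]
    change 2 * (Gm y).mulVec (fun k => christoffel Gm k i j y) l = D l
    rw [h3]; ring
  induction u using euclidean_induction with
  | h0 => simp
  | ha a b h1 h2 => simp only [map_add, add_apply]; linarith
  | hc c a h1 => simp only [map_smul, smul_apply, smul_eq_mul]; linear_combination c * h1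
  | hs i =>
    induction v using euclidean_induction with
    | h0 => simp
    | ha a b h1 h2 => simp only [map_add, add_apply]; linarith
    | hc c a h1 => simp only [map_smul, smul_apply, smul_eq_mul]; linear_combination c * h1
    | hs j =>
      induction w using euclidean_induction with
      | h0 => simp
      | ha a b h1 h2 => simp only [map_add, add_apply]; linarith
      | hc c a h1 => simp only [map_smul, smul_apply, smul_eq_mul]; linear_combination c * h1
      | hs l => exact hb i j l

lemma isLocalMetric_matBil {Gm : 𝔼 → Matrix (Fin n) (Fin n) ℝ} {x : 𝔼}
    (h : ∀ᶠ y in 𝓝 x, ∀ i j, ContDiffAt ℝ ∞ (fun z => Gm z i j) y)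
    (hd : ∀ᶠ y in 𝓝 x, (Gm y).det ≠ 0)
    (hs : ∀ᶠ y in 𝓝 x, ∀ i j, Gm y i j = Gm y j i) :
    IsLocalMetric (fun y => matBil (Gm y)) (matConn Gm) x where
  eventually_smooth := h.mono fun y hy => contDiffAt_matBil hy
  eventually_smooth_conn := by
    filter_upwards [h, hd] with y h1 h2 using contDiffAt_matConn h1 h2
  symm := hs.mono fun y hy u v => by
    rw [matBil_apply, matBil_apply, Finset.sum_comm]
    refine Finset.sum_congr rfl fun i _ => Finset.sum_congr rfl fun j _ => ?_
    rw [hy i j]; ring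
  nondeg := by
    filter_upwards [hd] with y hy u hu
    have h1 : Matrix.vecMul (WithLp.ofLp u) (Gm y) = 0 := by
      funext j
      have := hu (stdVec j)
      rw [matBil_apply] at this
      simp [stdVec] at this
      simp only [Matrix.vecMul, dotProduct, Pi.zero_apply]
      rw [← this]
      exact Finset.sum_congr rfl fun i _ => mul_comm _ _
    have h2 := Matrix.eq_zero_of_vecMul_eq_zero hy h1
    ext i
    exact congrFun h2 i
  koszul := by
    filter_upwards [h, hd, hs] with y h1 h2 h3 u v w using koszul_matConn h1 h2 h3 u v w

lemma riemannUp_eq {Gm : 𝔼 → Matrix (Fin n) (Fin n) ℝ} {y : 𝔼}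
    (h : ContDiffAt ℝ ∞ (matConn Gm) y) (a b c d : Fin n) :
    riemannUp Gm a b c d y = curvature (matConn Gm) y (stdVec c) (stdVec d) (stdVec b) a := by
  have hp : ∀ c d b, pd c (christoffel Gm a d b) y =
      fderiv ℝ (matConn Gm) y (stdVec c) (stdVec d) (stdVec b) a := by
    intro c d b
    have e1 : christoffel Gm a d b = fun z => (EuclideanSpace.proj a : 𝔼 →L[ℝ] ℝ)
        (matConn Gm z (stdVec d) (stdVec b)) := by
      funext z; simp
    have e2 := (EuclideanSpace.proj a : 𝔼 →L[ℝ] ℝ).hasFDerivAt.comp y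
      ((h.diffAt.hasFDerivAt.clm_apply (hasFDerivAt_const (stdVec d) y)).clm_apply
      (hasFDerivAt_const (stdVec b) y))
    rw [pd, e1]
    refine (congrArg (fun L => L (stdVec c)) e2.fderiv).trans ?_
    simp
  have hq : ∀ c d b, matConn Gm y (stdVec c) (matConn Gm y (stdVec d) (stdVec b)) a =
      ∑ e, christoffel Gm a c e y * christoffel Gm e d b y := by
    intro c d b
    rw [matConn_apply]
    simp [stdVec]
  rw [curvature_apply, riemannUp, hp, hp]
  simp only [PiLp.sub_apply, PiLp.add_apply, hq, Finset.sum_sub_distrib]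
  ring

lemma ricci_sum_eq {Gm : 𝔼 → Matrix (Fin n) (Fin n) ℝ} {y : 𝔼}
    (h : ContDiffAt ℝ ∞ (matConn Gm) y) (b d : Fin n) :
    ∑ a, riemannUp Gm a b a d y = ricciTrace (matConn Gm) y (stdVec b) (stdVec d) := by
  rw [ricciTrace, traceL_euclidean]
  exact Finset.sum_congr rfl fun a _ => riemannUp_eq h a b a d

end Coordinates

/-! ### Orthonormal frames and index contractions -/

section Frames

variable {n : ℕ}

local notation "𝔼" => EuclideanSpace ℝ (Fin n)

/-- Completeness of the frame, written in components, says that the claimed matrix is a left inverse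
of m. -/
lemma IsOrthoFrame.matrix_inv {m : Matrix (Fin n) (Fin n) ℝ} {ι : Type*} [Fintype ι]
    [DecidableEq ι] {e : ι → 𝔼} {s : ι → ℝ}
    (h : IsOrthoFrame (matBil m) e s) (a b : Fin n) : m⁻¹ a b = ∑ i, s i * (e i a * e i b) := by
  have h1 : (Matrix.of fun a b => ∑ i, s i * (e i a * e i b)) * m = 1 := by
    ext a c
    have h2 := congrArg (fun z : 𝔼 => z a) (h.complete (stdVec c))
    simp only [matBil_apply] at h2
    simp [stdVec] at h2
    rw [Matrix.mul_apply, Matrix.one_apply, h2]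
    simp only [Matrix.of_apply, Finset.sum_mul, Finset.mul_sum]
    rw [Finset.sum_comm]
    refine Finset.sum_congr rfl fun i _ => Finset.sum_congr rfl fun j _ => ?_
    ring
  rw [Matrix.inv_eq_left_inv h1, Matrix.of_apply]

/-- Contractions with the inverse metric, as in the coordinate definitions, become sums over a
frame, which is the form used by the hypersurface computations. -/
lemma IsOrthoFrame.sum_inv {m : Matrix (Fin n) (Fin n) ℝ} {ι : Type*} [Fintype ι]
    [DecidableEq ι] {e : ι → 𝔼} {s : ι → ℝ}
    (h : IsOrthoFrame (matBil m) e s) (B : 𝔼 →ₗ[ℝ] 𝔼 →ₗ[ℝ] ℝ) :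
    ∑ a, ∑ b, m⁻¹ a b * B (stdVec a) (stdVec b) = ∑ i, s i * B (e i) (e i) := by
  have h1 : ∀ i, B (e i) (e i) = ∑ a, ∑ b, e i a * e i b * B (stdVec a) (stdVec b) := by
    intro i
    rw [← matBil_eq_of_stdVec (m := Matrix.of fun a b => B (stdVec a) (stdVec b))
      (fun _ _ => rfl), matBil_apply]
    refine Finset.sum_congr rfl fun a _ => Finset.sum_congr rfl fun b _ => ?_
    simp; ring
  simp only [h1, h.matrix_inv, Finset.sum_mul, Finset.mul_sum]
  rw [Finset.sum_comm' (t' := Finset.univ) (s' := fun _ => Finset.univ) (by simp)]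
  refine (Finset.sum_congr rfl fun b _ => Finset.sum_comm).trans ?_
  rw [Finset.sum_comm]
  refine Finset.sum_congr rfl fun i _ => ?_
  rw [Finset.sum_comm]
  refine Finset.sum_congr rfl fun a _ => Finset.sum_congr rfl fun b _ => ?_
  ring

lemma exists_orthoFrame {m : Matrix (Fin n) (Fin n) ℝ} (h : m.PosDef) :
    ∃ e : Fin n → 𝔼, IsOrthoFrame (matBil m) e 1 := by
  open scoped MatrixOrder in
  obtain ⟨a, ha⟩ := CStarAlgebra.nonneg_iff_eq_star_mul_self.mp h.posSemidef.nonneg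
  have hu : IsUnit a.det := by
    have h1 := h.det_pos
    rw [ha, Matrix.star_eq_conjTranspose, Matrix.det_mul] at h1
    exact isUnit_iff_ne_zero.2 (right_ne_zero_of_mul h1.ne')
  -- Since m = aᵀa, the columns of a⁻¹ are orthonormal for m.
  refine ⟨fun i => WithLp.toLp 2 fun j => a⁻¹ j i, IsOrthoFrame.of_orth (by simp) ?_ (by simp)⟩
  intro i j
  have h1 : (a⁻¹).transpose * m * a⁻¹ = 1 := by
    rw [ha, Matrix.star_eq_conjTranspose, Matrix.conjTranspose_eq_transpose_of_trivial]
    rw [← Matrix.mul_assoc, ← Matrix.transpose_mul, Matrix.mul_assoc, Matrix.mul_nonsing_inv _ hu]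
    simp
  have h2 := congrFun (congrFun h1 i) j
  rw [Matrix.one_apply] at h2
  rw [show (1 : Fin n → ℝ) i = 1 from rfl, ← h2, matBil_apply, Matrix.mul_assoc, Matrix.mul_apply]
  refine Finset.sum_congr rfl fun k _ => ?_
  simp only [Matrix.mul_apply, Matrix.transpose_apply, Finset.mul_sum]
  refine Finset.sum_congr rfl fun l _ => ?_
  ring

end Frames

section Tensor

variable {U : Type*} [NormedAddCommGroup U] [NormedSpace ℝ U]

/-- The covariant derivative `(∇_w T)(u, v)`. -/
def nablaTensor (Γ : U → U →L[ℝ] U →L[ℝ] U) (T : U → U →L[ℝ] U →L[ℝ] ℝ) (y w u v : U) : ℝ :=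
  fderiv ℝ T y w u v - T y (Γ y w u) v - T y u (Γ y w v)

end Tensor

/-! ### Determinants and volume densities in dimension three -/

section Three

local notation "𝔼³" => EuclideanSpace ℝ (Fin 3)

/-- The determinant of three vectors. -/
def det3 (a b c : 𝔼³) : ℝ :=
  a 0 * (b 1 * c 2 - b 2 * c 1) - a 1 * (b 0 * c 2 - b 2 * c 0) + a 2 * (b 0 * c 1 - b 1 * c 0)

/-- An endomorphism acts as a derivation on top-degree forms by its trace. It is used both for the
parallelism of the volume form and for the closedness of the flux form. -/
lemma det3_derivation (A : 𝔼³ →L[ℝ] 𝔼³) (a b c : 𝔼³) :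
    det3 (A a) b c + det3 a (A b) c + det3 a b (A c) = (∑ l, A (stdVec l) l) * det3 a b c := by
  have h : ∀ (z : 𝔼³) i, A z i = z 0 * A (stdVec 0) i + z 1 * A (stdVec 1) i
      + z 2 * A (stdVec 2) i := by
    intro z i
    conv_lhs => rw [euclidean_sum z]
    simp [Fin.sum_univ_three]
  simp only [det3, h a, h b, h c, Fin.sum_univ_three]
  ring

variable {m : Matrix (Fin 3) (Fin 3) ℝ} {e : Fin 3 → 𝔼³} {w : ℝ}

lemma IsOrthoFrame.det3_sq (h : IsOrthoFrame (matBil m) e 1) (hw : w ^ 2 = m.det) :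
    (w * det3 (e 0) (e 1) (e 2)) ^ 2 = 1 := by
  let P : Matrix (Fin 3) (Fin 3) ℝ := Matrix.of fun i a => e i a
  have h1 : P * m * P.transpose = 1 := by
    ext i j
    have h2 := h.orth i j
    rw [matBil_apply] at h2
    rw [Matrix.one_apply, show (if i = j then (1 : ℝ) else 0) = if i = j then (1 : Fin 3 → ℝ) i else 0
      from rfl, ← h2, Matrix.mul_assoc, Matrix.mul_apply]
    refine Finset.sum_congr rfl fun a _ => ?_
    simp only [Matrix.mul_apply, Finset.mul_sum]
    refine Finset.sum_congr rfl fun b _ => ?_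
    simp [P]; ring
  have h2 := congrArg Matrix.det h1
  rw [Matrix.det_mul, Matrix.det_mul, Matrix.det_transpose, Matrix.det_one] at h2
  have h3 : P.det = det3 (e 0) (e 1) (e 2) := by
    rw [Matrix.det_fin_three]; simp [P, det3]; ring
  rw [h3, ← hw] at h2
  rw [← h2]; ring

/-- The identity ε_{abc} ε_d{}^{bc} = 2 γ_{ad}, the volume form being normalised by `hw`. -/
lemma IsOrthoFrame.sum_det3_mul_det3 (h : IsOrthoFrame (matBil m) e 1) (hw : w ^ 2 = m.det)
    (u v : 𝔼³) : ∑ b, ∑ c, (w * det3 u (e b) (e c)) * (w * det3 v (e b) (e c)) =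
      2 * matBil m u v := by
  obtain ⟨p, hp⟩ : ∃ p : Fin 3 → ℝ, u = p 0 • e 0 + p 1 • e 1 + p 2 • e 2 :=
    ⟨fun i => matBil m (e i) u, by simpa [Fin.sum_univ_three] using h.complete u⟩
  obtain ⟨q, hq⟩ : ∃ q : Fin 3 → ℝ, v = q 0 • e 0 + q 1 • e 1 + q 2 • e 2 :=
    ⟨fun i => matBil m (e i) v, by simpa [Fin.sum_univ_three] using h.complete v⟩
  have h1 := h.det3_sq hw
  have h2 : matBil m u v = p 0 * q 0 + p 1 * q 1 + p 2 * q 2 := by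
    rw [hp, hq]
    simp [h.orth]
  have hd : ∀ b c, det3 (e b) (e b) (e c) = 0 ∧ det3 (e b) (e c) (e b) = 0 ∧
    det3 (e b) (e c) (e c) = 0 := fun b c => by refine ⟨?_, ?_, ?_⟩ <;> (simp only [det3]; ring)
  have hl : ∀ (r : Fin 3 → ℝ) (x y : 𝔼³), det3 (r 0 • e 0 + r 1 • e 1 + r 2 • e 2) x y =
      r 0 * det3 (e 0) x y + r 1 * det3 (e 1) x y + r 2 * det3 (e 2) x y := by
    intro r x y; simp [det3]; ring
  have h021 : det3 (e 0) (e 2) (e 1) = -det3 (e 0) (e 1) (e 2) := by simp only [det3]; ring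
  have h102 : det3 (e 1) (e 0) (e 2) = -det3 (e 0) (e 1) (e 2) := by simp only [det3]; ring
  have h120 : det3 (e 1) (e 2) (e 0) = det3 (e 0) (e 1) (e 2) := by simp only [det3]; ring
  have h201 : det3 (e 2) (e 0) (e 1) = det3 (e 0) (e 1) (e 2) := by simp only [det3]; ring
  have h210 : det3 (e 2) (e 1) (e 0) = -det3 (e 0) (e 1) (e 2) := by simp only [det3]; ring
  rw [h2, hp, hq]
  simp only [hl, Fin.sum_univ_three, h021, h102, h120, h201, h210,
    (hd _ _).1, (hd _ _).2.1, (hd _ _).2.2]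
  linear_combination 2 * (p 0 * q 0 + p 1 * q 1 + p 2 * q 2) * h1

variable {γ : 𝔼³ → Matrix (Fin 3) (Fin 3) ℝ} {ρ : 𝔼³ → ℝ} {y : 𝔼³}

/-- `ρ` is the density of a volume form of the metric `γ` near `y`. -/
structure IsLocalVolume (γ : 𝔼³ → Matrix (Fin 3) (Fin 3) ℝ) (Γ : 𝔼³ → 𝔼³ →L[ℝ] 𝔼³ →L[ℝ] 𝔼³)
    (ρ : 𝔼³ → ℝ) (y : 𝔼³) : Prop where
  metric : IsLocalMetric (fun z => matBil (γ z)) Γ y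
  smooth : ContDiffAt ℝ ∞ ρ y
  sq : ∀ᶠ z in 𝓝 y, ρ z ^ 2 = (γ z).det
  ne_zero : ρ y ≠ 0

/-- Continuity and nonvanishing fix the sign near y, so ρ is locally either √D or −√D. -/
lemma contDiffAt_of_sq {U : Type*} [NormedAddCommGroup U] [NormedSpace ℝ U] {ρ D : U → ℝ} {y : U}
    (hρ : ContinuousAt ρ y) (hD : ContDiffAt ℝ ∞ D y)
    (h : ∀ᶠ z in 𝓝 y, ρ z ^ 2 = D z) (h0 : ρ y ≠ 0) : ContDiffAt ℝ ∞ ρ y := by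
  have hD0 : D y ≠ 0 := by rw [← h.self_of_nhds]; positivity
  have hs := hD.sqrt hD0
  rcases lt_or_gt_of_ne h0 with h1 | h1
  · refine hs.neg.congr_of_eventuallyEq ?_
    filter_upwards [h, hρ.eventually_lt continuousAt_const h1] with z hz1 hz2
    rw [← hz1, Real.sqrt_sq_eq_abs, abs_of_neg hz2, neg_neg]
  · refine hs.congr_of_eventuallyEq ?_
    filter_upwards [h, continuousAt_const.eventually_lt hρ h1] with z hz1 hz2
    rw [← hz1, Real.sqrt_sq_eq_abs, abs_of_pos hz2]

variable {Γ : 𝔼³ → 𝔼³ →L[ℝ] 𝔼³ →L[ℝ] 𝔼³}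

/-- The volume form is parallel: differentiate ρ² = det γ, use metric compatibility, and divide by
2ρ. -/
lemma IsLocalVolume.fderiv_density (h : IsLocalVolume γ Γ ρ y) (k : 𝔼³) :
    fderiv ℝ ρ y k = (∑ l, Γ y k (stdVec l) l) * ρ y := by
  have hG : HasFDerivAt (fun z => matBil (γ z)) _ y := h.metric.smooth.diffAt.hasFDerivAt
  have hij : ∀ i j, HasFDerivAt (fun z => γ z i j) _ y := fun i j => by
    simpa only [matBil_stdVec] using (hG.clm_apply (hasFDerivAt_const (stdVec i) y)).clm_apply
      (hasFDerivAt_const (stdVec j) y)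
  have hval : ∀ i j, fderiv ℝ (fun z => γ z i j) y k =
      ∑ l, (Γ y k (stdVec i) l * γ y l j + Γ y k (stdVec j) l * γ y i l) := by
    intro i j
    have h1 := fderiv_apply₂ h.metric.smooth.diffAt k (stdVec i) (stdVec j)
    simp only [matBil_stdVec] at h1
    rw [h1, h.metric.compat, matBil_apply, matBil_apply, Finset.sum_add_distrib]
    congr 1
    · refine Finset.sum_congr rfl fun l _ => ?_
      simp [stdVec]; ring
    · rw [Finset.sum_comm]
      refine Finset.sum_congr rfl fun l _ => ?_
      simp [stdVec]; ring
  have hd : ∀ i j, HasFDerivAt (fun z => γ z i j) (fderiv ℝ (fun z => γ z i j) y) y :=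
    fun i j => (hij i j).differentiableAt.hasFDerivAt
  have h2 : (fun z => ρ z * ρ z) =ᶠ[𝓝 y] fun z => γ z 0 0 * γ z 1 1 * γ z 2 2
      - γ z 0 0 * γ z 1 2 * γ z 2 1 - γ z 0 1 * γ z 1 0 * γ z 2 2 + γ z 0 1 * γ z 1 2 * γ z 2 0
      + γ z 0 2 * γ z 1 0 * γ z 2 1 - γ z 0 2 * γ z 1 1 * γ z 2 0 := by
    filter_upwards [h.sq] with z hz
    rw [← pow_two, hz, Matrix.det_fin_three]
  have h3 := fderiv_congr_apply h2 k
  have hρ := h.smooth.diffAt.hasFDerivAt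
  rw [(hρ.fun_mul hρ).fderiv, (((((((hd 0 0).fun_mul (hd 1 1)).fun_mul (hd 2 2)).fun_sub
    (((hd 0 0).fun_mul (hd 1 2)).fun_mul (hd 2 1))).fun_sub
    (((hd 0 1).fun_mul (hd 1 0)).fun_mul (hd 2 2))).fun_add
    (((hd 0 1).fun_mul (hd 1 2)).fun_mul (hd 2 0))).fun_add
    (((hd 0 2).fun_mul (hd 1 0)).fun_mul (hd 2 1))).fun_sub
    (((hd 0 2).fun_mul (hd 1 1)).fun_mul (hd 2 0)) |>.fderiv] at h3
  simp only [add_apply, sub_apply, smul_apply, smul_eq_mul, hval, Fin.sum_univ_three] at h3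
  have h4 := h2.self_of_nhds
  simp only at h4
  have h5 : 2 * ρ y * fderiv ℝ ρ y k = 2 * ρ y * ((∑ l, Γ y k (stdVec l) l) * ρ y) := by
    rw [Fin.sum_univ_three]
    linear_combination h3 - 2 * (Γ y k (stdVec 0) 0 + Γ y k (stdVec 1) 1 + Γ y k (stdVec 2) 2) * h4
  exact mul_left_cancel₀ (mul_ne_zero two_ne_zero h.ne_zero) h5

end Three

/-! ### The magnetic part as the dual of the Codazzi part -/

section Magnetic

local notation "𝔼³" => EuclideanSpace ℝ (Fin 3)

variable {V : Type*} [NormedAddCommGroup V] [NormedSpace ℝ V]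
  {G : V → V →L[ℝ] V →L[ℝ] ℝ} {Γ : V → V →L[ℝ] V →L[ℝ] V}
  {γ : 𝔼³ → Matrix (Fin 3) (Fin 3) ℝ} {Γ' : 𝔼³ → 𝔼³ →L[ℝ] 𝔼³ →L[ℝ] 𝔼³} {f N : 𝔼³ → V} {y : 𝔼³}
  {ρ : 𝔼³ → ℝ}

/-- The vector dual to the Codazzi part of the curvature. -/
def magneticVec (G : V → V →L[ℝ] V →L[ℝ] ℝ) (Γ : V → V →L[ℝ] V →L[ℝ] V) (f N : 𝔼³ → V)
    (ρ : 𝔼³ → ℝ) (z u : 𝔼³) : 𝔼³ :=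
  (ρ z)⁻¹ • (codazzi G Γ f N z u (stdVec 1) (stdVec 2) • stdVec 0
    + codazzi G Γ f N z u (stdVec 2) (stdVec 0) • stdVec 1
    + codazzi G Γ f N z u (stdVec 0) (stdVec 1) • stdVec 2)

/-- The magnetic part of the curvature. -/
def magnetic (G : V → V →L[ℝ] V →L[ℝ] ℝ) (Γ : V → V →L[ℝ] V →L[ℝ] V)
    (γ : 𝔼³ → Matrix (Fin 3) (Fin 3) ℝ) (f N : 𝔼³ → V) (ρ : 𝔼³ → ℝ) (z u v : 𝔼³) : ℝ :=
  matBil (γ z) (magneticVec G Γ f N ρ z u) v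

lemma codazzi_antisymm (z u k l : 𝔼³) :
    codazzi G Γ f N z u k l = -codazzi G Γ f N z u l k := by
  rw [codazzi, curvature_antisymm, map_neg, codazzi]

/-- In dimension three every 2-form is the contraction of the volume form with a unique vector; here
the 2-form is in the last two arguments. -/
lemma codazzi_eq_det3 {z : 𝔼³} (hρ : ρ z ≠ 0) (u k l : 𝔼³) :
    codazzi G Γ f N z u k l = ρ z * det3 (magneticVec G Γ f N ρ z u) k l := by
  have h : codazzi G Γ f N z u k l = ∑ i, ∑ j, k i * l j *
      codazzi G Γ f N z u (stdVec i) (stdVec j) := by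
    simp only [codazzi]
    conv_lhs => rw [euclidean_sum k, euclidean_sum l]
    simp only [map_sum, map_smul, sum_apply, smul_apply, smul_eq_mul, Finset.mul_sum]
    rw [Finset.sum_comm]
    refine Finset.sum_congr rfl fun i _ => Finset.sum_congr rfl fun j _ => ?_
    ring
  have h0 : ∀ a, codazzi G Γ f N z u a a = 0 := fun a => by
    linarith [codazzi_antisymm (G := G) (Γ := Γ) (f := f) (N := N) z u a a]
  have h1 := codazzi_antisymm (G := G) (Γ := Γ) (f := f) (N := N) z u
  rw [h]
  simp only [Fin.sum_univ_three, h0, h1 (stdVec 2) (stdVec 1), h1 (stdVec 0) (stdVec 2),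
    h1 (stdVec 1) (stdVec 0)]
  simp [det3, magneticVec, stdVec]
  field_simp
  ring

namespace IsLocalHypersurface

variable (h : IsLocalHypersurface G Γ (fun z => matBil (γ z)) Γ' f N y)
  (hv : IsLocalVolume γ Γ' ρ y)
include h

lemma contDiffAt_codazzi (u k l : 𝔼³) : ContDiffAt ℝ ∞ (fun z => codazzi G Γ f N z u k l) y :=
  ((h.ambient.smooth.comp y h.smooth).clm_apply (h.eventually_contDiffAt_tangent u)).clm_apply
    (ContDiffAt.curvature_along h.ambient.smooth_conn h.smooth (h.eventually_contDiffAt_tangent k)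
      (h.eventually_contDiffAt_tangent l) h.smooth_normal)

lemma contDiffAt_electric (u v : 𝔼³) : ContDiffAt ℝ ∞ (fun z => electric G Γ f N z u v) y :=
  ((h.ambient.smooth.comp y h.smooth).clm_apply (h.eventually_contDiffAt_tangent u)).clm_apply
    (ContDiffAt.curvature_along h.ambient.smooth_conn h.smooth h.smooth_normal
      (h.eventually_contDiffAt_tangent v) h.smooth_normal)

include hv

lemma contDiffAt_magneticVec (u : 𝔼³) :
    ContDiffAt ℝ ∞ (fun z => magneticVec G Γ f N ρ z u) y := by
  unfold magneticVec
  exact (hv.smooth.inv hv.ne_zero).smul ((((h.contDiffAt_codazzi _ _ _).smul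
    contDiffAt_const).add ((h.contDiffAt_codazzi _ _ _).smul contDiffAt_const)).add
    ((h.contDiffAt_codazzi _ _ _).smul contDiffAt_const))

lemma contDiffAt_magnetic (u v : 𝔼³) :
    ContDiffAt ℝ ∞ (fun z => magnetic G Γ γ f N ρ z u v) y :=
  (h.induced.smooth.clm_apply (h.contDiffAt_magneticVec hv u)).clm_apply contDiffAt_const

/-- The covariant derivative of the magnetic part, as a vector. -/
lemma fderiv_magnetic (w u v : 𝔼³) : fderiv ℝ (fun z => magnetic G Γ γ f N ρ z u v) y w
    - magnetic G Γ γ f N ρ y (Γ' y w u) v - magnetic G Γ γ f N ρ y u (Γ' y w v) =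
    matBil (γ y) (fderiv ℝ (fun z => magneticVec G Γ f N ρ z u) y w
      + Γ' y w (magneticVec G Γ f N ρ y u) - magneticVec G Γ f N ρ y (Γ' y w u)) v := by
  simp only [magnetic]
  rw [((h.induced.smooth.diffAt.hasFDerivAt.clm_apply
    (h.contDiffAt_magneticVec hv u).diffAt.hasFDerivAt).clm_apply
    (hasFDerivAt_const v y)).fderiv]
  simp [h.induced.compat]
  ring

/-- Dualisation commutes with covariant differentiation: the derivative of ρ supplies exactly the
trace that `det3_derivation` distributes over the three slots. -/
lemma fderiv_codazzi_eq_det3 (w u k l : 𝔼³) : fderiv ℝ (fun z => codazzi G Γ f N z u k l) y w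
    - codazzi G Γ f N y (Γ' y w u) k l - codazzi G Γ f N y u (Γ' y w k) l
      - codazzi G Γ f N y u k (Γ' y w l) =
    ρ y * det3 (fderiv ℝ (fun z => magneticVec G Γ f N ρ z u) y w
      + Γ' y w (magneticVec G Γ f N ρ y u) - magneticVec G Γ f N ρ y (Γ' y w u)) k l := by
  have h1 : (fun z => codazzi G Γ f N z u k l) =ᶠ[𝓝 y]
      fun z => ρ z * det3 (magneticVec G Γ f N ρ z u) k l := by
    filter_upwards [hv.smooth.continuousAt.eventually_ne hv.ne_zero] with z hz
    exact codazzi_eq_det3 hz u k l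
  have hm := (h.contDiffAt_magneticVec hv u).diffAt.hasFDerivAt
  have hi : ∀ i, HasFDerivAt (fun z => magneticVec G Γ f N ρ z u i)
      ((EuclideanSpace.proj i : 𝔼³ →L[ℝ] ℝ).comp
        (fderiv ℝ (fun z => magneticVec G Γ f N ρ z u) y)) y := fun i =>
    (EuclideanSpace.proj i : 𝔼³ →L[ℝ] ℝ).hasFDerivAt.comp y hm
  have h2 : HasFDerivAt (fun z => det3 (magneticVec G Γ f N ρ z u) k l) _ y :=
    (((hi 0).mul_const (k 1 * l 2 - k 2 * l 1)).fun_sub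
      ((hi 1).mul_const (k 0 * l 2 - k 2 * l 0))).fun_add
      ((hi 2).mul_const (k 0 * l 1 - k 1 * l 0))
  rw [fderiv_congr_apply h1 w, (hv.smooth.diffAt.hasFDerivAt.fun_mul h2).fderiv,
    codazzi_eq_det3 hv.ne_zero, codazzi_eq_det3 hv.ne_zero, codazzi_eq_det3 hv.ne_zero]
  have h3 := det3_derivation (Γ' y w) (magneticVec G Γ f N ρ y u) k l
  simp only [add_apply, smul_apply, smul_eq_mul, hv.fderiv_density, sub_apply,
    ContinuousLinearMap.comp_apply, PiLp.proj_apply]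
  rw [mul_comm _ (ρ y), mul_comm (det3 _ _ _), mul_assoc, ← h3]
  simp only [det3, PiLp.sub_apply, PiLp.add_apply]
  ring

variable [FiniteDimensional ℝ V] {e : Fin 3 → 𝔼³} (he : IsOrthoFrame (matBil (γ y)) e 1)
include he

omit h [FiniteDimensional ℝ V] in
-- This form matches the contraction with ε in the definition of the dual Weyl tensor.
lemma magnetic_eq_sum (u v : 𝔼³) : magnetic G Γ γ f N ρ y u v =
    (1 / 2) * ∑ k, ∑ l, codazzi G Γ f N y u (e k) (e l) * (ρ y * det3 v (e k) (e l)) := by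
  simp only [codazzi_eq_det3 hv.ne_zero]
  rw [he.sum_det3_mul_det3 hv.sq.self_of_nhds, magnetic]
  ring

/-- The divergence of the magnetic part. -/
lemma divergence_magnetic {Λ : ℝ}
    (hric : ∀ᶠ x in 𝓝 (f y), ∀ b d, ricciTrace Γ x b d = Λ * G x b d) (v : 𝔼³) :
    ∑ i, (fderiv ℝ (fun z => magnetic G Γ γ f N ρ z (e i) v) y (e i)
      - magnetic G Γ γ f N ρ y (Γ' y (e i) (e i)) v - magnetic G Γ γ f N ρ y (e i) (Γ' y (e i) v)) =
    -∑ b, ∑ c, ρ y * det3 v (e b) (e c) *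
      ∑ d, extrinsic G Γ f N y (e b) (e d) * electric G Γ f N y (e d) (e c) := by
  have h1 := h.divergence_codazzi he (by simp) hric
  simp only [h.fderiv_magnetic hv]
  simp only [h.fderiv_codazzi_eq_det3 hv] at h1
  set D : Fin 3 → 𝔼³ := fun i => fderiv ℝ (fun z => magneticVec G Γ f N ρ z (e i)) y (e i)
      + Γ' y (e i) (magneticVec G Γ f N ρ y (e i)) - magneticVec G Γ f N ρ y (Γ' y (e i) (e i))
    with hD
  -- The divergence of the magnetic part, as a vector, is dual to the 2-form computed in
  -- `divergence_codazzi`.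
  have h2 : ∀ k l, ρ y * det3 (∑ i, D i) k l =
      ∑ i, (extrinsic G Γ f N y (e i) l * electric G Γ f N y (e i) k
        - extrinsic G Γ f N y (e i) k * electric G Γ f N y (e i) l) := by
    intro k l
    rw [← h1 k l]
    simp [Fin.sum_univ_three, det3, hD]
    ring
  have h3 := he.sum_det3_mul_det3 hv.sq.self_of_nhds v (∑ i, D i)
  have h4 : ∑ i, matBil (γ y) (D i) v = matBil (γ y) v (∑ i, D i) := by
    rw [h.induced.symm_self v]; simp
  rw [h4]
  simp only [h2] at h3
  have h5 : ∀ b c, det3 v (e c) (e b) = -det3 v (e b) (e c) := fun b c => by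
    simp only [det3]; ring
  have h6 : ∀ b c, det3 v (e b) (e c) = -det3 v (e c) (e b) := fun b c => h5 _ _
  have hs := h.extrinsic_symm
  have h7 : matBil (γ y) v (∑ i, D i) = (1 / 2) * (2 * matBil (γ y) v (∑ i, D i)) := by ring
  rw [h7, ← h3]
  -- Relabelling b and c against the antisymmetric determinant shows that the two terms of the
  -- 2-form contribute equally, which absorbs the factor 1/2.
  have h8 : ∑ b, ∑ c, ρ y * det3 v (e b) (e c) *
      ∑ i, extrinsic G Γ f N y (e i) (e c) * electric G Γ f N y (e i) (e b) =
      -∑ b, ∑ c, ρ y * det3 v (e b) (e c) *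
      ∑ i, extrinsic G Γ f N y (e i) (e b) * electric G Γ f N y (e i) (e c) := by
    rw [Finset.sum_comm]
    simp only [← Finset.sum_neg_distrib]
    refine Finset.sum_congr rfl fun b _ => Finset.sum_congr rfl fun c _ => ?_
    rw [h5]; simp
  simp only [Finset.sum_sub_distrib, mul_sub, h8]
  have h9 : ∀ b, ∀ i, extrinsic G Γ f N y (e i) (e b) = extrinsic G Γ f N y (e b) (e i) :=
    fun b i => hs _ _
  simp only [h9]
  ring

/-- The divergence of the electric part, in terms of the magnetic part. -/
lemma divergence_electric_eq {Λ : ℝ}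
    (hric : ∀ᶠ x in 𝓝 (f y), ∀ b d, ricciTrace Γ x b d = Λ * G x b d) (v : 𝔼³) :
    ∑ i, (fderiv ℝ (fun z => electric G Γ f N z (e i) v) y (e i)
      - electric G Γ f N y (Γ' y (e i) (e i)) v - electric G Γ f N y (e i) (Γ' y (e i) v)) =
    ∑ b, ∑ c, ρ y * det3 v (e b) (e c) *
      ∑ d, extrinsic G Γ f N y (e b) (e d) * magnetic G Γ γ f N ρ y (e d) (e c) := by
  rw [h.divergence_electric he (by simp) hric]
  -- Expand the dual vector in the frame; moving v to the first slot of the determinant gives the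
  -- minus sign, which cancels the one in `divergence_electric`.
  have h1 : ∀ u k, codazzi G Γ f N y u k v =
      -∑ c, magnetic G Γ γ f N ρ y u (e c) * (ρ y * det3 v k (e c)) := by
    intro u k
    rw [codazzi_eq_det3 hv.ne_zero]
    have h2 := he.complete (magneticVec G Γ f N ρ y u)
    set p : Fin 3 → ℝ := fun i => matBil (γ y) (e i) (magneticVec G Γ f N ρ y u) with hp
    have h3 : ∀ c, magnetic G Γ γ f N ρ y u (e c) = p c := fun c => by
      rw [magnetic, h.induced.symm_self]
    simp only [h3]
    rw [h2]
    simp [Fin.sum_univ_three, det3]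
    ring
  simp only [h1, Finset.mul_sum, mul_neg, Finset.sum_neg_distrib, neg_neg]
  rw [Finset.sum_comm]
  refine Finset.sum_congr rfl fun b _ => ?_
  rw [Finset.sum_comm]
  refine Finset.sum_congr rfl fun c _ => Finset.sum_congr rfl fun i _ => ?_
  rw [h.extrinsic_symm (e b)]
  ring

omit hv in
-- The trace in the adapted frame counts the normal direction with sign −1.
lemma sum_ricci (b d : V) :
    ∑ i, G (f y) (fderiv ℝ f y (e i)) (curvature Γ (f y) (fderiv ℝ f y (e i)) d b) =
      ricciTrace Γ (f y) b d + G (f y) (N y) (curvature Γ (f y) (N y) d b) := by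
  rw [ricciTrace, (h.ambient_frame he (by simp)).trace]
  simp [Fintype.sum_option]

omit [FiniteDimensional ℝ V] hv he in
lemma electric_symm (u v : 𝔼³) : electric G Γ f N y u v = electric G Γ f N y v u := by
  rw [electric, electric, h.ambient.metric_curvature_pair, h.ambient.metric_curvature_antisymm',
    curvature_antisymm]
  simp

omit hv in
-- The trace is −Ric(N, N), and G(N, N) = −1. It is this Λ that the three diagonal terms of (Λ/3)γ
-- cancel in the trace of E.
lemma electric_trace {Λ : ℝ} (hric : ∀ b d, ricciTrace Γ (f y) b d = Λ * G (f y) b d) :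
    ∑ i, electric G Γ f N y (e i) (e i) = Λ := by
  have h1 := h.sum_ricci he (N y) (N y)
  rw [h.ambient.metric_curvature_self, hric, h.unit.self_of_nhds] at h1
  have h2 : ∀ i, electric G Γ f N y (e i) (e i) =
      -G (f y) (fderiv ℝ f y (e i)) (curvature Γ (f y) (fderiv ℝ f y (e i)) (N y) (N y)) := by
    intro i
    rw [electric, curvature_antisymm, map_neg]
  simp only [h2, Finset.sum_neg_distrib, h1]
  ring

omit hv in
-- The trace is Ric(N, df l), which vanishes because Ric is proportional to G and N is normal.
lemma codazzi_trace {Λ : ℝ} (hric : ∀ b d, ricciTrace Γ (f y) b d = Λ * G (f y) b d) (l : 𝔼³) :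
    ∑ i, codazzi G Γ f N y (e i) (e i) l = 0 := by
  have h1 := h.sum_ricci he (N y) (fderiv ℝ f y l)
  rw [h.ambient.metric_curvature_self, hric, h.normal.self_of_nhds] at h1
  simpa [codazzi] using h1

omit [FiniteDimensional ℝ V] hv he in
lemma codazzi_cyclic (a b c : 𝔼³) : codazzi G Γ f N y a b c + codazzi G Γ f N y b c a
    + codazzi G Γ f N y c a b = 0 := by
  simp only [codazzi]
  have A := h.ambient.metric_curvature_antisymm'
  rw [A (fderiv ℝ f y b), A (fderiv ℝ f y c), A (fderiv ℝ f y a)]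
  have := congrArg (G (f y) (N y)) (h.ambient.bianchi_first (fderiv ℝ f y b) (fderiv ℝ f y c)
    (fderiv ℝ f y a))
  simp only [map_add, map_zero] at this
  linarith

/-- The antisymmetric part of the magnetic tensor is dual to the trace of the Codazzi part; each
off-diagonal pair is one component of that trace multiplied by ±ρ det(e). -/
lemma magnetic_symm {Λ : ℝ} (hric : ∀ b d, ricciTrace Γ (f y) b d = Λ * G (f y) b d) (i j : Fin 3) :
    magnetic G Γ γ f N ρ y (e i) (e j) = magnetic G Γ γ f N ρ y (e j) (e i) := by
  have ht := fun l => h.codazzi_trace he hric l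
  have ha := codazzi_antisymm (G := G) (Γ := Γ) (f := f) (N := N) y
  have h0 : ∀ u a, codazzi G Γ f N y u a a = 0 := fun u a => by linarith [ha u a a]
  simp only [magnetic_eq_sum hv he]
  have t0 := ht (e 0)
  have t1 := ht (e 1)
  have t2 := ht (e 2)
  simp only [Fin.sum_univ_three, h0, ha _ (e 1) (e 0), ha _ (e 2) (e 0), ha _ (e 2) (e 1)] at t0 t1 t2 ⊢
  have s0 := congrArg (ρ y * det3 (e 0) (e 1) (e 2) * ·) t0
  have s1 := congrArg (ρ y * det3 (e 0) (e 1) (e 2) * ·) t1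
  have s2 := congrArg (ρ y * det3 (e 0) (e 1) (e 2) * ·) t2
  simp only [det3] at s0 s1 s2
  fin_cases i <;> fin_cases j <;> simp only [det3, Fin.zero_eta, Fin.mk_one, Fin.reduceFinMk]
  · linear_combination -s2
  · linear_combination s1
  · linear_combination s2
  · linear_combination -s0
  · linear_combination -s1
  · linear_combination s0

omit [FiniteDimensional ℝ V] in
-- The trace is the totally antisymmetric part of the Codazzi tensor, which the first Bianchi
-- identity kills.
lemma magnetic_trace : ∑ i, magnetic G Γ γ f N ρ y (e i) (e i) = 0 := by
  have hc := h.codazzi_cyclic (e 0) (e 1) (e 2)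
  have ha := codazzi_antisymm (G := G) (Γ := Γ) (f := f) (N := N) y
  have h0 : ∀ u a, codazzi G Γ f N y u a a = 0 := fun u a => by linarith [ha u a a]
  simp only [magnetic_eq_sum hv he]
  simp only [Fin.sum_univ_three, h0, ha _ (e 1) (e 0), ha _ (e 0) (e 2), ha _ (e 2) (e 1)]
  have s0 := congrArg (ρ y * det3 (e 0) (e 1) (e 2) * ·) hc
  simp only [det3] at s0 ⊢
  linear_combination s0

end IsLocalHypersurface

end Magnetic

/-! ### Conserved currents from conformal Killing fields -/

section Conservation

local notation "𝔼³" => EuclideanSpace ℝ (Fin 3)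

variable {γ : 𝔼³ → Matrix (Fin 3) (Fin 3) ℝ} {Γ : 𝔼³ → 𝔼³ →L[ℝ] 𝔼³ →L[ℝ] 𝔼³} {y : 𝔼³}
  {ρ : 𝔼³ → ℝ}

/-- The contraction of a symmetric, trace-free and divergence-free tensor with a conformal Killing
field is divergence-free. -/
lemma IsLocalVolume.divergence_density_eq_zero (h : IsLocalVolume γ Γ ρ y) {T : 𝔼³ → 𝔼³ →L[ℝ] 𝔼³ →L[ℝ] ℝ}
    (hT : DifferentiableAt ℝ T y) {e : Fin 3 → 𝔼³} (he : IsOrthoFrame (matBil (γ y)) e 1)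
    (hsymm : ∀ i j, T y (e i) (e j) = T y (e j) (e i)) (htr : ∑ i, T y (e i) (e i) = 0)
    (hdiv : ∀ v, ∑ i, nablaTensor Γ T y (e i) (e i) v = 0) {X Y : 𝔼³ → 𝔼³}
    (hX : DifferentiableAt ℝ X y) (hY : DifferentiableAt ℝ Y y) {lam : ℝ}
    (hXk : ∀ u v, matBil (γ y) (fderiv ℝ X y u + Γ y u (X y)) v
      + matBil (γ y) (fderiv ℝ X y v + Γ y v (X y)) u = lam * matBil (γ y) u v)
    (hXY : ∀ᶠ z in 𝓝 y, ∀ u, matBil (γ z) (Y z) u = T z u (X z)) :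
    ∑ l, fderiv ℝ (fun z => ρ z • Y z) y (stdVec l) l = 0 := by
  have hG := h.metric.smooth.diffAt
  have h1 : ∀ w u, matBil (γ y) (fderiv ℝ Y y w + Γ y w (Y y)) u =
      nablaTensor Γ T y w u (X y) + T y u (fderiv ℝ X y w + Γ y w (X y)) := by
    intro w u
    have e1 := fderiv_congr_apply (hXY.mono fun z hz => hz u) w
    rw [((hG.hasFDerivAt.clm_apply hY.hasFDerivAt).clm_apply (hasFDerivAt_const u y)).fderiv,
      ((hT.hasFDerivAt.clm_apply (hasFDerivAt_const u y)).clm_apply hX.hasFDerivAt).fderiv] at e1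
    simp [h.metric.compat, hXY.self_of_nhds] at e1
    simp only [nablaTensor, map_add, add_apply]
    linarith
  set L : 𝔼³ →L[ℝ] 𝔼³ := fderiv ℝ Y y + (Γ y).flip (Y y) with hL
  set D : 𝔼³ →L[ℝ] 𝔼³ := fderiv ℝ X y + (Γ y).flip (X y) with hD
  have hLa : ∀ w, L w = fderiv ℝ Y y w + Γ y w (Y y) := fun w => by simp [hL]
  have hDa : ∀ w, D w = fderiv ℝ X y w + Γ y w (X y) := fun w => by simp [hD]
  simp only [← hLa, ← hDa] at h1 hXk
  have h2 : traceL _ L = 0 := by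
    rw [he.trace]
    simp only [Pi.one_apply, one_mul]
    simp only [h.metric.symm_self (e _) (L _), h1, Finset.sum_add_distrib, hdiv, zero_add]
    have h3 : ∀ i, T y (e i) (D (e i)) =
        ∑ j, matBil (γ y) (D (e i)) (e j) * T y (e i) (e j) := by
      intro i
      conv_lhs => rw [he.complete (D (e i))]
      simp [h.metric.symm_self (e _) (D _)]
    have h4 : ∀ i j, matBil (γ y) (D (e j)) (e i) = lam * (if i = j then 1 else 0)
        - matBil (γ y) (D (e i)) (e j) := by
      intro i j
      have := hXk (e i) (e j)
      rw [he.orth] at this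
      simp only [Pi.one_apply] at this
      linarith
    simp only [h3]
    -- Exchanging i and j and applying the conformal Killing equation shows that the sum equals λ tr
    -- T minus itself, hence vanishes for trace-free T.
    have h5 : ∑ i, ∑ j, matBil (γ y) (D (e i)) (e j) * T y (e i) (e j) =
        lam * ∑ i, T y (e i) (e i)
          - ∑ i, ∑ j, matBil (γ y) (D (e i)) (e j) * T y (e i) (e j) := by
      conv_lhs => rw [Finset.sum_comm]
      refine (Finset.sum_congr rfl fun i _ => Finset.sum_congr rfl fun j _ => ?_).trans
        (b := ∑ i, ∑ j, (lam * (if i = j then 1 else 0) * T y (e i) (e j)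
          - matBil (γ y) (D (e i)) (e j) * T y (e i) (e j))) ?_
      · rw [h4 i j, hsymm j i, sub_mul]
      · simp only [Finset.sum_sub_distrib]
        congr 1
        simp [Finset.mul_sum]
    rw [htr] at h5
    linarith
  rw [traceL_euclidean] at h2
  have h3 : ∀ l, fderiv ℝ (fun z => ρ z • Y z) y (stdVec l) =
      ρ y • fderiv ℝ Y y (stdVec l) + fderiv ℝ ρ y (stdVec l) • Y y := by
    intro l
    rw [(h.smooth.diffAt.hasFDerivAt.fun_smul hY.hasFDerivAt).fderiv]
    simp
  -- The derivative of the density is the Christoffel term of the covariant divergence: ∂_l(ρ Y^l) =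
  -- ρ ∇_l Y^l.
  have h4 : ∑ l, fderiv ℝ ρ y (stdVec l) * Y y l = ρ y * ∑ l, Γ y (stdVec l) (Y y) l := by
    have e1 : ∑ l, fderiv ℝ ρ y (stdVec l) * Y y l = fderiv ℝ ρ y (Y y) := by
      conv_rhs => rw [euclidean_sum (Y y)]
      simp [mul_comm]
    rw [e1, h.fderiv_density, mul_comm]
    simp only [h.metric.torsionFree (Y y)]
  simp only [h3, PiLp.add_apply, PiLp.smul_apply, smul_eq_mul, Finset.sum_add_distrib, h4]
  rw [← Finset.mul_sum, ← mul_add, ← Finset.sum_add_distrib]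
  simp only [hLa, PiLp.add_apply] at h2
  rw [h2, mul_zero]

/-- The flux 2-form of a divergence-free field is closed. -/
lemma flux_closed {P : Type*} [NormedAddCommGroup P] [NormedSpace ℝ P] {Z : 𝔼³ → 𝔼³} {F : P → 𝔼³}
    {t : P} (hF : ContDiffAt ℝ ∞ F t) (hZ : DifferentiableAt ℝ Z (F t))
    (hdiv : ∑ l, fderiv ℝ Z (F t) (stdVec l) l = 0) (a b c : P) :
    fderiv ℝ (fun s => det3 (Z (F s)) (fderiv ℝ F s b) (fderiv ℝ F s c)) t a
    - fderiv ℝ (fun s => det3 (Z (F s)) (fderiv ℝ F s a) (fderiv ℝ F s c)) t b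
    + fderiv ℝ (fun s => det3 (Z (F s)) (fderiv ℝ F s a) (fderiv ℝ F s b)) t c = 0 := by
  have hp : ∀ {g : P → 𝔼³} {g' : P →L[ℝ] 𝔼³}, HasFDerivAt g g' t → ∀ i,
      HasFDerivAt (fun s => g s i) ((EuclideanSpace.proj i : 𝔼³ →L[ℝ] ℝ).comp g') t :=
    fun h i => (EuclideanSpace.proj i : 𝔼³ →L[ℝ] ℝ).hasFDerivAt.comp t h
  have h0 : HasFDerivAt (fun s => Z (F s)) _ t := hZ.hasFDerivAt.comp t hF.diffAt.hasFDerivAt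
  have h1 : ∀ b, HasFDerivAt (fun s => fderiv ℝ F s b) _ t := fun b =>
    hF.fderiv_infty.diffAt.hasFDerivAt.clm_apply (hasFDerivAt_const b t)
  have key : ∀ a b c, fderiv ℝ (fun s => det3 (Z (F s)) (fderiv ℝ F s b) (fderiv ℝ F s c)) t a =
      det3 (fderiv ℝ Z (F t) (fderiv ℝ F t a)) (fderiv ℝ F t b) (fderiv ℝ F t c)
      + det3 (Z (F t)) (fderiv ℝ (fderiv ℝ F) t a b) (fderiv ℝ F t c)
      + det3 (Z (F t)) (fderiv ℝ F t b) (fderiv ℝ (fderiv ℝ F) t a c) := by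
    intro a b c
    have h2 : HasFDerivAt (fun s => det3 (Z (F s)) (fderiv ℝ F s b) (fderiv ℝ F s c)) _ t :=
      (((hp h0 0).fun_mul (((hp (h1 b) 1).fun_mul (hp (h1 c) 2)).fun_sub
        ((hp (h1 b) 2).fun_mul (hp (h1 c) 1)))).fun_sub
      ((hp h0 1).fun_mul (((hp (h1 b) 0).fun_mul (hp (h1 c) 2)).fun_sub
        ((hp (h1 b) 2).fun_mul (hp (h1 c) 0))))).fun_add
      ((hp h0 2).fun_mul (((hp (h1 b) 0).fun_mul (hp (h1 c) 1)).fun_sub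
        ((hp (h1 b) 1).fun_mul (hp (h1 c) 0))))
    rw [h2.fderiv]
    simp [det3]
    ring
  -- The second derivatives of F cancel in the alternating sum; what remains is the action of DZ on
  -- the determinant, namely its trace div Z = 0.
  have h3 := det3_derivation (fderiv ℝ Z (F t)) (fderiv ℝ F t a) (fderiv ℝ F t b) (fderiv ℝ F t c)
  rw [hdiv, zero_mul] at h3
  rw [key, key, key, hF.fderiv_fderiv_symm b a, hF.fderiv_fderiv_symm c a,
    hF.fderiv_fderiv_symm c b]
  rw [← h3]
  simp only [det3]
  ring

end Conservation

/-! ### Tangent vectors and tensors in preferred charts -/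

section Charts

variable {n : ℕ} {M : Type*} [TopologicalSpace M] [ChartedSpace (EuclideanSpace ℝ (Fin n)) M]

local notation "𝔼" => EuclideanSpace ℝ (Fin n)

/-- The components of a tangent vector at `x` in the preferred chart at `p`. -/
def toChart (p x : M) : TangentSpace (𝓡 n) x →L[ℝ] 𝔼 :=
  mfderiv (𝓡 n) 𝓘(ℝ, 𝔼) (extChartAt (𝓡 n) p) x

/-- The tangent vector with given components in the preferred chart at `p`. -/
def fromChart (p : M) (y : 𝔼) : 𝔼 →L[ℝ] TangentSpace (𝓡 n) ((extChartAt (𝓡 n) p).symm y) :=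
  mfderiv 𝓘(ℝ, 𝔼) (𝓡 n) (extChartAt (𝓡 n) p).symm y

variable [IsManifold (𝓡 n) ∞ M]

lemma toChart_fromChart {p : M} {y : 𝔼} (hy : y ∈ (extChartAt (𝓡 n) p).target) (u : 𝔼) :
    toChart p ((extChartAt (𝓡 n) p).symm y) (fromChart p y u) = u := by
  have h := mfderiv_extChartAt_comp_mfderivWithin_extChartAt_symm (I := 𝓡 n) hy
  rw [ModelWithCorners.range_eq_univ, mfderivWithin_univ] at h
  exact congrArg (fun L => L u) h

lemma fromChart_toChart {p : M} {y : 𝔼} (hy : y ∈ (extChartAt (𝓡 n) p).target)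
    (u : TangentSpace (𝓡 n) ((extChartAt (𝓡 n) p).symm y)) :
    fromChart p y (toChart p ((extChartAt (𝓡 n) p).symm y) u) = u := by
  have h := mfderivWithin_extChartAt_symm_comp_mfderiv_extChartAt (I := 𝓡 n) hy
  rw [ModelWithCorners.range_eq_univ, mfderivWithin_univ] at h
  exact congrArg (fun L => L u) h

lemma toChart_self (p : M) (u : TangentSpace (𝓡 n) p) : toChart p p u = u := by
  exact congrArg (fun L => L u) (mfderiv_extChartAt_self (I := 𝓡 n) (x := p))

/-- A field of bilinear forms. -/
def IsBilinear (T : Tensor2 n M) : Prop :=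
  ∀ x, ∃ B : TangentSpace (𝓡 n) x →ₗ[ℝ] TangentSpace (𝓡 n) x →ₗ[ℝ] ℝ, ∀ u v, T x u v = B u v

omit [IsManifold (𝓡 n) ∞ M] in
lemma IsBilinear.matBil_chartComp {T : Tensor2 n M} (hT : IsBilinear T) (p : M) (y u v : 𝔼) :
    matBil (chartComp T p y) u v =
      T ((extChartAt (𝓡 n) p).symm y) (fromChart p y u) (fromChart p y v) := by
  obtain ⟨B, hB⟩ := hT ((extChartAt (𝓡 n) p).symm y)
  have h1 : ∀ u v : 𝔼, T ((extChartAt (𝓡 n) p).symm y) (fromChart p y u) (fromChart p y v) =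
      B (fromChart p y u) (fromChart p y v) := fun u v => hB _ _
  let B' : 𝔼 →ₗ[ℝ] 𝔼 →ₗ[ℝ] ℝ := LinearMap.mk₂ ℝ
    (fun u v => B (fromChart p y u) (fromChart p y v))
    (fun a b c => by simp only [map_add, LinearMap.add_apply])
    (fun a b c => by simp only [map_smul, LinearMap.smul_apply])
    (fun a b c => by simp only [map_add])
    (fun a b c => by simp only [map_smul])
  rw [h1]
  exact matBil_eq_of_stdVec (B := B') (fun i j => h1 _ _) u v

/-- The fibre depends on the base point, so `left_inv` cannot be rewritten inside it. Writing x as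
the image of chart coordinates and treating an arbitrary dependent F settles the transport once for
all. -/
lemma apply_fromChart_toChart {α : Type*} (F : ∀ x : M, TangentSpace (𝓡 n) x → α) {p x : M}
    (hx : x ∈ (extChartAt (𝓡 n) p).source) (u : TangentSpace (𝓡 n) x) :
    F ((extChartAt (𝓡 n) p).symm (extChartAt (𝓡 n) p x))
      (fromChart p (extChartAt (𝓡 n) p x) (toChart p x u)) = F x u := by
  obtain ⟨y, hy, rfl⟩ : ∃ y ∈ (extChartAt (𝓡 n) p).target, x = (extChartAt (𝓡 n) p).symm y :=
    ⟨_, (extChartAt (𝓡 n) p).map_source hx, ((extChartAt (𝓡 n) p).left_inv hx).symm⟩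
  rw [(extChartAt (𝓡 n) p).right_inv hy, fromChart_toChart hy]

lemma apply_fromChart_self {α : Type*} (F : ∀ x : M, TangentSpace (𝓡 n) x → α) (p : M)
    (u : TangentSpace (𝓡 n) p) :
    F ((extChartAt (𝓡 n) p).symm (extChartAt (𝓡 n) p p)) (fromChart p (extChartAt (𝓡 n) p p) u) =
      F p u := by
  have h := apply_fromChart_toChart F (mem_extChartAt_source (I := 𝓡 n) p) u
  rwa [toChart_self] at h

lemma tensor_eq_fromChart (T : Tensor2 n M) {p x : M} (hx : x ∈ (extChartAt (𝓡 n) p).source)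
    (u v : TangentSpace (𝓡 n) x) :
    T x u v = T ((extChartAt (𝓡 n) p).symm (extChartAt (𝓡 n) p x))
      (fromChart p (extChartAt (𝓡 n) p x) (toChart p x u))
      (fromChart p (extChartAt (𝓡 n) p x) (toChart p x v)) := by
  obtain ⟨y, hy, rfl⟩ : ∃ y ∈ (extChartAt (𝓡 n) p).target, x = (extChartAt (𝓡 n) p).symm y :=
    ⟨_, (extChartAt (𝓡 n) p).map_source hx, ((extChartAt (𝓡 n) p).left_inv hx).symm⟩
  rw [(extChartAt (𝓡 n) p).right_inv hy, fromChart_toChart hy, fromChart_toChart hy]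

lemma IsBilinear.eq_matBil {T : Tensor2 n M} (hT : IsBilinear T) {p x : M}
    (hx : x ∈ (extChartAt (𝓡 n) p).source) (u v : TangentSpace (𝓡 n) x) :
    T x u v = matBil (chartComp T p (extChartAt (𝓡 n) p x)) (toChart p x u) (toChart p x v) := by
  rw [tensor_eq_fromChart T hx, hT.matBil_chartComp]

lemma IsBilinear.eq_matBil_self {T : Tensor2 n M} (hT : IsBilinear T) (p : M)
    (u v : TangentSpace (𝓡 n) p) :
    T p u v = matBil (chartComp T p (extChartAt (𝓡 n) p p)) u v := by
  have h := hT.eq_matBil (mem_extChartAt_source (I := 𝓡 n) p) u v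
  rwa [toChart_self, toChart_self] at h

lemma IsBilinear.comp_eq {T : Tensor2 n M} (hT : IsBilinear T) (p : M) :
    comp T p = chartComp T p (extChartAt (𝓡 n) p p) := by
  ext i j
  exact (hT.eq_matBil_self p (bvec p i) (bvec p j)).trans (matBil_stdVec _ i j)

section Maps

variable {k : ℕ} {S : Type*} [TopologicalSpace S] [ChartedSpace (EuclideanSpace ℝ (Fin k)) S]
  [IsManifold (𝓡 k) ∞ S] {ι : S → M}

/-- The local representative of a map in the preferred charts at `s` and `p`. -/
def localRep (ι : S → M) (s : S) (p : M) (y : EuclideanSpace ℝ (Fin k)) : 𝔼 :=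
  extChartAt (𝓡 n) p (ι ((extChartAt (𝓡 k) s).symm y))

omit [IsManifold (𝓡 n) ∞ M] in
lemma contMDiffAt_extChartAt_symm {s : S} {y : EuclideanSpace ℝ (Fin k)}
    (hy : y ∈ (extChartAt (𝓡 k) s).target) :
    ContMDiffAt 𝓘(ℝ, EuclideanSpace ℝ (Fin k)) (𝓡 k) ∞ (extChartAt (𝓡 k) s).symm y :=
  (contMDiffOn_extChartAt_symm s).contMDiffAt ((isOpen_extChartAt_target s).mem_nhds hy)

lemma contDiffAt_localRep (hι : ContMDiff (𝓡 k) (𝓡 n) ∞ ι) {s : S} {p : M}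
    {y : EuclideanSpace ℝ (Fin k)} (hy : y ∈ (extChartAt (𝓡 k) s).target)
    (hp : ι ((extChartAt (𝓡 k) s).symm y) ∈ (extChartAt (𝓡 n) p).source) :
    ContDiffAt ℝ ∞ (localRep (n := n) (k := k) ι s p) y := by
  rw [← contMDiffAt_iff_contDiffAt]
  exact (contMDiffAt_extChartAt' (I := 𝓡 n) (by rwa [← extChartAt_source (𝓡 n)])).comp y (hι.contMDiffAt.comp y
    (contMDiffAt_extChartAt_symm hy))

lemma fderiv_localRep (hι : ContMDiff (𝓡 k) (𝓡 n) ∞ ι) {s : S} {p : M}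
    {y : EuclideanSpace ℝ (Fin k)} (hy : y ∈ (extChartAt (𝓡 k) s).target)
    (hp : ι ((extChartAt (𝓡 k) s).symm y) ∈ (extChartAt (𝓡 n) p).source)
    (u : EuclideanSpace ℝ (Fin k)) :
    fderiv ℝ (localRep (n := n) (k := k) ι s p) y u = toChart (n := n) p (ι ((extChartAt (𝓡 k) s).symm y))
      (mfderiv (𝓡 k) (𝓡 n) ι ((extChartAt (𝓡 k) s).symm y) (fromChart s y u)) := by
  have h1 := (contMDiffAt_extChartAt_symm hy).mdifferentiableAt (by simp)
  have h2 := (hι.contMDiffAt (x := (extChartAt (𝓡 k) s).symm y)).mdifferentiableAt (by simp)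
  have h3 := mdifferentiableAt_extChartAt (I := 𝓡 n) (by rwa [← extChartAt_source (𝓡 n)] :
    ι ((extChartAt (𝓡 k) s).symm y) ∈ (chartAt (EuclideanSpace ℝ (Fin n)) p).source)
  rw [← mfderiv_eq_fderiv]
  have h4 : localRep (n := n) (k := k) ι s p = extChartAt (𝓡 n) p ∘ (ι ∘ (extChartAt (𝓡 k) s).symm) := rfl
  rw [h4, mfderiv_comp y h3 (h2.comp y h1), mfderiv_comp y h2 h1]
  rfl

omit [IsManifold (𝓡 n) ∞ M] [IsManifold (𝓡 k) ∞ S] in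
lemma eventually_localRep_mem (hι : Continuous ι) {s : S} {p : M}
    {y : EuclideanSpace ℝ (Fin k)} (hy : y ∈ (extChartAt (𝓡 k) s).target)
    (hp : ι ((extChartAt (𝓡 k) s).symm y) ∈ (extChartAt (𝓡 n) p).source) :
    ∀ᶠ z in 𝓝 y, z ∈ (extChartAt (𝓡 k) s).target ∧
      ι ((extChartAt (𝓡 k) s).symm z) ∈ (extChartAt (𝓡 n) p).source := by
  refine Filter.Eventually.and ((isOpen_extChartAt_target s).mem_nhds hy) ?_
  have h1 : ContinuousAt (fun z => ι ((extChartAt (𝓡 k) s).symm z)) y :=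
    hι.continuousAt.comp (continuousAt_extChartAt_symm'' hy)
  exact h1.eventually ((isOpen_extChartAt_source p).mem_nhds hp)

end Maps

end Charts

/-! ### Smoothness of metric components -/

section Smoothness

variable {M : Type*} [TopologicalSpace M] [ChartedSpace (EuclideanSpace ℝ (Fin 4)) M]
  [IsManifold (𝓡 4) ∞ M] (g : LorentzMetric M)

lemma LorentzMetric.isBilinear : IsBilinear g.tensor := fun x =>
  ⟨LinearMap.mk₂ ℝ (fun u v => g.val x u v) (by simp) (by simp) (by simp) (by simp), fun _ _ => rfl⟩

/-- In the trivialisation of the tangent bundle at p the coordinate frame of the chart at p is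
constant. -/
lemma contMDiffAt_frame {n : ℕ} {M : Type*} [TopologicalSpace M]
    [ChartedSpace (EuclideanSpace ℝ (Fin n)) M] [IsManifold (𝓡 n) ∞ M] {p : M}
    {y : EuclideanSpace ℝ (Fin n)} (hy : y ∈ (extChartAt (𝓡 n) p).target) (i : Fin n) :
    ContMDiffAt 𝓘(ℝ, EuclideanSpace ℝ (Fin n)) (𝓡 n).tangent ∞
      (fun z => (⟨(extChartAt (𝓡 n) p).symm z, frame p z i⟩ : TangentBundle (𝓡 n) M)) y := by
  have hz : ∀ z ∈ (extChartAt (𝓡 n) p).target,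
      (extChartAt (𝓡 n) p).symm z ∈ (trivializationAt (EuclideanSpace ℝ (Fin n))
        (TangentSpace (𝓡 n)) p).baseSet := fun z hz => by
    have := (extChartAt (𝓡 n) p).map_target hz
    simpa using this
  rw [(trivializationAt (EuclideanSpace ℝ (Fin n))
    (TangentSpace (𝓡 n)) p).contMDiffAt_iff (IB := 𝓡 n) (by
      rw [Bundle.Trivialization.mem_source]; exact hz y hy)]
  refine ⟨contMDiffAt_extChartAt_symm hy, ?_⟩
  refine (contMDiffAt_const (c := stdVec i)).congr_of_eventuallyEq ?_
  filter_upwards [(isOpen_extChartAt_target p).mem_nhds hy] with z hz'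
  have h2 := toChart_fromChart hz' (stdVec i)
  have h3 := TangentBundle.continuousLinearMapAt_trivializationAt (I := 𝓡 n) (x₀ := p)
    (x := (extChartAt (𝓡 n) p).symm z) (by simpa using hz z hz')
  rw [← h2, toChart]
  rw [← h3]
  rw [Bundle.Trivialization.continuousLinearMapAt_apply]
  rw [Bundle.Trivialization.coe_linearMapAt_of_mem _ (hz z hz')]
  rfl

lemma LorentzMetric.contDiffAt_chartComp {p : M} {y : EuclideanSpace ℝ (Fin 4)}
    (hy : y ∈ (extChartAt (𝓡 4) p).target) (i j : Fin 4) :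
    ContDiffAt ℝ ∞ (fun z => chartComp g.tensor p z i j) y := by
  rw [← contMDiffAt_iff_contDiffAt]
  have h1 := (g.smooth ((extChartAt (𝓡 4) p).symm y)).comp y (contMDiffAt_extChartAt_symm hy)
  have : ContMDiffAt 𝓘(ℝ, EuclideanSpace ℝ (Fin 4)) ((𝓡 4).prod 𝓘(ℝ)) ∞
      (fun z => Bundle.TotalSpace.mk' ℝ (E := Bundle.Trivial M ℝ) ((extChartAt (𝓡 4) p).symm z)
        (g.val ((extChartAt (𝓡 4) p).symm z) (frame p z i) (frame p z j))) y := by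
    apply ContMDiffAt.clm_bundle_apply₂ (F₁ := EuclideanSpace ℝ (Fin 4))
      (F₂ := EuclideanSpace ℝ (Fin 4))
    · exact h1
    · exact contMDiffAt_frame hy i
    · exact contMDiffAt_frame hy j
  rw [Bundle.contMDiffAt_totalSpace] at this
  exact this.2

end Smoothness

/-! ### Invariance of connection and curvature under isometries -/

section Isometry

variable {V : Type*} [NormedAddCommGroup V] [NormedSpace ℝ V] [FiniteDimensional ℝ V]
  {G γ : V → V →L[ℝ] V →L[ℝ] ℝ} {Γ Γ' : V → V →L[ℝ] V →L[ℝ] V} {f : V → V} {y : V}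

omit [FiniteDimensional ℝ V] in
lemma IsLocalMetric.isometry_injective (h' : IsLocalMetric γ Γ' y)
    (hγ : ∀ᶠ z in 𝓝 y, ∀ u v, γ z u v = G (f z) (fderiv ℝ f z u) (fderiv ℝ f z v)) :
    Function.Injective (fderiv ℝ f y) := by
  rw [injective_iff_map_eq_zero]
  intro u hu
  refine h'.nondeg.self_of_nhds u fun v => ?_
  rw [hγ.self_of_nhds u v, hu]; simp

/-- In equal dimensions df is surjective, so the tangential identity `metric_gauss` already tests
against all vectors and nondegeneracy applies. -/
lemma IsLocalMetric.isometry_conn (h : IsLocalMetric G Γ (f y)) (h' : IsLocalMetric γ Γ' y)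
    (hf : ContDiffAt ℝ ∞ f y)
    (hγ : ∀ᶠ z in 𝓝 y, ∀ u v, γ z u v = G (f z) (fderiv ℝ f z u) (fderiv ℝ f z v)) (u v : V) :
    fderiv ℝ (fderiv ℝ f) y u v + Γ (f y) (fderiv ℝ f y u) (fderiv ℝ f y v) =
      fderiv ℝ f y (Γ' y u v) := by
  have hs : Function.Surjective (fderiv ℝ f y) :=
    (LinearMap.injective_iff_surjective (f := (fderiv ℝ f y : V →ₗ[ℝ] V))).1
      (h'.isometry_injective hγ)
  rw [← sub_eq_zero]
  refine h.nondeg.self_of_nhds _ fun w => ?_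
  obtain ⟨w, rfl⟩ := hs w
  rw [map_sub, sub_apply, metric_gauss h h' hf hγ, hγ.self_of_nhds, sub_self]

lemma IsLocalMetric.isometry_curvature (h : IsLocalMetric G Γ (f y)) (h' : IsLocalMetric γ Γ' y)
    (hf : ∀ᶠ z in 𝓝 y, ContDiffAt ℝ ∞ f z)
    (hγ : ∀ᶠ z in 𝓝 y, ∀ u v, γ z u v = G (f z) (fderiv ℝ f z u) (fderiv ℝ f z v)) (u v w : V) :
    curvature Γ (f y) (fderiv ℝ f y u) (fderiv ℝ f y v) (fderiv ℝ f y w) =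
      fderiv ℝ f y (curvature Γ' y u v w) := by
  refine curvature_pullback h.smooth_conn h'.smooth_conn hf.self_of_nhds ?_ u v w
  filter_upwards [h'.eventually, hf.self_of_nhds.continuousAt.eventually h.eventually, hγ.eventually_nhds,
    hf] with z h1 h2 h3 h4
  exact h2.isometry_conn h1 h4 h3

/-- The two endomorphisms being traced are conjugate by df. -/
lemma IsLocalMetric.isometry_ricciTrace (h : IsLocalMetric G Γ (f y)) (h' : IsLocalMetric γ Γ' y)
    (hf : ∀ᶠ z in 𝓝 y, ContDiffAt ℝ ∞ f z)
    (hγ : ∀ᶠ z in 𝓝 y, ∀ u v, γ z u v = G (f z) (fderiv ℝ f z u) (fderiv ℝ f z v)) (b d : V) :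
    ricciTrace Γ (f y) (fderiv ℝ f y b) (fderiv ℝ f y d) = ricciTrace Γ' y b d := by
  have hi := h'.isometry_injective hγ
  let e : V ≃L[ℝ] V := (LinearEquiv.ofInjectiveEndo (fderiv ℝ f y : V →ₗ[ℝ] V)
    hi).toContinuousLinearEquiv
  have he : ∀ u, e u = fderiv ℝ f y u := fun u => rfl
  have h1 : ((curvature Γ (f y)).flip (fderiv ℝ f y d)).flip (fderiv ℝ f y b) =
      (e : V →L[ℝ] V).comp ((((curvature Γ' y).flip d).flip b).comp (e.symm : V →L[ℝ] V)) := by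
    ext u
    obtain ⟨u, rfl⟩ := e.surjective u
    simp only [ContinuousLinearMap.flip_apply, ContinuousLinearMap.comp_apply,
      ContinuousLinearEquiv.coe_coe, ContinuousLinearEquiv.symm_apply_apply]
    rw [he, he, h.isometry_curvature h' hf hγ]
  rw [ricciTrace, h1, traceL_comp_comm, ContinuousLinearMap.comp_assoc]
  simp [ricciTrace]

end Isometry

/-! ### Pulled-back tensors in local representatives -/

section Pullback

variable {n k : ℕ} {M : Type*} [TopologicalSpace M] [ChartedSpace (EuclideanSpace ℝ (Fin n)) M]
  [IsManifold (𝓡 n) ∞ M] {S : Type*} [TopologicalSpace S]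
  [ChartedSpace (EuclideanSpace ℝ (Fin k)) S] [IsManifold (𝓡 k) ∞ S] {ι : S → M}

lemma IsBilinear.pullback_eq {T : Tensor2 n M} (hT : IsBilinear T)
    (hι : ContMDiff (𝓡 k) (𝓡 n) ∞ ι) {s : S} {p : M} {y : EuclideanSpace ℝ (Fin k)}
    (hy : y ∈ (extChartAt (𝓡 k) s).target)
    (hp : ι ((extChartAt (𝓡 k) s).symm y) ∈ (extChartAt (𝓡 n) p).source)
    (u v : EuclideanSpace ℝ (Fin k)) :
    T (ι ((extChartAt (𝓡 k) s).symm y))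
      (mfderiv (𝓡 k) (𝓡 n) ι ((extChartAt (𝓡 k) s).symm y) (fromChart s y u))
      (mfderiv (𝓡 k) (𝓡 n) ι ((extChartAt (𝓡 k) s).symm y) (fromChart s y v)) =
    matBil (chartComp T p (localRep (n := n) (k := k) ι s p y))
      (fderiv ℝ (localRep (n := n) (k := k) ι s p) y u)
      (fderiv ℝ (localRep (n := n) (k := k) ι s p) y v) := by
  rw [fderiv_localRep hι hy hp, fderiv_localRep hι hy hp, hT.eq_matBil hp]
  rfl

end Pullback

/-! ### Nondegeneracy, inverse matrices and reduction to basis vectors -/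

section LinearAlgebra

variable {n : ℕ}

local notation "𝔼" => EuclideanSpace ℝ (Fin n)

lemma det_ne_zero_of_nondegenerate {m : Matrix (Fin n) (Fin n) ℝ}
    (h : ∀ v : 𝔼, (∀ w : 𝔼, matBil m w v = 0) → v = 0) : m.det ≠ 0 := by
  intro h0
  obtain ⟨v, hv, hmv⟩ := Matrix.exists_mulVec_eq_zero_iff.2 h0
  apply hv
  have h1 := h (WithLp.toLp 2 v) fun w => by
    rw [matBil_apply]
    refine Finset.sum_eq_zero fun i _ => ?_
    have h2 := congrFun hmv i
    simp only [Matrix.mulVec, dotProduct, Pi.zero_apply] at h2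
    calc _ = w i * ∑ j, m i j * v j := by
          rw [Finset.mul_sum]; exact Finset.sum_congr rfl fun j _ => by simp; ring
      _ = 0 := by rw [h2, mul_zero]
  simpa using congrArg (WithLp.ofLp) h1

lemma sum_inv_mul_self {m : Matrix (Fin n) (Fin n) ℝ} (hd : m.det ≠ 0)
    (hs : ∀ i j, m i j = m j i) : ∑ b, ∑ d, m⁻¹ b d * m b d = n := by
  have h1 : m⁻¹ * m = 1 := Matrix.nonsing_inv_mul m (isUnit_iff_ne_zero.2 hd)
  calc _ = ∑ b, (m⁻¹ * m) b b := by
        simp only [Matrix.mul_apply]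
        exact Finset.sum_congr rfl fun b _ => Finset.sum_congr rfl fun d _ => by rw [hs b d]
    _ = n := by simp [h1]

lemma ricciTrace_eq_of_stdVec {Γ : 𝔼 → 𝔼 →L[ℝ] 𝔼 →L[ℝ] 𝔼} {y : 𝔼} {Λ : ℝ}
    {m : Matrix (Fin n) (Fin n) ℝ}
    (h : ∀ i j, ricciTrace Γ y (stdVec i) (stdVec j) = Λ * m i j) (b d : 𝔼) :
    ricciTrace Γ y b d = Λ * matBil m b d := by
  have h1 := matBil_eq_of_stdVec (m := Λ • m) (B := LinearMap.mk₂ ℝ (ricciTrace Γ y)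
    (by intros; simp [ricciTrace]) (by intros; simp [ricciTrace]) (by intros; simp [ricciTrace])
    (by intros; simp [ricciTrace])) (fun i j => by rw [Matrix.smul_apply, smul_eq_mul, ← h]; rfl) b d
  change _ = ricciTrace Γ y b d at h1
  rw [← h1, matBil_apply, matBil_apply, Finset.mul_sum]
  refine Finset.sum_congr rfl fun i _ => ?_
  rw [Finset.mul_sum]
  refine Finset.sum_congr rfl fun i _ => ?_
  simp [mul_assoc]

end LinearAlgebra

/-! ### The Einstein equations and the Weyl tensor in a fixed chart -/

namespace LorentzMetric

variable {M : Type*} [TopologicalSpace M] [ChartedSpace (EuclideanSpace ℝ (Fin 4)) M]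
  [IsManifold (𝓡 4) ∞ M] (g : LorentzMetric M)

local notation "𝔼⁴" => EuclideanSpace ℝ (Fin 4)

/-- A nonzero u in the kernel is orthogonal to the timelike t, hence spacelike, contradicting g(u,
u) = 0. -/
lemma nondegenerate {x : M} {u : TangentSpace (𝓡 4) x} (h : ∀ v, g.val x v u = 0) : u = 0 := by
  obtain ⟨t, -, ht⟩ := g.lorentz x
  by_contra hu
  have := ht u (h t) hu
  rw [h u] at this
  exact lt_irrefl _ this

/-- The metric in the preferred chart at `p`. -/
def bil (p : M) (y : 𝔼⁴) : 𝔼⁴ →L[ℝ] 𝔼⁴ →L[ℝ] ℝ := matBil (chartComp g.tensor p y)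

/-- The Levi-Civita connection in the preferred chart at `p`. -/
def conn (p : M) : 𝔼⁴ → 𝔼⁴ →L[ℝ] 𝔼⁴ →L[ℝ] 𝔼⁴ := matConn (chartComp g.tensor p)

lemma det_chartComp_ne_zero {p : M} {y : 𝔼⁴} (hy : y ∈ (extChartAt (𝓡 4) p).target) :
    (chartComp g.tensor p y).det ≠ 0 := by
  refine det_ne_zero_of_nondegenerate fun v hv => ?_
  have h1 : fromChart p y v = 0 := g.nondegenerate fun w => by
    have := hv (toChart p _ w)
    rwa [g.isBilinear.matBil_chartComp, fromChart_toChart hy] at this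
  have h2 := toChart_fromChart hy v
  rw [h1, map_zero] at h2
  exact h2.symm

lemma chartComp_symm (p : M) (y : 𝔼⁴) (i j : Fin 4) :
    chartComp g.tensor p y i j = chartComp g.tensor p y j i := g.symm _ _ _

lemma isLocalMetric {p : M} {y : 𝔼⁴} (hy : y ∈ (extChartAt (𝓡 4) p).target) :
    IsLocalMetric (g.bil p) (g.conn p) y := by
  have h := (isOpen_extChartAt_target (I := 𝓡 4) p).mem_nhds hy
  exact isLocalMetric_matBil (h := by
      filter_upwards [h] with z hz i j using g.contDiffAt_chartComp hz i j)
    (by filter_upwards [h] with z hz using g.det_chartComp_ne_zero hz)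
    (Eventually.of_forall fun z i j => g.chartComp_symm p z i j)

variable {g} in
-- Tracing the field equations gives R = 4(R/2 − Λ), so R = 4Λ; substituting back gives the Ricci
-- tensor.
lemma _root_.WeylCharge.EinsteinVacuum.ricci_eq {Λ : ℝ} (hg : EinsteinVacuum g Λ) (q : M) :
    scalarCurv g.tensor q = 4 * Λ ∧ ∀ b d, ricci g.tensor q b d = Λ * comp g.tensor q b d := by
  have hc := g.isBilinear.comp_eq q
  have hd : (comp g.tensor q).det ≠ 0 := by
    rw [hc]; exact g.det_chartComp_ne_zero (mem_extChartAt_target (I := 𝓡 4) q)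
  have hs : ∑ b, ∑ d, (comp g.tensor q)⁻¹ b d * comp g.tensor q b d = 4 :=
    sum_inv_mul_self hd fun i j => by rw [hc]; exact g.chartComp_symm _ _ _ _
  have h1 : ∀ b d, ricci g.tensor q b d =
      (1 / 2 * scalarCurv g.tensor q - Λ) * comp g.tensor q b d := fun b d => by
    linarith [hg q b d]
  have h2 : scalarCurv g.tensor q = (1 / 2 * scalarCurv g.tensor q - Λ) * 4 := by
    rw [← hs, Finset.mul_sum]
    conv_lhs => rw [scalarCurv]
    refine Finset.sum_congr rfl fun b _ => ?_
    rw [Finset.mul_sum]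
    exact Finset.sum_congr rfl fun d _ => by rw [h1]; ring
  have h3 : scalarCurv g.tensor q = 4 * Λ := by linarith
  exact ⟨h3, fun b d => by rw [h1, h3]; ring⟩

/-- Comparison of the charts at `q` and `p`. -/
lemma bil_change {q p : M} {y : 𝔼⁴} (hy : y ∈ (extChartAt (𝓡 4) q).target)
    (hp : (extChartAt (𝓡 4) q).symm y ∈ (extChartAt (𝓡 4) p).source) :
    ∀ᶠ z in 𝓝 y, ∀ u v, g.bil q z u v = g.bil p (localRep (n := 4) (k := 4) id q p z)
      (fderiv ℝ (localRep (n := 4) (k := 4) id q p) z u)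
      (fderiv ℝ (localRep (n := 4) (k := 4) id q p) z v) := by
  filter_upwards [eventually_localRep_mem (ι := id) continuous_id hy hp] with z hz u v
  have := g.isBilinear.pullback_eq (ι := id) contMDiff_id hz.1 hz.2 u v
  rw [bil, bil, ← this, g.isBilinear.matBil_chartComp]
  simp only [mfderiv_id]
  rfl

/-- The hypothesis is stated at each q in the chart at q. Transporting it by the transition map
makes it an identity throughout the target of the chart at p, where it can be differentiated. -/
lemma ricciTrace_chart {Λ : ℝ} (hg : EinsteinVacuum g Λ) {p : M} {y : 𝔼⁴}
    (hy : y ∈ (extChartAt (𝓡 4) p).target) (b d : 𝔼⁴) :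
    ricciTrace (g.conn p) y b d = Λ * g.bil p y b d := by
  set q := (extChartAt (𝓡 4) p).symm y with hq
  have hy0 := mem_extChartAt_target (I := 𝓡 4) q
  have hq0 : (extChartAt (𝓡 4) q).symm (extChartAt (𝓡 4) q q) = q :=
    (extChartAt (𝓡 4) q).left_inv (mem_extChartAt_source (I := 𝓡 4) q)
  have hp : (extChartAt (𝓡 4) q).symm (extChartAt (𝓡 4) q q) ∈ (extChartAt (𝓡 4) p).source := by
    rw [hq0]; exact (extChartAt (𝓡 4) p).map_target hy
  have hφ : localRep (n := 4) (k := 4) id q p (extChartAt (𝓡 4) q q) = y := by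
    rw [localRep, hq0]; exact (extChartAt (𝓡 4) p).right_inv hy
  have hch := g.bil_change hy0 hp
  have hf := (eventually_localRep_mem (ι := id) continuous_id hy0 hp).mono fun z hz =>
    contDiffAt_localRep (ι := id) contMDiff_id hz.1 hz.2
  have hm := g.isLocalMetric hy0
  have hs : Function.Surjective (fderiv ℝ (localRep (n := 4) (k := 4) id q p)
      (extChartAt (𝓡 4) q q)) :=
    (LinearMap.injective_iff_surjective (f := ((fderiv ℝ (localRep (n := 4) (k := 4) id q p)
      (extChartAt (𝓡 4) q q)) : 𝔼⁴ →ₗ[ℝ] 𝔼⁴))).1 (hm.isometry_injective hch)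
  obtain ⟨b, rfl⟩ := hs b
  obtain ⟨d, rfl⟩ := hs d
  have hmp := g.isLocalMetric (hφ ▸ hy : localRep (n := 4) (k := 4) id q p (extChartAt (𝓡 4) q q)
    ∈ (extChartAt (𝓡 4) p).target)
  have h1 := hmp.isometry_ricciTrace hm hf hch b d
  have h2 := hch.self_of_nhds b d
  rw [hφ] at h1 h2
  rw [h1, ← h2]
  refine ricciTrace_eq_of_stdVec (fun i j => ?_) b d
  rw [conn, ← ricci_sum_eq hm.smooth_conn, ← g.isBilinear.comp_eq q]
  exact (hg.ricci_eq q).2 i j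

/-- The curvature at `q` in the chart at `p`. -/
lemma bil_curvature_change {q p : M} (hq : q ∈ (extChartAt (𝓡 4) p).source)
    (a b c d : 𝔼⁴) :
    g.bil q (extChartAt (𝓡 4) q q) a (curvature (g.conn q) (extChartAt (𝓡 4) q q) c d b) =
    g.bil p (extChartAt (𝓡 4) p q) (toChart p q a) (curvature (g.conn p) (extChartAt (𝓡 4) p q)
      (toChart p q c) (toChart p q d) (toChart p q b)) := by
  have hy0 := mem_extChartAt_target (I := 𝓡 4) q
  have hq0 : (extChartAt (𝓡 4) q).symm (extChartAt (𝓡 4) q q) = q :=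
    (extChartAt (𝓡 4) q).left_inv (mem_extChartAt_source (I := 𝓡 4) q)
  have hp : (extChartAt (𝓡 4) q).symm (extChartAt (𝓡 4) q q) ∈ (extChartAt (𝓡 4) p).source := by
    rwa [hq0]
  have hφ : localRep (n := 4) (k := 4) id q p (extChartAt (𝓡 4) q q) = extChartAt (𝓡 4) p q := by
    rw [localRep, hq0]; rfl
  have hch := g.bil_change hy0 hp
  have hf := (eventually_localRep_mem (ι := id) continuous_id hy0 hp).mono fun z hz =>
    contDiffAt_localRep (ι := id) contMDiff_id hz.1 hz.2
  have hd : ∀ u : 𝔼⁴, fderiv ℝ (localRep (n := 4) (k := 4) id q p) (extChartAt (𝓡 4) q q) u =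
      toChart p q u := fun u => by
    rw [fderiv_localRep (ι := id) contMDiff_id hy0 hp, mfderiv_id]
    exact apply_fromChart_self (fun x u => toChart p x u) q u
  have hmp := g.isLocalMetric (hφ ▸ (extChartAt (𝓡 4) p).map_source hq :
    localRep (n := 4) (k := 4) id q p (extChartAt (𝓡 4) q q) ∈ (extChartAt (𝓡 4) p).target)
  have h1 := hmp.isometry_curvature (g.isLocalMetric hy0) hf hch c d b
  rw [hφ] at h1
  have h2 := hch.self_of_nhds a (curvature (g.conn q) (extChartAt (𝓡 4) q q) c d b)
  rw [← h1, hφ] at h2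
  simp only [hd] at h2
  exact h2

lemma riemann_eq (q : M) (a b c d : Fin 4) : riemann g.tensor q a b c d =
    g.bil q (extChartAt (𝓡 4) q q) (stdVec a) (curvature (g.conn q) (extChartAt (𝓡 4) q q)
      (stdVec c) (stdVec d) (stdVec b)) := by
  have hm := g.isLocalMetric (mem_extChartAt_target (I := 𝓡 4) q)
  rw [riemann, g.isBilinear.comp_eq q, bil, matBil_apply]
  have : ∀ e, riemannUp (chartComp g.tensor q) e b c d (extChartAt (𝓡 4) q q) = _ :=
    fun e => riemannUp_eq hm.smooth_conn e b c d
  simp only [this]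
  symm
  rw [Finset.sum_eq_single a (fun i _ hi => by simp [hi]) (by simp)]
  exact Finset.sum_congr rfl fun e _ => by simp [conn]

/-- With Ric = Λg and R = 4Λ the two corrections have coefficients −Λ and +2Λ/3, together −Λ/3. -/
lemma weyl_eq {Λ : ℝ} (hg : EinsteinVacuum g Λ) (q : M) (a b c d : Fin 4) :
    weyl g q a b c d = riemann g.tensor q a b c d - Λ / 3 *
      (comp g.tensor q a c * comp g.tensor q d b - comp g.tensor q a d * comp g.tensor q c b) := by
  obtain ⟨h1, h2⟩ := hg.ricci_eq q
  have hs : ∀ i j, comp g.tensor q i j = comp g.tensor q j i := fun i j => g.symm _ _ _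
  simp only [weyl, h1, h2]
  rw [hs b c, hs b d, hs d a, hs c a]
  ring

end LorentzMetric

/-! ### Multilinear contractions in frames -/

section Multilinear

variable {n : ℕ}

local notation "𝔼" => EuclideanSpace ℝ (Fin n)

lemma sum_stdVec_mul {F : 𝔼 → ℝ} (h : IsLinearMap ℝ F) (u : 𝔼) :
    ∑ i, F (stdVec i) * u i = F u := by
  conv_rhs => rw [euclidean_sum u, ← h.mk'_apply, map_sum]
  exact Finset.sum_congr rfl fun i _ => by rw [map_smul, h.mk'_apply, smul_eq_mul, mul_comm]

lemma sum_stdVec_mul₄ {F : 𝔼 → 𝔼 → 𝔼 → 𝔼 → ℝ}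
    (h1 : ∀ b c d, IsLinearMap ℝ fun a => F a b c d) (h2 : ∀ a c d, IsLinearMap ℝ fun b => F a b c d)
    (h3 : ∀ a b d, IsLinearMap ℝ fun c => F a b c d) (h4 : ∀ a b c, IsLinearMap ℝ fun d => F a b c d)
    (a b c d : 𝔼) :
    ∑ i, ∑ j, ∑ k, ∑ l, F (stdVec i) (stdVec j) (stdVec k) (stdVec l) * a i * b j * c k * d l =
      F a b c d := by
  rw [← sum_stdVec_mul (h1 b c d) a]
  refine Finset.sum_congr rfl fun i _ => ?_
  rw [← sum_stdVec_mul (h2 _ c d) b, Finset.sum_mul]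
  refine Finset.sum_congr rfl fun j _ => ?_
  rw [← sum_stdVec_mul (h3 _ _ d) c, Finset.sum_mul, Finset.sum_mul]
  refine Finset.sum_congr rfl fun k _ => ?_
  rw [← sum_stdVec_mul (h4 _ _ _) d, Finset.sum_mul, Finset.sum_mul, Finset.sum_mul]
  exact Finset.sum_congr rfl fun l _ => by ring


lemma IsOrthoFrame.sum_inv_mul {m : Matrix (Fin n) (Fin n) ℝ} {ι : Type*} [Fintype ι] [DecidableEq ι] {e : ι → 𝔼}
    {s : ι → ℝ} (h : IsOrthoFrame (matBil m) e s) {B : 𝔼 → 𝔼 → ℝ}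
    (h1 : ∀ b, IsLinearMap ℝ fun a => B a b) (h2 : ∀ a, IsLinearMap ℝ (B a)) :
    ∑ a, ∑ b, m⁻¹ a b * B (stdVec a) (stdVec b) = ∑ i, s i * B (e i) (e i) :=
  h.sum_inv (LinearMap.mk₂ ℝ B (fun a a' b => (h1 b).map_add a a') (fun c a b => (h1 b).map_smul c a)
    (fun a => (h2 a).map_add) fun c a b => (h2 a).map_smul c b)

lemma isLinearMap_sum {κ : Type*} (t : Finset κ) {F : κ → 𝔼 → ℝ} (h : ∀ i, IsLinearMap ℝ (F i)) :
    IsLinearMap ℝ fun a => ∑ i ∈ t, F i a :=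
  ⟨fun a b => by simp [(h _).map_add, Finset.sum_add_distrib],
    fun c a => by simp [(h _).map_smul, Finset.mul_sum]⟩

lemma isLinearMap_mul_left {F : 𝔼 → ℝ} (h : IsLinearMap ℝ F) (c : ℝ) :
    IsLinearMap ℝ fun a => c * F a :=
  ⟨fun a b => by rw [h.map_add]; ring, fun r a => by rw [h.map_smul]; simp; ring⟩

lemma isLinearMap_mul_right {F : 𝔼 → ℝ} (h : IsLinearMap ℝ F) (c : ℝ) :
    IsLinearMap ℝ fun a => F a * c :=
  ⟨fun a b => by rw [h.map_add]; ring, fun r a => by rw [h.map_smul]; simp; ring⟩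

/-- Evaluation of the double contraction defining the dual tensor in an orthonormal frame. -/
lemma IsOrthoFrame.sum_dual {m : Matrix (Fin n) (Fin n) ℝ} {ι : Type*} [Fintype ι] [DecidableEq ι] {e : ι → 𝔼}
    {s : ι → ℝ} (h : IsOrthoFrame (matBil m) e s) {W ω' : 𝔼 → 𝔼 → 𝔼 → 𝔼 → ℝ}
    (h1 : ∀ b c d, IsLinearMap ℝ fun a => W a b c d) (h2 : ∀ a c d, IsLinearMap ℝ fun b => W a b c d)
    (h3 : ∀ a b d, IsLinearMap ℝ fun c => W a b c d) (h4 : ∀ a b c, IsLinearMap ℝ fun d => W a b c d)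
    (k1 : ∀ b c d, IsLinearMap ℝ fun a => ω' a b c d)
    (k2 : ∀ a c d, IsLinearMap ℝ fun b => ω' a b c d)
    (k3 : ∀ a b d, IsLinearMap ℝ fun c => ω' a b c d)
    (k4 : ∀ a b c, IsLinearMap ℝ fun d => ω' a b c d) (u n' c v : 𝔼) :
    ∑ α, ∑ μ, ∑ ν, ∑ β, ((1 / 2) * ∑ l, ∑ d, ∑ r, ∑ t, W (stdVec α) (stdVec μ) (stdVec l) (stdVec d)
      * m⁻¹ l r * m⁻¹ d t * ω' (stdVec r) (stdVec t) (stdVec ν) (stdVec β)) *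
      u α * n' μ * c ν * v β =
    (1 / 2) * ∑ i, ∑ j, (s i * s j) * (W u n' (e i) (e j) * ω' (e i) (e j) c v) := by
  rw [sum_stdVec_mul₄ (F := fun a b c d => (1 / 2) * ∑ l, ∑ k, ∑ r, ∑ t,
    W a b (stdVec l) (stdVec k) * m⁻¹ l r * m⁻¹ k t * ω' (stdVec r) (stdVec t) c d)
    (fun b c d => isLinearMap_mul_left (isLinearMap_sum _ fun l => isLinearMap_sum _ fun k =>
      isLinearMap_sum _ fun r => isLinearMap_sum _ fun t => isLinearMap_mul_right
        (isLinearMap_mul_right (isLinearMap_mul_right (h1 _ _ _) _) _) _) _)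
    (fun b c d => isLinearMap_mul_left (isLinearMap_sum _ fun l => isLinearMap_sum _ fun k =>
      isLinearMap_sum _ fun r => isLinearMap_sum _ fun t => isLinearMap_mul_right
        (isLinearMap_mul_right (isLinearMap_mul_right (h2 _ _ _) _) _) _) _)
    (fun b c d => isLinearMap_mul_left (isLinearMap_sum _ fun l => isLinearMap_sum _ fun k =>
      isLinearMap_sum _ fun r => isLinearMap_sum _ fun t => isLinearMap_mul_left (k3 _ _ _) _) _)
    (fun b c d => isLinearMap_mul_left (isLinearMap_sum _ fun l => isLinearMap_sum _ fun k =>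
      isLinearMap_sum _ fun r => isLinearMap_sum _ fun t => isLinearMap_mul_left (k4 _ _ _) _) _)]
  congr 1
  have e1 : ∀ a b, ∑ k, ∑ t, m⁻¹ k t * (W u n' a (stdVec k) * ω' b (stdVec t) c v) =
      ∑ j, s j * (W u n' a (e j) * ω' b (e j) c v) := fun a b =>
    h.sum_inv_mul (B := fun k t => W u n' a k * ω' b t c v)
      (fun b => isLinearMap_mul_right (h4 _ _ _) _) (fun a => isLinearMap_mul_left (k2 _ _ _) _)
  have e2 := h.sum_inv_mul (B := fun a b => ∑ j, s j * (W u n' a (e j) * ω' b (e j) c v))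
    (fun b => isLinearMap_sum _ fun j => isLinearMap_mul_left
      (isLinearMap_mul_right (h3 _ _ _) _) _)
    (fun a => isLinearMap_sum _ fun j => isLinearMap_mul_left
      (isLinearMap_mul_left (k1 _ _ _) _) _)
  calc _ = ∑ l, ∑ r, m⁻¹ l r * ∑ k, ∑ t,
        m⁻¹ k t * (W u n' (stdVec l) (stdVec k) * ω' (stdVec r) (stdVec t) c v) := by
        refine Finset.sum_congr rfl fun l _ => ?_
        rw [Finset.sum_comm]
        refine Finset.sum_congr rfl fun r _ => ?_
        rw [Finset.mul_sum]
        refine Finset.sum_congr rfl fun k _ => ?_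
        rw [Finset.mul_sum]
        exact Finset.sum_congr rfl fun t _ => by ring
    _ = _ := by
        simp only [e1]
        rw [e2]
        refine Finset.sum_congr rfl fun i _ => ?_
        rw [Finset.mul_sum]
        exact Finset.sum_congr rfl fun t _ => by ring

/-- Evaluation of the contraction defining the wedge product in an orthonormal frame. -/
lemma IsOrthoFrame.sum_wedge {m : Matrix (Fin n) (Fin n) ℝ} {ι : Type*} [Fintype ι] [DecidableEq ι] {e : ι → 𝔼}
    (h : IsOrthoFrame (matBil m) e 1) {ω' : 𝔼 → 𝔼 → ℝ} {A C : 𝔼 → 𝔼 → ℝ}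
    (k1 : ∀ b, IsLinearMap ℝ fun a => ω' a b) (k2 : ∀ a, IsLinearMap ℝ (ω' a))
    (a1 : ∀ b, IsLinearMap ℝ fun a => A a b) (a2 : ∀ a, IsLinearMap ℝ (A a))
    (c1 : ∀ b, IsLinearMap ℝ fun a => C a b) (c2 : ∀ a, IsLinearMap ℝ (C a)) :
    ∑ b, ∑ c, ∑ b', ∑ c', ∑ d, ∑ d', ω' (stdVec b') (stdVec c') * m⁻¹ b' b * m⁻¹ c' c *
      (A (stdVec b) (stdVec d') * m⁻¹ d' d) * C (stdVec d) (stdVec c) =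
    ∑ i, ∑ j, ω' (e i) (e j) * ∑ l, A (e i) (e l) * C (e l) (e j) := by
  have e1 : ∀ a b, ∑ k, ∑ t, m⁻¹ k t * (A a (stdVec k) * C (stdVec t) b) =
      ∑ j, A a (e j) * C (e j) b := fun a b => by
    have := h.sum_inv_mul (B := fun k t => A a k * C t b)
      (fun b => isLinearMap_mul_right (a2 _) _) (fun a => isLinearMap_mul_left (c1 _) _)
    simpa using this
  have e2 : ∀ a b, ∑ k, ∑ t, m⁻¹ k t * (ω' a (stdVec k) * ∑ l, A b (e l) * C (e l) (stdVec t)) =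
      ∑ j, ω' a (e j) * ∑ l, A b (e l) * C (e l) (e j) := fun a b => by
    have := h.sum_inv_mul (B := fun k t => ω' a k * ∑ l, A b (e l) * C (e l) t)
      (fun b => isLinearMap_mul_right (k2 _) _)
      (fun a => isLinearMap_mul_left (isLinearMap_sum _ fun l => isLinearMap_mul_left (c2 _) _) _)
    simpa using this
  have e3 := h.sum_inv_mul (B := fun k t => ∑ j, ω' k (e j) * ∑ l, A t (e l) * C (e l) (e j))
      (fun b => isLinearMap_sum _ fun j => isLinearMap_mul_right (k1 _) _)
      (fun a => isLinearMap_sum _ fun j => isLinearMap_mul_left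
        (isLinearMap_sum _ fun l => isLinearMap_mul_right (a1 _) _) _)
  simp only [Pi.one_apply, one_mul] at e3
  rw [← e3]
  simp only [← e2]
  simp only [← e1, Finset.mul_sum]
  trans ∑ b, ∑ b', ∑ c, ∑ c', ∑ d, ∑ d', ω' (stdVec b') (stdVec c') * m⁻¹ b' b * m⁻¹ c' c *
      (A (stdVec b) (stdVec d') * m⁻¹ d' d) * C (stdVec d) (stdVec c)
  · exact Finset.sum_congr rfl fun b _ => Finset.sum_comm
  rw [Finset.sum_comm]
  refine Finset.sum_congr rfl fun b' _ => ?_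
  refine Finset.sum_congr rfl fun b _ => ?_
  rw [Finset.sum_comm]
  refine Finset.sum_congr rfl fun c' _ => ?_
  refine Finset.sum_congr rfl fun c _ => ?_
  rw [Finset.sum_comm]
  refine Finset.sum_congr rfl fun d' _ => ?_
  refine Finset.sum_congr rfl fun d _ => ?_
  ring

lemma alternating_eq_det (A : 𝔼 [⋀^Fin n]→ₗ[ℝ] ℝ) (v : Fin n → 𝔼) :
    A v = A stdVec * (Matrix.of fun i j => v i j).det := by
  have h := A.eq_smul_basis_det (EuclideanSpace.basisFun (Fin n) ℝ).toBasis
  have h1 : ⇑(EuclideanSpace.basisFun (Fin n) ℝ).toBasis = stdVec := by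
    ext i; simp [stdVec]
  rw [h, AlternatingMap.smul_apply, AlternatingMap.smul_apply, smul_eq_mul, smul_eq_mul, h1]
  rw [← h1, Module.Basis.det_self, mul_one, Module.Basis.det_apply, ← Matrix.det_transpose]
  congr 2

end Multilinear

/-! ### Alternating 4-forms -/

section Alternating

variable {V : Type*} [AddCommGroup V] [Module ℝ V] (A : V [⋀^Fin 4]→ₗ[ℝ] ℝ)

lemma alternating_linear₀ (b c d : V) : IsLinearMap ℝ fun a => A ![a, b, c, d] :=
  ⟨fun x y => congrArg (fun B => B ![b, c, d]) (A.curryLeft.map_add x y),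
    fun r x => congrArg (fun B => B ![b, c, d]) (A.curryLeft.map_smul r x)⟩

lemma alternating_swap₂₃ (a b c d : V) : A ![a, b, c, d] = A ![c, d, a, b] := by
  have h1 := A.map_swap ![a, b, c, d] (show (0 : Fin 4) ≠ 2 by decide)
  have h2 := A.map_swap (![a, b, c, d] ∘ Equiv.swap (0 : Fin 4) 2) (show (1 : Fin 4) ≠ 3 by decide)
  rw [h1, neg_neg] at h2
  rw [← h2]
  congr 1
  ext i; fin_cases i <;> rfl

lemma alternating_swap₀₁ (a b c d : V) : A ![a, b, c, d] = -A ![b, a, c, d] := by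
  rw [← A.map_swap ![b, a, c, d] (show (0 : Fin 4) ≠ 1 by decide)]
  congr 1
  ext i; fin_cases i <;> rfl

lemma alternating_linear₁ (a c d : V) : IsLinearMap ℝ fun b => A ![a, b, c, d] := by
  have h := alternating_linear₀ A a c d
  exact ⟨fun x y => by simp only [alternating_swap₀₁ A a, h.map_add]; ring,
    fun r x => by simp only [alternating_swap₀₁ A a, h.map_smul]; simp⟩

lemma alternating_linear₂ (a b d : V) : IsLinearMap ℝ fun c => A ![a, b, c, d] := by
  simpa only [alternating_swap₂₃ A a b] using alternating_linear₀ A d a b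

lemma alternating_linear₃ (a b c : V) : IsLinearMap ℝ fun d => A ![a, b, c, d] := by
  simpa only [alternating_swap₂₃ A a b] using alternating_linear₁ A c a b

/-- In an adapted frame only the tangential components contribute to a contraction with the
interior product of a 4-form with the normal vector. -/
lemma alternating_sum_option {ι : Type*} [Fintype ι] (F : V → V → ℝ) (N v : V) (p : ι → V) :
    ∑ i : Option ι, ∑ j : Option ι, (i.elim (-1) (fun _ => 1) * j.elim (-1) fun _ => 1) *
      (F (i.elim N p) (j.elim N p) * A ![i.elim N p, j.elim N p, N, v]) =
    ∑ k, ∑ l, F (p k) (p l) * A ![N, v, p k, p l] := by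
  have hA : ∀ a b c, A ![a, b, a, c] = 0 := fun a b c =>
    A.map_eq_zero_of_eq _ (i := 0) (j := 2) rfl (by decide)
  have hA' : ∀ a b c, A ![b, a, a, c] = 0 := fun a b c =>
    A.map_eq_zero_of_eq _ (i := 1) (j := 2) rfl (by decide)
  simp only [Fintype.sum_option, Option.elim, hA, hA', mul_zero, zero_add, Finset.sum_const_zero]
  refine Finset.sum_congr rfl fun k _ => ?_
  refine Finset.sum_congr rfl fun l _ => ?_
  rw [alternating_swap₂₃ A, one_mul, one_mul]

end Alternating

/-! ### The Weyl tensor as a multilinear form -/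

namespace LorentzMetric

variable {M : Type*} [TopologicalSpace M] [ChartedSpace (EuclideanSpace ℝ (Fin 4)) M]
  [IsManifold (𝓡 4) ∞ M] (g : LorentzMetric M)

local notation "𝔼⁴" => EuclideanSpace ℝ (Fin 4)

/-- The Weyl tensor of a vacuum spacetime, in the preferred chart at `p`. -/
def weylForm (Λ : ℝ) (p : M) (y a b c d : 𝔼⁴) : ℝ :=
  g.bil p y a (curvature (g.conn p) y c d b) -
    Λ / 3 * (g.bil p y a c * g.bil p y d b - g.bil p y a d * g.bil p y c b)

lemma weylForm_linear (Λ : ℝ) (p : M) (y : 𝔼⁴) :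
    (∀ b c d, IsLinearMap ℝ fun a => g.weylForm Λ p y a b c d) ∧
    (∀ a c d, IsLinearMap ℝ fun b => g.weylForm Λ p y a b c d) ∧
    (∀ a b d, IsLinearMap ℝ fun c => g.weylForm Λ p y a b c d) ∧
    (∀ a b c, IsLinearMap ℝ fun d => g.weylForm Λ p y a b c d) := by
  refine ⟨fun b c d => ⟨?_, ?_⟩, fun a c d => ⟨?_, ?_⟩, fun a b d => ⟨?_, ?_⟩,
    fun a b c => ⟨?_, ?_⟩⟩ <;> intros <;>
  simp only [weylForm, map_add, map_smul, add_apply, smul_apply, smul_eq_mul] <;> ring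

lemma weyl_eq_weylForm {Λ : ℝ} (hg : EinsteinVacuum g Λ) (q : M) (a b c d : Fin 4) :
    weyl g q a b c d = g.weylForm Λ q (extChartAt (𝓡 4) q q) (stdVec a) (stdVec b) (stdVec c)
      (stdVec d) := by
  rw [g.weyl_eq hg, g.riemann_eq, g.isBilinear.comp_eq, weylForm]
  simp only [bil, matBil_stdVec]

lemma bil_self (q : M) (u v : 𝔼⁴) : g.bil q (extChartAt (𝓡 4) q q) u v = g.val q u v :=
  (g.isBilinear.eq_matBil_self q u v).symm

lemma bil_toChart {q p : M} (hq : q ∈ (extChartAt (𝓡 4) p).source) (u v : TangentSpace (𝓡 4) q) :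
    g.bil p (extChartAt (𝓡 4) p q) (toChart p q u) (toChart p q v) = g.val q u v :=
  (g.isBilinear.eq_matBil hq u v).symm

lemma weylForm_change (Λ : ℝ) {q p : M} (hq : q ∈ (extChartAt (𝓡 4) p).source) (a b c d : 𝔼⁴) :
    g.weylForm Λ q (extChartAt (𝓡 4) q q) a b c d = g.weylForm Λ p (extChartAt (𝓡 4) p q)
      (toChart p q a) (toChart p q b) (toChart p q c) (toChart p q d) := by
  have h : ∀ u v : 𝔼⁴, g.bil q (extChartAt (𝓡 4) q q) u v =
      g.bil p (extChartAt (𝓡 4) p q) (toChart p q u) (toChart p q v) := fun u v =>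
    (g.bil_self q u v).trans (g.bil_toChart hq u v).symm
  have h2 := g.bil_curvature_change hq a b c d
  simp only [weylForm]
  rw [h2, h, h, h, h]

end LorentzMetric

/-! ### Vector fields along maps, in charts -/

section VectorFields

variable {n k : ℕ} {M : Type*} [TopologicalSpace M] [ChartedSpace (EuclideanSpace ℝ (Fin n)) M]
  [IsManifold (𝓡 n) ∞ M] {S : Type*} [TopologicalSpace S]
  [ChartedSpace (EuclideanSpace ℝ (Fin k)) S] [IsManifold (𝓡 k) ∞ S] {ι : S → M}

lemma toChart_eq_trivialization {p x : M} (hx : x ∈ (extChartAt (𝓡 n) p).source)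
    (u : TangentSpace (𝓡 n) x) : toChart p x u =
      (trivializationAt (EuclideanSpace ℝ (Fin n)) (TangentSpace (𝓡 n)) p
        (⟨x, u⟩ : TangentBundle (𝓡 n) M)).2 := by
  have hx' : x ∈ (chartAt (EuclideanSpace ℝ (Fin n)) p).source := by
    rwa [← extChartAt_source (𝓡 n)]
  have hb : x ∈ (trivializationAt (EuclideanSpace ℝ (Fin n))
      (TangentSpace (𝓡 n)) p).baseSet := by simpa using hx'
  have h3 := TangentBundle.continuousLinearMapAt_trivializationAt (I := 𝓡 n) (x₀ := p) (x := x) hx'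
  rw [toChart, ← h3, Bundle.Trivialization.continuousLinearMapAt_apply,
    Bundle.Trivialization.coe_linearMapAt_of_mem _ hb]

omit [IsManifold (𝓡 k) ∞ S] in
-- Chart components are the fibre coordinates of the bundle trivialisation near the base point.
lemma contMDiffAt_toChart_along {Z : ∀ s, TangentSpace (𝓡 n) (ι s)}
    (hZ : ContMDiff (𝓡 k) (𝓡 n).tangent ∞ (fun s => (⟨ι s, Z s⟩ : TangentBundle (𝓡 n) M)))
    {s : S} {p : M} (hp : ι s ∈ (extChartAt (𝓡 n) p).source) :
    ContMDiffAt (𝓡 k) 𝓘(ℝ, EuclideanSpace ℝ (Fin n)) ∞ (fun s' => toChart p (ι s') (Z s')) s := by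
  have hb : ∀ x ∈ (extChartAt (𝓡 n) p).source, x ∈ (trivializationAt (EuclideanSpace ℝ (Fin n))
      (TangentSpace (𝓡 n)) p).baseSet := fun x hx => by simpa using hx
  have h := hZ s
  rw [(trivializationAt (EuclideanSpace ℝ (Fin n))
    (TangentSpace (𝓡 n)) p).contMDiffAt_iff (IB := 𝓡 n) (by
      rw [Bundle.Trivialization.mem_source]; exact hb _ hp)] at h
  refine h.2.congr_of_eventuallyEq ?_
  filter_upwards [h.1.continuousAt.eventually ((isOpen_extChartAt_source p).mem_nhds hp)] with s' hs'
  exact toChart_eq_trivialization hs' _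

lemma contDiffAt_toChart_along {Z : ∀ s, TangentSpace (𝓡 n) (ι s)}
    (hZ : ContMDiff (𝓡 k) (𝓡 n).tangent ∞ (fun s => (⟨ι s, Z s⟩ : TangentBundle (𝓡 n) M)))
    {s : S} {p : M} {y : EuclideanSpace ℝ (Fin k)} (hy : y ∈ (extChartAt (𝓡 k) s).target)
    (hp : ι ((extChartAt (𝓡 k) s).symm y) ∈ (extChartAt (𝓡 n) p).source) :
    ContDiffAt ℝ ∞ (fun z => toChart p (ι ((extChartAt (𝓡 k) s).symm z))
      (Z ((extChartAt (𝓡 k) s).symm z))) y := by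
  rw [← contMDiffAt_iff_contDiffAt]
  exact (contMDiffAt_toChart_along hZ hp).comp y (contMDiffAt_extChartAt_symm hy)

lemma fderiv_toChart_along {Z : ∀ s, TangentSpace (𝓡 n) (ι s)}
    (hZ : ContMDiff (𝓡 k) (𝓡 n).tangent ∞ (fun s => (⟨ι s, Z s⟩ : TangentBundle (𝓡 n) M)))
    {s : S} {p : M} (hp : ι s ∈ (extChartAt (𝓡 n) p).source) (u : TangentSpace (𝓡 k) s) :
    mfderiv (𝓡 k) 𝓘(ℝ, EuclideanSpace ℝ (Fin n)) (fun s' => toChart p (ι s') (Z s')) s u =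
    fderiv ℝ (fun z => toChart p (ι ((extChartAt (𝓡 k) s).symm z))
      (Z ((extChartAt (𝓡 k) s).symm z))) (extChartAt (𝓡 k) s s) u := by
  have hy := mem_extChartAt_target (I := 𝓡 k) s
  have hs : (extChartAt (𝓡 k) s).symm (extChartAt (𝓡 k) s s) = s :=
    (extChartAt (𝓡 k) s).left_inv (mem_extChartAt_source (I := 𝓡 k) s)
  have h1 := (contMDiffAt_toChart_along hZ (s := (extChartAt (𝓡 k) s).symm (extChartAt (𝓡 k) s s))
    (p := p) (by rwa [hs])).mdifferentiableAt (by simp)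
  have h2 := (contMDiffAt_extChartAt_symm hy).mdifferentiableAt (by simp)
  have h3 : (fun z => toChart p (ι ((extChartAt (𝓡 k) s).symm z))
      (Z ((extChartAt (𝓡 k) s).symm z))) = (fun s' => toChart (n := n) p (ι s') (Z s')) ∘
      (extChartAt (𝓡 k) s).symm := rfl
  rw [← mfderiv_eq_fderiv, h3, mfderiv_comp _ h1 h2]
  exact (apply_fromChart_self (fun x w => mfderiv (𝓡 k) 𝓘(ℝ, EuclideanSpace ℝ (Fin n))
    (fun s' => toChart p (ι s') (Z s')) x w) s u).symm

end VectorFields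

/-! ### The hypersurface tensors in charts -/

namespace SpacelikeHypersurface

variable {M : Type*} [TopologicalSpace M] [ChartedSpace (EuclideanSpace ℝ (Fin 4)) M]
  [IsManifold (𝓡 4) ∞ M] {S : Type*} [TopologicalSpace S]
  [ChartedSpace (EuclideanSpace ℝ (Fin 3)) S] {g : LorentzMetric M}
  (H : SpacelikeHypersurface S g) (ε : VolumeForm g)

local notation "𝔼³" => EuclideanSpace ℝ (Fin 3)
local notation "𝔼⁴" => EuclideanSpace ℝ (Fin 4)

lemma push_add (s : S) (u v : TangentSpace (𝓡 3) s) : H.push s (u + v) = H.push s u + H.push s v :=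
  map_add _ _ _

lemma push_smul (s : S) (c : ℝ) (u : TangentSpace (𝓡 3) s) : H.push s (c • u) = c • H.push s u :=
  map_smul _ _ _

lemma isBilinear_γ : IsBilinear H.γ := fun s =>
  ⟨LinearMap.mk₂ ℝ (H.γ s) (by simp [γ, push_add]) (by simp [γ, push_smul])
    (by simp [γ, push_add]) (by simp [γ, push_smul]), fun _ _ => rfl⟩

/-- Covers the electric and magnetic tensors together, as they differ only in the 4-tensor that is
contracted. -/
lemma isBilinear_of_components (C : S → Fin 4 → Fin 4 → Fin 4 → Fin 4 → ℝ) :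
    IsBilinear (fun s u v => ∑ α, ∑ μ, ∑ ν, ∑ β, C s α μ ν β *
      coord (H.push s u) α * coord (H.n s) μ * coord (H.n s) ν * coord (H.push s v) β) := fun s =>
  ⟨LinearMap.mk₂ ℝ (fun u v => ∑ α, ∑ μ, ∑ ν, ∑ β, C s α μ ν β *
      coord (H.push s u) α * coord (H.n s) μ * coord (H.n s) ν * coord (H.push s v) β)
    (fun a b c => by
      have h : ∀ i, coord (H.push s (a + b)) i = coord (H.push s a) i + coord (H.push s b) i :=
        fun i => by rw [push_add]; rfl
      simp only [h, mul_add, add_mul, Finset.sum_add_distrib])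
    (fun a b c => by
      have h : ∀ i, coord (H.push s (a • b)) i = a * coord (H.push s b) i :=
        fun i => by rw [push_smul]; rfl
      simp only [h, smul_eq_mul]
      simp only [Finset.mul_sum, mul_assoc, mul_left_comm])
    (fun c a b => by
      have h : ∀ i, coord (H.push s (a + b)) i = coord (H.push s a) i + coord (H.push s b) i :=
        fun i => by rw [push_add]; rfl
      simp only [h, mul_add, Finset.sum_add_distrib])
    (fun a c b => by
      have h : ∀ i, coord (H.push s (a • b)) i = a * coord (H.push s b) i :=
        fun i => by rw [push_smul]; rfl
      simp only [h, smul_eq_mul]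
      simp only [Finset.mul_sum, mul_left_comm]), fun _ _ => rfl⟩

lemma isBilinear_E : IsBilinear H.E := H.isBilinear_of_components fun s => weyl g (H.ι s)

lemma isBilinear_B : IsBilinear (H.B ε) :=
  H.isBilinear_of_components fun s => weylDual g ε (H.ι s)

variable [IsManifold (𝓡 3) ∞ S]

/-- The representative of the hypersurface in the preferred charts at `s` and `H.ι s`. -/
def rep (s : S) : 𝔼³ → 𝔼⁴ := localRep H.ι s (H.ι s)

/-- The components of the normal field in the preferred chart at `H.ι s`. -/
def normalRep (s : S) (z : 𝔼³) : 𝔼⁴ :=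
  toChart (H.ι s) (H.ι ((extChartAt (𝓡 3) s).symm z)) (H.n ((extChartAt (𝓡 3) s).symm z))

/-- The points of the preferred chart at `s` that are mapped to the preferred chart at `H.ι s`. -/
def IsGood (s : S) (z : 𝔼³) : Prop :=
  z ∈ (extChartAt (𝓡 3) s).target ∧
    H.ι ((extChartAt (𝓡 3) s).symm z) ∈ (extChartAt (𝓡 4) (H.ι s)).source

variable {H} {s : S} {z : 𝔼³}

omit [IsManifold (𝓡 3) ∞ S] in
lemma symm_extChartAt_self (s : S) : (extChartAt (𝓡 3) s).symm (extChartAt (𝓡 3) s s) = s :=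
  (extChartAt (𝓡 3) s).left_inv (mem_extChartAt_source (I := 𝓡 3) s)

omit [IsManifold (𝓡 3) ∞ S] in
lemma isGood_self (s : S) : H.IsGood s (extChartAt (𝓡 3) s s) :=
  ⟨mem_extChartAt_target (I := 𝓡 3) s, by
    rw [symm_extChartAt_self]; exact mem_extChartAt_source (I := 𝓡 4) _⟩

omit [IsManifold (𝓡 3) ∞ S] in
lemma IsGood.eventually (h : H.IsGood s z) : ∀ᶠ z' in 𝓝 z, H.IsGood s z' :=
  eventually_localRep_mem H.smooth.continuous h.1 h.2

omit [IsManifold (𝓡 3) ∞ S] in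
lemma IsGood.rep_mem (h : H.IsGood s z) : H.rep s z ∈ (extChartAt (𝓡 4) (H.ι s)).target :=
  (extChartAt (𝓡 4) (H.ι s)).map_source h.2

omit [IsManifold (𝓡 3) ∞ S] in
lemma IsGood.isLocalMetric (h : H.IsGood s z) :
    IsLocalMetric (g.bil (H.ι s)) (g.conn (H.ι s)) (H.rep s z) :=
  g.isLocalMetric h.rep_mem

lemma IsGood.contDiffAt_rep (h : H.IsGood s z) : ContDiffAt ℝ ∞ (H.rep s) z :=
  contDiffAt_localRep H.smooth h.1 h.2

lemma IsGood.contDiffAt_normalRep (h : H.IsGood s z) : ContDiffAt ℝ ∞ (H.normalRep s) z :=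
  contDiffAt_toChart_along H.smooth_n h.1 h.2

lemma IsGood.fderiv_rep (h : H.IsGood s z) (u : 𝔼³) : fderiv ℝ (H.rep s) z u =
    toChart (H.ι s) (H.ι ((extChartAt (𝓡 3) s).symm z)) (H.push _ (fromChart s z u)) :=
  fderiv_localRep H.smooth h.1 h.2 u

lemma fderiv_rep_self (s : S) (u : 𝔼³) :
    fderiv ℝ (H.rep s) (extChartAt (𝓡 3) s s) u = H.push s u := by
  rw [(isGood_self s).fderiv_rep]
  exact (apply_fromChart_self (fun x w => toChart (H.ι s) (H.ι x) (H.push x w)) s u).trans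
    (toChart_self _ _)

omit [IsManifold (𝓡 3) ∞ S] in
lemma normalRep_self (s : S) : H.normalRep s (extChartAt (𝓡 3) s s) = H.n s := by
  rw [normalRep, symm_extChartAt_self]
  exact toChart_self _ _

lemma IsGood.matBil_γ (h : H.IsGood s z) (u v : 𝔼³) : matBil (chartComp H.γ s z) u v =
    g.bil (H.ι s) (H.rep s z) (fderiv ℝ (H.rep s) z u) (fderiv ℝ (H.rep s) z v) := by
  rw [H.isBilinear_γ.matBil_chartComp]
  exact g.isBilinear.pullback_eq H.smooth h.1 h.2 u v

omit [IsManifold (𝓡 3) ∞ S] in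
lemma IsGood.unit (h : H.IsGood s z) :
    g.bil (H.ι s) (H.rep s z) (H.normalRep s z) (H.normalRep s z) = -1 :=
  (g.bil_toChart h.2 _ _).trans (H.unit_n _)

lemma IsGood.normal (h : H.IsGood s z) (u : 𝔼³) :
    g.bil (H.ι s) (H.rep s z) (H.normalRep s z) (fderiv ℝ (H.rep s) z u) = 0 := by
  rw [h.fderiv_rep]
  exact (g.bil_toChart h.2 _ _).trans (H.normal_n _ _)

lemma IsGood.posDef (h : H.IsGood s z) : (chartComp H.γ s z).PosDef := by
  have hs : ∀ i j, chartComp H.γ s z i j = chartComp H.γ s z j i := fun i j => g.symm _ _ _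
  refine Matrix.PosDef.of_dotProduct_mulVec_pos (by ext i j; simp [hs i j]) fun v hv => ?_
  have h1 : (star v ⬝ᵥ (chartComp H.γ s z).mulVec v) =
      matBil (chartComp H.γ s z) (WithLp.toLp 2 v) (WithLp.toLp 2 v) := by
    rw [matBil_apply]
    simp only [dotProduct, Matrix.mulVec, Finset.mul_sum]
    exact Finset.sum_congr rfl fun i _ => Finset.sum_congr rfl fun j _ => by simp; ring
  rw [h1, H.isBilinear_γ.matBil_chartComp]
  refine H.spacelike _ _ fun h0 => hv ?_
  have h2 := toChart_fromChart h.1 (WithLp.toLp 2 v)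
  rw [h0, map_zero] at h2
  simpa using (congrArg WithLp.ofLp h2).symm

lemma IsGood.contDiffAt_γ (h : H.IsGood s z) (i j : Fin 3) :
    ContDiffAt ℝ ∞ (fun z => chartComp H.γ s z i j) z := by
  have h1 : (fun z => chartComp H.γ s z i j) =ᶠ[𝓝 z] fun z => g.bil (H.ι s) (H.rep s z)
      (fderiv ℝ (H.rep s) z (stdVec i)) (fderiv ℝ (H.rep s) z (stdVec j)) := by
    filter_upwards [h.eventually] with z hz
    rw [← hz.matBil_γ, matBil_stdVec]
  refine ContDiffAt.congr_of_eventuallyEq ?_ h1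
  have hf := h.contDiffAt_rep
  exact ((h.isLocalMetric.smooth.comp z hf).clm_apply
    (hf.fderiv_infty.clm_apply contDiffAt_const)).clm_apply
    (hf.fderiv_infty.clm_apply contDiffAt_const)

variable (H) in
/-- The Levi-Civita connection of the induced metric in the preferred chart at `s`. -/
def inducedConn (s : S) : 𝔼³ → 𝔼³ →L[ℝ] 𝔼³ →L[ℝ] 𝔼³ := matConn (chartComp H.γ s)

lemma IsGood.isLocalHypersurface (h : H.IsGood s z) :
    IsLocalHypersurface (g.bil (H.ι s)) (g.conn (H.ι s)) (fun z => matBil (chartComp H.γ s z))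
      (H.inducedConn s) (H.rep s) (H.normalRep s) z where
  ambient := h.isLocalMetric
  induced := isLocalMetric_matBil (h.eventually.mono fun _ hz => hz.contDiffAt_γ)
    (h.eventually.mono fun _ hz => hz.posDef.det_pos.ne')
    (Eventually.of_forall fun _ _ _ => g.symm _ _ _)
  smooth := h.contDiffAt_rep
  smooth_normal := h.contDiffAt_normalRep
  induced_eq := h.eventually.mono fun _ hz => hz.matBil_γ
  unit := h.eventually.mono fun _ hz => hz.unit
  normal := h.eventually.mono fun _ hz => hz.normal
  finrank := by simp

omit [IsManifold (𝓡 3) ∞ S] in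
lemma rep_self (s : S) : H.rep s (extChartAt (𝓡 3) s s) = extChartAt (𝓡 4) (H.ι s) (H.ι s) := by
  rw [rep, localRep, symm_extChartAt_self]

/-- Identifies the derivative taken on the manifold S with a derivative in the chart at s, so that
the local hypersurface theory applies to K. -/
lemma nablaNormal_eq_covAlong (u : 𝔼³) (α : Fin 4) :
    H.nablaNormal s u α = covAlong (g.conn (H.ι s)) (H.rep s) (H.normalRep s)
      (extChartAt (𝓡 3) s s) u α := by
  have h1 := fderiv_toChart_along H.smooth_n (p := H.ι s)
    (mem_extChartAt_source (I := 𝓡 4) (H.ι s)) u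
  rw [covAlong, PiLp.add_apply]
  refine congrArg₂ (· + ·) (congrArg (fun w : 𝔼⁴ => w α) h1) ?_
  rw [fderiv_rep_self, normalRep_self, LorentzMetric.conn, rep_self]
  refine Eq.trans ?_ (matConn_apply _ _ _ _ _).symm
  exact Finset.sum_congr rfl fun i _ => Finset.sum_congr rfl fun j _ => mul_assoc _ _ _

/-- The extrinsic curvature in coordinates. -/
lemma K_eq_extrinsic (u v : 𝔼³) : H.K s u v = extrinsic (g.bil (H.ι s)) (g.conn (H.ι s)) (H.rep s)
    (H.normalRep s) (extChartAt (𝓡 3) s s) u v := by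
  change -∑ α, ∑ β, WeylCharge.comp g.tensor (H.ι s) α β * H.nablaNormal s u α *
    coord (H.push s v) β = _
  rw [extrinsic, LorentzMetric.bil, matBil_apply, fderiv_rep_self, rep_self]
  simp only [nablaNormal_eq_covAlong, g.isBilinear.comp_eq, mul_assoc]
  rfl

lemma isBilinear_K : IsBilinear H.K := fun s =>
  ⟨(LinearMap.mk₂ ℝ (extrinsic (g.bil (H.ι s)) (g.conn (H.ι s)) (H.rep s)
    (H.normalRep s) (extChartAt (𝓡 3) s s))
    (by intros; simp [extrinsic, covAlong]; ring) (by intros; simp [extrinsic, covAlong]; ring)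
    (by intros; simp [extrinsic, covAlong]; ring) (by intros; simp [extrinsic, covAlong]; ring) :
    𝔼³ →ₗ[ℝ] 𝔼³ →ₗ[ℝ] ℝ), fun u v => K_eq_extrinsic u v⟩

omit [IsManifold (𝓡 3) ∞ S] in
lemma E_eq_weylForm {Λ : ℝ} (hg : EinsteinVacuum g Λ) (u v : TangentSpace (𝓡 3) s) :
    H.E s u v = g.weylForm Λ (H.ι s) (extChartAt (𝓡 4) (H.ι s) (H.ι s)) (H.push s u) (H.n s) (H.n s)
      (H.push s v) := by
  obtain ⟨h1, h2, h3, h4⟩ := g.weylForm_linear Λ (H.ι s) (extChartAt (𝓡 4) (H.ι s) (H.ι s))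
  refine Eq.trans ?_ (sum_stdVec_mul₄ h1 h2 h3 h4 _ _ _ _)
  simp only [E, g.weyl_eq_weylForm hg]
  rfl

/-- Of the constant-curvature term only the product containing G(N, N) = −1 survives; the other
contains G(N, df u) = 0. -/
lemma IsGood.matBil_E {Λ : ℝ} (hg : EinsteinVacuum g Λ) (h : H.IsGood s z) (u v : 𝔼³) :
    matBil (chartComp H.E s z) u v = electric (g.bil (H.ι s)) (g.conn (H.ι s)) (H.rep s)
      (H.normalRep s) z u v - Λ / 3 * matBil (chartComp H.γ s z) u v := by
  have hs := fun u v => h.isLocalMetric.symm_self u v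
  rw [H.isBilinear_E.matBil_chartComp, E_eq_weylForm hg]
  refine (g.weylForm_change Λ h.2 _ _ _ _).trans ?_
  rw [h.matBil_γ]
  have hu : ∀ u : 𝔼³, toChart (H.ι s) (H.ι ((extChartAt (𝓡 3) s).symm z))
      (H.push _ (fromChart s z u)) = fderiv ℝ (H.rep s) z u := fun u => (h.fderiv_rep u).symm
  rw [hu, hu]
  change g.weylForm Λ (H.ι s) (H.rep s z) _ (H.normalRep s z) (H.normalRep s z) _ = _
  rw [LorentzMetric.weylForm, electric, hs _ (H.normalRep s z), h.normal, h.unit]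
  ring

omit [IsManifold (𝓡 3) ∞ S] in
-- The frame of TS is completed by n with sign −1. Pairs containing n drop out because ε is already
-- contracted with n, so only tangential pairs remain in the dual.
lemma B_eq_weylForm {Λ : ℝ} (hg : EinsteinVacuum g Λ) {e : Fin 3 → TangentSpace (𝓡 3) s}
    (he : ∀ i j, H.γ s (e i) (e j) = if i = j then 1 else 0) (u v : TangentSpace (𝓡 3) s) :
    H.B ε s u v = (1 / 2) * ∑ k, ∑ l,
      g.weylForm Λ (H.ι s) (extChartAt (𝓡 4) (H.ι s) (H.ι s)) (H.push s u) (H.n s)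
        (H.push s (e k)) (H.push s (e l)) * H.vol ε s v (e k) (e l) := by
  obtain ⟨h1, h2, h3, h4⟩ := g.weylForm_linear Λ (H.ι s) (extChartAt (𝓡 4) (H.ι s) (H.ι s))
  let A : 𝔼⁴ [⋀^Fin 4]→ₗ[ℝ] ℝ := ε.val (H.ι s)
  let e' : Option (Fin 3) → 𝔼⁴ := fun o => o.elim (H.n s) fun i => H.push s (e i)
  have hf : IsOrthoFrame (matBil (WeylCharge.comp g.tensor (H.ι s))) e'
      (fun o : Option (Fin 3) => o.elim (-1) fun _ => 1) := by
    refine IsOrthoFrame.of_orth ?_ ?_ (by simp)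
    · rintro (_ | i) <;> simp
    · rw [g.isBilinear.comp_eq]
      change ∀ i j, g.bil _ _ _ _ = _
      simp only [g.bil_self]
      rintro (_ | i) (_ | j)
      · exact (H.unit_n s).trans (by simp)
      · exact (H.normal_n s (e j)).trans (by simp)
      · exact ((g.symm _ _ _).trans (H.normal_n s (e i))).trans (by simp)
      · exact (he i j).trans (by simp)
  have hsum := hf.sum_dual h1 h2 h3 h4 (ω' := fun a b c d => A ![a, b, c, d])
    (fun b c d => alternating_linear₀ A b c d) (fun b c d => alternating_linear₁ A b c d)
    (fun b c d => alternating_linear₂ A b c d) (fun b c d => alternating_linear₃ A b c d)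
    (H.push s u) (H.n s) (H.n s) (H.push s v)
  refine Eq.trans ?_ (hsum.trans ?_)
  · simp only [B, weylDual, g.weyl_eq_weylForm hg]
    rfl
  exact congrArg ((1 / 2 : ℝ) * ·) (alternating_sum_option A _ (H.n s) (H.push s v)
    fun i => H.push s (e i))

variable (H) in
/-- The density of the volume form in the preferred chart at `s`. -/
def density (s : S) (z : 𝔼³) : ℝ :=
  H.vol ε ((extChartAt (𝓡 3) s).symm z) (frame s z 0) (frame s z 1) (frame s z 2)

omit [IsManifold (𝓡 3) ∞ S] in
-- Contracting ε with n and pulling back gives an alternating 3-form on a 3-dimensional space, hence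
-- a multiple of the determinant.
lemma vol_fromChart (z u v w : 𝔼³) :
    H.vol ε ((extChartAt (𝓡 3) s).symm z) (fromChart s z u) (fromChart s z v) (fromChart s z w) =
      H.density ε s z * det3 u v w := by
  let x := (extChartAt (𝓡 3) s).symm z
  let L : 𝔼³ →ₗ[ℝ] TangentSpace (𝓡 4) (H.ι x) :=
    (mfderiv (𝓡 3) (𝓡 4) H.ι x).toLinearMap ∘ₗ (fromChart s z).toLinearMap
  let A : 𝔼³ [⋀^Fin 3]→ₗ[ℝ] ℝ := ((ε.val (H.ι x)).curryLeft (H.n x)).compLinearMap L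
  have h1 : ∀ a b c : 𝔼³, A ![a, b, c] = H.vol ε x (fromChart s z a) (fromChart s z b)
      (fromChart s z c) := fun a b c => by
    refine congrArg (ε.val (H.ι x)) ?_
    ext i; fin_cases i <;> rfl
  have h2 := alternating_eq_det A ![u, v, w]
  rw [h1] at h2
  rw [h2]
  have h3 : (stdVec : Fin 3 → 𝔼³) = ![stdVec 0, stdVec 1, stdVec 2] := by
    ext i; fin_cases i <;> rfl
  rw [h3, h1]
  refine congrArg₂ (· * ·) rfl ?_
  rw [Matrix.det_fin_three, det3]
  simp
  ring

omit [IsManifold (𝓡 3) ∞ S] in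
-- The Gram matrix of n and the three tangent vectors is block diagonal with blocks −1 and γ; the
-- sign cancels the one in the normalisation of ε.
lemma density_sq (z : 𝔼³) : H.density ε s z ^ 2 = (chartComp H.γ s z).det := by
  let x := (extChartAt (𝓡 3) s).symm z
  have h := ε.sq_eq (H.ι x) ![H.n x, H.push x (frame s z 0), H.push x (frame s z 1),
    H.push x (frame s z 2)]
  rw [density, vol, h]
  have h0 : ∀ u, g.val (H.ι x) (H.n x) (H.push x u) = 0 := H.normal_n x
  rw [Matrix.det_succ_row_zero, Fin.sum_univ_succ]
  simp only [Fin.sum_univ_three, Matrix.of_apply]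
  simp [h0, H.unit_n]
  congr 1
  ext i j
  fin_cases i <;> fin_cases j <;> rfl

/-- The density of the spacetime volume form is pulled back by the adapted frame. -/
lemma IsGood.density_eq (h : H.IsGood s z) : H.density ε s z =
    ε.val ((extChartAt (𝓡 4) (H.ι s)).symm (H.rep s z)) (frame (H.ι s) (H.rep s z)) *
      (Matrix.of fun i j : Fin 4 => (![H.normalRep s z, fderiv ℝ (H.rep s) z (stdVec 0),
        fderiv ℝ (H.rep s) z (stdVec 1), fderiv ℝ (H.rep s) z (stdVec 2)] : Fin 4 → 𝔼⁴) i j).det := by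
  have key : ∀ x ∈ (extChartAt (𝓡 4) (H.ι s)).source, ∀ v : Fin 4 → TangentSpace (𝓡 4) x,
      ε.val x v = ε.val ((extChartAt (𝓡 4) (H.ι s)).symm (extChartAt (𝓡 4) (H.ι s) x))
        (frame (H.ι s) (extChartAt (𝓡 4) (H.ι s) x)) *
        (Matrix.of fun i j : Fin 4 => (toChart (H.ι s) x (v i) : 𝔼⁴) j).det := by
    intro x hx v
    obtain ⟨y, hy, rfl⟩ : ∃ y ∈ (extChartAt (𝓡 4) (H.ι s)).target,
        x = (extChartAt (𝓡 4) (H.ι s)).symm y :=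
      ⟨_, (extChartAt (𝓡 4) (H.ι s)).map_source hx, ((extChartAt (𝓡 4) (H.ι s)).left_inv hx).symm⟩
    rw [(extChartAt (𝓡 4) (H.ι s)).right_inv hy]
    let A : 𝔼⁴ [⋀^Fin 4]→ₗ[ℝ] ℝ := (ε.val ((extChartAt (𝓡 4) (H.ι s)).symm y)).compLinearMap
      (fromChart (H.ι s) y).toLinearMap
    have h1 := alternating_eq_det A fun i => toChart (H.ι s) _ (v i)
    refine Eq.trans ?_ h1
    change _ = ε.val _ fun i => fromChart (H.ι s) y (toChart (H.ι s) _ (v i))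
    simp only [fromChart_toChart hy]
  refine (key _ h.2 _).trans (congrArg₂ (· * ·) rfl (congrArg Matrix.det ?_))
  ext i j
  simp only [Matrix.of_apply]
  refine congrArg (fun w : 𝔼⁴ => w j) ?_
  fin_cases i
  · rfl
  · exact (h.fderiv_rep _).symm
  · exact (h.fderiv_rep _).symm
  · exact (h.fderiv_rep _).symm

/-- The volume form ε is only assumed continuous, which gives continuity of the density; smoothness
then follows because its square is the smooth nonvanishing det γ. -/
lemma IsGood.isLocalVolume (h : H.IsGood s z) :
    IsLocalVolume (chartComp H.γ s) (H.inducedConn s) (H.density ε s) z := by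
  have h0 : H.density ε s z ≠ 0 := fun h0 => by
    have h1 := H.density_sq ε (s := s) z
    rw [h0] at h1
    exact h.posDef.det_pos.ne' (by simpa using h1.symm)
  refine ⟨h.isLocalHypersurface.induced, ?_, Eventually.of_forall fun z => H.density_sq ε z, h0⟩
  refine contDiffAt_of_sq ?_ (contDiffAt_det h.contDiffAt_γ)
    (Eventually.of_forall fun z => H.density_sq ε z) h0
  have h1 : H.density ε s =ᶠ[𝓝 z] _ := h.eventually.mono fun z' hz' => hz'.density_eq ε
  refine ContinuousAt.congr_of_eventuallyEq ?_ h1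
  refine ContinuousAt.mul ?_ ?_
  · have h2 := (ε.continuousOn (H.ι s)).continuousAt ((isOpen_extChartAt_target
      (I := 𝓡 4) (H.ι s)).mem_nhds h.rep_mem)
    exact h2.comp h.contDiffAt_rep.continuousAt
  · have hc : ∀ u, ContinuousAt (fun z => fderiv ℝ (H.rep s) z u) z := fun u =>
      (h.contDiffAt_rep.fderiv_infty.clm_apply contDiffAt_const).continuousAt
    refine (contDiffAt_det (n := 4) (Gm := fun z => Matrix.of fun i j : Fin 4 =>
      (![H.normalRep s z, fderiv ℝ (H.rep s) z (stdVec 0),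
        fderiv ℝ (H.rep s) z (stdVec 1), fderiv ℝ (H.rep s) z (stdVec 2)] : Fin 4 → 𝔼⁴) i j)
      fun i j => ?_).continuousAt
    have hd : ∀ u, ContDiffAt ℝ ∞ (fun z => fderiv ℝ (H.rep s) z u) z := fun u =>
      h.contDiffAt_rep.fderiv_infty.clm_apply contDiffAt_const
    have hj : ∀ F : 𝔼³ → 𝔼⁴, ContDiffAt ℝ ∞ F z → ContDiffAt ℝ ∞ (fun z => F z j) z :=
      fun F hF => (EuclideanSpace.proj (𝕜 := ℝ) j).contDiff.contDiffAt.comp z hF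
    fin_cases i
    · exact hj _ h.contDiffAt_normalRep
    · exact hj _ (hd _)
    · exact hj _ (hd _)
    · exact hj _ (hd _)

/-- Both products in the constant-curvature term pair the normal with a tangent vector, so the Weyl
and Riemann tensors have the same magnetic part. -/
lemma IsGood.matBil_B {Λ : ℝ} (hg : EinsteinVacuum g Λ) (h : H.IsGood s z) (u v : 𝔼³) :
    matBil (chartComp (H.B ε) s z) u v = magnetic (g.bil (H.ι s)) (g.conn (H.ι s))
      (chartComp H.γ s) (H.rep s) (H.normalRep s) (H.density ε s) z u v := by
  obtain ⟨e, he⟩ := exists_orthoFrame h.posDef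
  have he' : ∀ i j, H.γ ((extChartAt (𝓡 3) s).symm z) (fromChart s z (e i)) (fromChart s z (e j)) =
      if i = j then 1 else 0 := fun i j => by
    rw [← H.isBilinear_γ.matBil_chartComp, he.orth]; rfl
  rw [IsLocalHypersurface.magnetic_eq_sum (h.isLocalVolume ε) he, (H.isBilinear_B ε).matBil_chartComp,
    B_eq_weylForm ε hg he']
  congr 1
  refine Finset.sum_congr rfl fun k _ => ?_
  refine Finset.sum_congr rfl fun l _ => ?_
  rw [vol_fromChart]
  congr 1
  refine (g.weylForm_change Λ h.2 _ _ _ _).trans ?_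
  have hu : ∀ u : 𝔼³, toChart (H.ι s) (H.ι ((extChartAt (𝓡 3) s).symm z))
      (H.push _ (fromChart s z u)) = fderiv ℝ (H.rep s) z u := fun u => (h.fderiv_rep u).symm
  rw [hu, hu, hu]
  change g.weylForm Λ (H.ι s) (H.rep s z) _ (H.normalRep s z) _ _ = _
  have hs := fun u v => h.isLocalMetric.symm_self u v
  rw [LorentzMetric.weylForm, codazzi, hs _ (H.normalRep s z), hs _ (H.normalRep s z), h.normal,
    h.normal]
  ring

end SpacelikeHypersurface

/-! ### Covariant divergence as a frame sum -/

section Divergence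

variable {n : ℕ} {M : Type*} [TopologicalSpace M] [ChartedSpace (EuclideanSpace ℝ (Fin n)) M]
  [IsManifold (𝓡 n) ∞ M]

local notation "𝔼" => EuclideanSpace ℝ (Fin n)

lemma sum_single_left {m : Matrix (Fin n) (Fin n) ℝ} (u : 𝔼) (j : Fin n) :
    matBil m u (stdVec j) = ∑ l, u l * m l j := by
  rw [matBil_apply]
  refine Finset.sum_congr rfl fun l _ => ?_
  rw [Finset.sum_eq_single j (fun i _ hi => by simp [hi]) (by simp)]
  simp [mul_comm]

lemma sum_single_right {m : Matrix (Fin n) (Fin n) ℝ} (u : 𝔼) (j : Fin n) :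
    matBil m (stdVec j) u = ∑ l, u l * m j l := by
  rw [matBil_apply, Finset.sum_eq_single j (fun i _ hi => by simp [hi]) (by simp)]
  refine Finset.sum_congr rfl fun l _ => ?_
  simp [mul_comm]

lemma IsBilinear.isLinearMap_left {T : Tensor2 n M} (hT : IsBilinear T) (p : M) (b : 𝔼) :
    IsLinearMap ℝ fun a : 𝔼 => T p a b := by
  have h : (fun a : 𝔼 => T p a b) = fun a => matBil (chartComp T p (extChartAt (𝓡 n) p p)) a b :=
    funext fun a => hT.eq_matBil_self p a b
  rw [h]
  exact ⟨by simp, by simp⟩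

lemma IsBilinear.isLinearMap_right {T : Tensor2 n M} (hT : IsBilinear T) (p : M) (a : 𝔼) :
    IsLinearMap ℝ fun b : 𝔼 => T p a b := by
  have h : (fun b : 𝔼 => T p a b) = fun b => matBil (chartComp T p (extChartAt (𝓡 n) p p)) a b :=
    funext fun b => hT.eq_matBil_self p a b
  rw [h]
  exact ⟨by simp, by simp⟩

lemma covDeriv2_eq {g T : Tensor2 n M} (hT : IsBilinear T) {p : M}
    (h : ∀ i j, ContDiffAt ℝ ∞ (fun z => chartComp T p z i j) (extChartAt (𝓡 n) p p))
    (k i j : Fin n) : covDeriv2 g T p k i j = nablaTensor (matConn (chartComp g p))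
      (fun z => matBil (chartComp T p z)) (extChartAt (𝓡 n) p p) (stdVec k) (stdVec i)
      (stdVec j) := by
  rw [covDeriv2, nablaTensor, pd_eq_fderiv_matBil h, sum_single_left, sum_single_right,
    hT.comp_eq]
  simp only [matConn_stdVec]
  rfl

lemma divergence_eq_sum {g T : Tensor2 n M} (hg : IsBilinear g) (hT : IsBilinear T) {p : M}
    (h : ∀ i j, ContDiffAt ℝ ∞ (fun z => chartComp T p z i j) (extChartAt (𝓡 n) p p))
    {ι : Type*} [Fintype ι] [DecidableEq ι] {e : ι → 𝔼}
    (he : IsOrthoFrame (matBil (chartComp g p (extChartAt (𝓡 n) p p))) e 1) (v : 𝔼) :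
    divergence g T p v = ∑ i, nablaTensor (matConn (chartComp g p))
      (fun z => matBil (chartComp T p z)) (extChartAt (𝓡 n) p p) (e i) (e i) v := by
  have h1 : ∀ v : 𝔼, ∑ k, ∑ i, (comp g p)⁻¹ k i * nablaTensor (matConn (chartComp g p))
      (fun z => matBil (chartComp T p z)) (extChartAt (𝓡 n) p p) (stdVec k) (stdVec i) v =
      ∑ i, nablaTensor (matConn (chartComp g p))
      (fun z => matBil (chartComp T p z)) (extChartAt (𝓡 n) p p) (e i) (e i) v := fun v => by
    rw [hg.comp_eq]
    have := he.sum_inv_mul (B := fun a b => nablaTensor (matConn (chartComp g p))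
      (fun z => matBil (chartComp T p z)) (extChartAt (𝓡 n) p p) a b v)
      (fun b => ⟨by intros; simp [nablaTensor]; ring, by intros; simp [nablaTensor]; ring⟩)
      (fun b => ⟨by intros; simp [nablaTensor]; ring, by intros; simp [nablaTensor]; ring⟩)
    simpa using this
  simp only [divergence, covDeriv2_eq hT h, h1]
  refine (sum_stdVec_mul (F := fun v => ∑ i, nablaTensor (matConn (chartComp g p))
      (fun z => matBil (chartComp T p z)) (extChartAt (𝓡 n) p p) (e i) (e i) v)
      (isLinearMap_sum _ fun i => ?_) v)
  exact ⟨by intros; simp [nablaTensor]; ring, by intros; simp [nablaTensor]; ring⟩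

end Divergence

/-! ### The divergence identities for E and B -/

namespace SpacelikeHypersurface

variable {M : Type*} [TopologicalSpace M] [ChartedSpace (EuclideanSpace ℝ (Fin 4)) M]
  [IsManifold (𝓡 4) ∞ M] {S : Type*} [TopologicalSpace S]
  [ChartedSpace (EuclideanSpace ℝ (Fin 3)) S] [IsManifold (𝓡 3) ∞ S] {g : LorentzMetric M}
  {H : SpacelikeHypersurface S g} (ε : VolumeForm g) {s : S} {z : EuclideanSpace ℝ (Fin 3)}

local notation "𝔼³" => EuclideanSpace ℝ (Fin 3)

lemma vol_toChart {x : S} (hx : x ∈ (extChartAt (𝓡 3) s).source) (u v w : TangentSpace (𝓡 3) x) :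
    H.vol ε x u v w = H.density ε s (extChartAt (𝓡 3) s x) *
      det3 (toChart s x u) (toChart s x v) (toChart s x w) := by
  obtain ⟨y, hy, rfl⟩ : ∃ y ∈ (extChartAt (𝓡 3) s).target, x = (extChartAt (𝓡 3) s).symm y :=
    ⟨_, (extChartAt (𝓡 3) s).map_source hx, ((extChartAt (𝓡 3) s).left_inv hx).symm⟩
  rw [(extChartAt (𝓡 3) s).right_inv hy, ← vol_fromChart, fromChart_toChart hy,
    fromChart_toChart hy, fromChart_toChart hy]

lemma vol_self (u v w : 𝔼³) :
    H.vol ε s u v w = H.density ε s (extChartAt (𝓡 3) s s) * det3 u v w := by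
  refine (vol_toChart ε (mem_extChartAt_source (I := 𝓡 3) s) u v w).trans ?_
  exact congrArg (_ * ·) (congr (congrArg₂ det3 (toChart_self s u) (toChart_self s v))
    (toChart_self s w))

lemma wedge_eq_sum {A C : Tensor2 3 S} (hA : IsBilinear A) (hC : IsBilinear C) {e : Fin 3 → 𝔼³}
    (he : IsOrthoFrame (matBil (chartComp H.γ s (extChartAt (𝓡 3) s s))) e 1) (v : 𝔼³) :
    H.wedge ε A C s v = ∑ b, ∑ c, H.density ε s (extChartAt (𝓡 3) s s) * det3 v (e b) (e c) *
      ∑ d, A s (e b) (e d) * C s (e d) (e c) := by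
  have hd : ∀ r : ℝ, (∀ b, IsLinearMap ℝ fun a => r * det3 v a b) ∧
      ∀ a, IsLinearMap ℝ fun b => r * det3 v a b := fun r => by
    refine ⟨fun b => ⟨?_, ?_⟩, fun b => ⟨?_, ?_⟩⟩ <;> intros <;> simp [det3] <;> ring
  refine Eq.trans ?_ (he.sum_wedge
    (ω' := fun a b => H.density ε s (extChartAt (𝓡 3) s s) * det3 v a b) (hd _).1 (hd _).2
    (hA.isLinearMap_left s) (hA.isLinearMap_right s) (hC.isLinearMap_left s)
    (hC.isLinearMap_right s))
  simp only [wedge, ← vol_self, H.isBilinear_γ.comp_eq]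
  rfl

/-- The density annihilates symmetric tensors. -/
lemma sum_det3_symm {Q : 𝔼³ → 𝔼³ → ℝ} (hQ : ∀ a b, Q a b = Q b a) (r : ℝ) (v : 𝔼³)
    (e : Fin 3 → 𝔼³) : ∑ b, ∑ c, r * det3 v (e b) (e c) * Q (e b) (e c) = 0 := by
  simp only [Fin.sum_univ_three, det3]
  rw [hQ (e 1) (e 0), hQ (e 2) (e 0), hQ (e 2) (e 1)]
  ring

lemma IsGood.contDiffAt_E {Λ : ℝ} (hg : EinsteinVacuum g Λ) (h : H.IsGood s z) (i j : Fin 3) :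
    ContDiffAt ℝ ∞ (fun z => chartComp H.E s z i j) z := by
  have h1 : (fun z => chartComp H.E s z i j) =ᶠ[𝓝 z] fun z => electric (g.bil (H.ι s))
      (g.conn (H.ι s)) (H.rep s) (H.normalRep s) z (stdVec i) (stdVec j) -
      Λ / 3 * chartComp H.γ s z i j := by
    filter_upwards [h.eventually] with z hz
    exact ((matBil_stdVec (chartComp H.E s z) i j).symm.trans (hz.matBil_E hg _ _)).trans
      (by rw [matBil_stdVec])
  exact ((h.isLocalHypersurface.contDiffAt_electric _ _).sub
    (contDiffAt_const.mul (h.contDiffAt_γ i j))).congr_of_eventuallyEq h1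

lemma IsGood.contDiffAt_B {Λ : ℝ} (hg : EinsteinVacuum g Λ) (h : H.IsGood s z) (i j : Fin 3) :
    ContDiffAt ℝ ∞ (fun z => chartComp (H.B ε) s z i j) z := by
  have h1 : (fun z => chartComp (H.B ε) s z i j) =ᶠ[𝓝 z] fun z => magnetic (g.bil (H.ι s))
      (g.conn (H.ι s)) (chartComp H.γ s) (H.rep s) (H.normalRep s) (H.density ε s) z
      (stdVec i) (stdVec j) := by
    filter_upwards [h.eventually] with z hz
    exact (matBil_stdVec (chartComp (H.B ε) s z) i j).symm.trans (hz.matBil_B ε hg _ _)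
  exact (h.isLocalHypersurface.contDiffAt_magnetic (h.isLocalVolume ε) _ _).congr_of_eventuallyEq h1

omit [IsManifold (𝓡 3) ∞ S] in
lemma IsGood.ricci {Λ : ℝ} (hg : EinsteinVacuum g Λ) (h : H.IsGood s z) :
    ∀ᶠ x in 𝓝 (H.rep s z), ∀ b d, ricciTrace (g.conn (H.ι s)) x b d =
      Λ * g.bil (H.ι s) x b d := by
  filter_upwards [(isOpen_extChartAt_target (I := 𝓡 4) (H.ι s)).mem_nhds h.rep_mem] with x hx
  exact g.ricciTrace_chart hg hx

/-- E and the electric part of the Riemann tensor differ by (Λ/3)γ, which is parallel. -/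
lemma IsGood.nablaTensor_E {Λ : ℝ} (hg : EinsteinVacuum g Λ) (h : H.IsGood s z) (w u v : 𝔼³) :
    nablaTensor (H.inducedConn s) (fun z => matBil (chartComp H.E s z)) z w u v =
    fderiv ℝ (fun z => electric (g.bil (H.ι s)) (g.conn (H.ι s)) (H.rep s) (H.normalRep s) z u v) z w
      - electric (g.bil (H.ι s)) (g.conn (H.ι s)) (H.rep s) (H.normalRep s) z
        (H.inducedConn s z w u) v
      - electric (g.bil (H.ι s)) (g.conn (H.ι s)) (H.rep s) (H.normalRep s) z u
        (H.inducedConn s z w v) := by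
  have h1 : (fun z => matBil (chartComp H.E s z) u v) =ᶠ[𝓝 z] fun z => electric (g.bil (H.ι s))
      (g.conn (H.ι s)) (H.rep s) (H.normalRep s) z u v - Λ / 3 * matBil (chartComp H.γ s z) u v :=
    h.eventually.mono fun z hz => hz.matBil_E hg u v
  have hγ := contDiffAt_matBil h.contDiffAt_γ
  have hγ' : DifferentiableAt ℝ (fun z => matBil (chartComp H.γ s z) u v) z :=
    ((hγ.clm_apply contDiffAt_const).clm_apply contDiffAt_const).diffAt
  rw [nablaTensor, ← fderiv_apply₂ (contDiffAt_matBil (h.contDiffAt_E hg)).diffAt,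
    fderiv_congr_apply h1, fderiv_fun_sub (h.isLocalHypersurface.contDiffAt_electric u v).diffAt
      (hγ'.const_mul _), fderiv_const_mul hγ', h.matBil_E hg, h.matBil_E hg]
  simp only [sub_apply, smul_apply, smul_eq_mul]
  rw [fderiv_apply₂ hγ.diffAt, h.isLocalHypersurface.induced.compat]
  ring

lemma IsGood.nablaTensor_B {Λ : ℝ} (hg : EinsteinVacuum g Λ) (h : H.IsGood s z) (w u v : 𝔼³) :
    nablaTensor (H.inducedConn s) (fun z => matBil (chartComp (H.B ε) s z)) z w u v =
    fderiv ℝ (fun z => magnetic (g.bil (H.ι s)) (g.conn (H.ι s)) (chartComp H.γ s) (H.rep s)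
      (H.normalRep s) (H.density ε s) z u v) z w
      - magnetic (g.bil (H.ι s)) (g.conn (H.ι s)) (chartComp H.γ s) (H.rep s) (H.normalRep s)
        (H.density ε s) z (H.inducedConn s z w u) v
      - magnetic (g.bil (H.ι s)) (g.conn (H.ι s)) (chartComp H.γ s) (H.rep s) (H.normalRep s)
        (H.density ε s) z u (H.inducedConn s z w v) := by
  have h1 : (fun z => matBil (chartComp (H.B ε) s z) u v) =ᶠ[𝓝 z] fun z => magnetic
      (g.bil (H.ι s)) (g.conn (H.ι s)) (chartComp H.γ s) (H.rep s) (H.normalRep s)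
      (H.density ε s) z u v := h.eventually.mono fun z hz => hz.matBil_B ε hg u v
  rw [nablaTensor, ← fderiv_apply₂ (contDiffAt_matBil (h.contDiffAt_B ε hg)).diffAt,
    fderiv_congr_apply h1, h.matBil_B ε hg, h.matBil_B ε hg]

theorem divergence_E {Λ : ℝ} (hg : EinsteinVacuum g Λ) (v : TangentSpace (𝓡 3) s) :
    divergence H.γ H.E s v = H.wedge ε H.K (H.B ε) s v := by
  have h := isGood_self (H := H) s
  obtain ⟨e, he⟩ := exists_orthoFrame h.posDef
  refine (divergence_eq_sum H.isBilinear_γ H.isBilinear_E (h.contDiffAt_E hg) he v).trans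
    (Eq.trans ?_ (wedge_eq_sum ε isBilinear_K (H.isBilinear_B ε) he v).symm)
  refine (Finset.sum_congr rfl fun i _ => h.nablaTensor_E hg (e i) (e i) v).trans ?_
  refine (h.isLocalHypersurface.divergence_electric_eq (h.isLocalVolume ε) he (h.ricci hg) v).trans ?_
  refine Finset.sum_congr rfl fun b _ => ?_
  refine Finset.sum_congr rfl fun c _ => ?_
  refine congrArg₂ (· * ·) rfl (Finset.sum_congr rfl fun d _ => ?_)
  refine congrArg₂ (· * ·) (K_eq_extrinsic _ _).symm ?_
  rw [← h.matBil_B ε hg]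
  exact ((H.isBilinear_B ε).eq_matBil_self s _ _).symm

theorem divergence_B {Λ : ℝ} (hg : EinsteinVacuum g Λ) (v : TangentSpace (𝓡 3) s) :
    divergence H.γ (H.B ε) s v = -H.wedge ε H.K H.E s v := by
  have h := isGood_self (H := H) s
  obtain ⟨e, he⟩ := exists_orthoFrame h.posDef
  refine (divergence_eq_sum H.isBilinear_γ (H.isBilinear_B ε) (h.contDiffAt_B ε hg) he v).trans
    (Eq.trans ?_ (congrArg (-·) (wedge_eq_sum ε isBilinear_K H.isBilinear_E he v).symm))
  refine (Finset.sum_congr rfl fun i _ => h.nablaTensor_B ε hg (e i) (e i) v).trans ?_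
  refine (h.isLocalHypersurface.divergence_magnetic (h.isLocalVolume ε) he (h.ricci hg) v).trans ?_
  congr 1
  -- The local formula has the electric part of the Riemann tensor in place of E. The difference is
  -- (Λ/3) K ∧ γ, which vanishes because K is symmetric.
  have h0 := sum_det3_symm (fun a b => h.isLocalHypersurface.extrinsic_symm a b)
    (Λ / 3 * H.density ε s (extChartAt (𝓡 3) s s)) v e
  rw [← sub_zero (∑ b, _), ← h0, ← Finset.sum_sub_distrib]
  refine Finset.sum_congr rfl fun b _ => ?_
  rw [← Finset.sum_sub_distrib]
  refine Finset.sum_congr rfl fun c _ => ?_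
  have hE : ∀ d, H.K s (e b) (e d) * H.E s (e d) (e c) =
    extrinsic (g.bil (H.ι s)) (g.conn (H.ι s)) (H.rep s) (H.normalRep s) (extChartAt (𝓡 3) s s)
      (e b) (e d) * electric (g.bil (H.ι s)) (g.conn (H.ι s)) (H.rep s) (H.normalRep s)
      (extChartAt (𝓡 3) s s) (e d) (e c) - (if d = c then Λ / 3 *
      extrinsic (g.bil (H.ι s)) (g.conn (H.ι s)) (H.rep s) (H.normalRep s) (extChartAt (𝓡 3) s s)
      (e b) (e d) else 0) := fun d => by
    refine (congrArg₂ (· * ·) (K_eq_extrinsic _ _) (H.isBilinear_E.eq_matBil_self s _ _)).trans ?_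
    rw [h.matBil_E hg, he.orth]
    split_ifs <;> simp
    ring
  refine Eq.trans ?_ (congrArg₂ (· * ·) rfl (Finset.sum_congr rfl fun d _ => (hE d).symm))
  rw [Finset.sum_sub_distrib, Finset.sum_ite_eq']
  simp only [Finset.mem_univ, if_true]
  ring

end SpacelikeHypersurface

/-! ### Raising an index -/

section Raise

variable {n : ℕ}

local notation "𝔼" => EuclideanSpace ℝ (Fin n)

/-- Raising an index. -/
lemma matBil_raise {m : Matrix (Fin n) (Fin n) ℝ} (hd : m.det ≠ 0) (hs : ∀ i j, m i j = m j i)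
    {φ : 𝔼 → ℝ} (hφ : IsLinearMap ℝ φ) (u : 𝔼) :
    matBil m (∑ i, (∑ k, m⁻¹ i k * φ (stdVec k)) • stdVec i) u = φ u := by
  have h1 : m * m⁻¹ = 1 := Matrix.mul_nonsing_inv m (isUnit_iff_ne_zero.2 hd)
  rw [← sum_stdVec_mul hφ u, matBil_apply, Finset.sum_comm]
  refine Finset.sum_congr rfl fun j _ => ?_
  have h2 : ∀ i, (∑ i, (∑ k, m⁻¹ i k * φ (stdVec k)) • stdVec (n := n) i) i =
      ∑ k, m⁻¹ i k * φ (stdVec k) := fun i => by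
    simp [Finset.sum_apply, Pi.single_apply]
  simp only [h2]
  calc _ = (∑ k, (m * m⁻¹) j k * φ (stdVec k)) * u j := by
        simp only [Matrix.mul_apply, Finset.sum_mul, Finset.mul_sum]
        rw [Finset.sum_comm]
        refine Finset.sum_congr rfl fun k _ => ?_
        refine Finset.sum_congr rfl fun i _ => ?_
        rw [hs j i]; ring
    _ = _ := by rw [h1]; simp [Matrix.one_apply]

lemma eq_raise {m : Matrix (Fin n) (Fin n) ℝ} (hd : m.PosDef) {φ : 𝔼 → ℝ} (hφ : IsLinearMap ℝ φ)
    {v : 𝔼} (h : ∀ u, matBil m v u = φ u) :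
    v = ∑ i, (∑ k, m⁻¹ i k * φ (stdVec k)) • stdVec i := by
  have hs : ∀ i j, m i j = m j i := fun i j => by simpa using hd.isHermitian.apply j i
  obtain ⟨e, he⟩ := exists_orthoFrame hd
  have hsm : ∀ u v, matBil m u v = matBil m v u := fun u v => by
    rw [matBil_apply, matBil_apply, Finset.sum_comm]
    exact Finset.sum_congr rfl fun i _ => Finset.sum_congr rfl fun j _ => by rw [hs i j]; ring
  rw [he.complete v, he.complete (∑ i, (∑ k, m⁻¹ i k * φ (stdVec k)) • stdVec i)]
  refine Finset.sum_congr rfl fun i _ => ?_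
  rw [hsm _ v, h, hsm _ (∑ i, _), matBil_raise hd.det_pos.ne' hs hφ]

end Raise

/-! ### The charge density and its vanishing divergence -/

namespace SpacelikeHypersurface

variable {M : Type*} [TopologicalSpace M] [ChartedSpace (EuclideanSpace ℝ (Fin 4)) M]
  [IsManifold (𝓡 4) ∞ M] {S : Type*} [TopologicalSpace S]
  [ChartedSpace (EuclideanSpace ℝ (Fin 3)) S] [IsManifold (𝓡 3) ∞ S] {g : LorentzMetric M}
  {H : SpacelikeHypersurface S g} (ε : VolumeForm g) {s : S} {z : EuclideanSpace ℝ (Fin 3)}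
  {T : Tensor2 3 S} {X : ∀ s : S, TangentSpace (𝓡 3) s}

local notation "𝔼³" => EuclideanSpace ℝ (Fin 3)

lemma γ_contract (hT : IsBilinear T) (s : S) (u : 𝔼³) :
    H.γ s (H.contract T X s) u = T s u (X s) := by
  have hp := (isGood_self (H := H) s).posDef
  refine (H.isBilinear_γ.eq_matBil_self s _ _).trans (Eq.trans ?_ (matBil_raise hp.det_pos.ne' (fun i j => g.symm _ _ _)
    (φ := fun u => T s u (X s)) (hT.isLinearMap_left s (X s)) u))
  rw [← H.isBilinear_γ.comp_eq]
  rfl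

/-- The components of a vector field in the preferred chart at `s`. -/
def fieldRep (s : S) (X : ∀ s : S, TangentSpace (𝓡 3) s) (z : 𝔼³) : 𝔼³ :=
  toChart s ((extChartAt (𝓡 3) s).symm z) (X ((extChartAt (𝓡 3) s).symm z))

lemma fieldRep_self (s : S) : fieldRep s X (extChartAt (𝓡 3) s s) = X s := by
  rw [fieldRep, symm_extChartAt_self]
  exact toChart_self _ _

lemma IsGood.matBil_contract (hT : IsBilinear T) (h : H.IsGood s z) (u : 𝔼³) :
    matBil (chartComp H.γ s z) (fieldRep s (H.contract T X) z) u =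
      matBil (chartComp T s z) u (fieldRep s X z) := by
  rw [H.isBilinear_γ.matBil_chartComp, hT.matBil_chartComp, fieldRep, fieldRep,
    fromChart_toChart h.1, fromChart_toChart h.1]
  exact γ_contract hT _ _

/-- The contraction is determined by its pairing with γ, so in the chart it is given by the smooth
inverse matrix applied to smooth components. -/
lemma IsGood.contDiffAt_contract (hT : IsBilinear T) (h : H.IsGood s z)
    (hTs : ∀ i j, ContDiffAt ℝ ∞ (fun z => chartComp T s z i j) z)
    (hX : ContDiffAt ℝ ∞ (fieldRep s X) z) :
    ContDiffAt ℝ ∞ (fieldRep s (H.contract T X)) z := by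
  have h1 : fieldRep s (H.contract T X) =ᶠ[𝓝 z] fun z => ∑ i, (∑ k, (chartComp H.γ s z)⁻¹ i k *
      matBil (chartComp T s z) (stdVec k) (fieldRep s X z)) • stdVec i :=
    h.eventually.mono fun z hz => eq_raise hz.posDef
      (φ := fun u => matBil (chartComp T s z) u (fieldRep s X z)) ⟨by simp, by simp⟩
      (hz.matBil_contract hT)
  refine ContDiffAt.congr_of_eventuallyEq ?_ h1
  refine ContDiffAt.sum fun i _ => ContDiffAt.fun_smul (ContDiffAt.sum fun k _ => ?_) contDiffAt_const
  exact (contDiffAt_matrix_inv h.contDiffAt_γ h.posDef.det_pos.ne' i k).mul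
    (((contDiffAt_matBil hTs).clm_apply contDiffAt_const).clm_apply hX)

lemma contDiffAt_fieldRep
    (hX : ContMDiff (𝓡 3) (𝓡 3).tangent ∞ (fun p => (⟨p, X p⟩ : TangentBundle (𝓡 3) S)))
    (hz : z ∈ (extChartAt (𝓡 3) s).target) : ContDiffAt ℝ ∞ (fieldRep s X) z :=
  contDiffAt_toChart_along (ι := fun s => s) hX hz ((extChartAt (𝓡 3) s).map_target hz)

/-- Lowering an index commutes with ∇ by metric compatibility; this turns the component form of the
Killing equation into one for the vector field itself. -/
lemma covDerivLower_eq
    (hX : ContMDiff (𝓡 3) (𝓡 3).tangent ∞ (fun p => (⟨p, X p⟩ : TangentBundle (𝓡 3) S)))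
    (s : S) (i j : Fin 3) :
    covDerivLower H.γ X s i j = matBil (chartComp H.γ s (extChartAt (𝓡 3) s s))
      (fderiv ℝ (fieldRep s X) (extChartAt (𝓡 3) s s) (stdVec i)
        + H.inducedConn s (extChartAt (𝓡 3) s s) (stdVec i)
          (fieldRep s X (extChartAt (𝓡 3) s s))) (stdVec j) := by
  have h := isGood_self (H := H) s
  have h1 : (fun y => H.γ ((extChartAt (𝓡 3) s).symm y) (X ((extChartAt (𝓡 3) s).symm y))
      (frame s y j)) =ᶠ[𝓝 (extChartAt (𝓡 3) s s)] fun y =>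
      matBil (chartComp H.γ s y) (fieldRep s X y) (stdVec j) := by
    filter_upwards [h.eventually] with y hy
    rw [H.isBilinear_γ.matBil_chartComp, fieldRep, fromChart_toChart hy.1]
    rfl
  have hγ := (contDiffAt_matBil h.contDiffAt_γ).diffAt
  have hXd := (contDiffAt_fieldRep hX h.1).diffAt
  have h2 : HasFDerivAt (fun y => matBil (chartComp H.γ s y) (fieldRep s X y) (stdVec j)) _ _ :=
    (hγ.hasFDerivAt.clm_apply hXd.hasFDerivAt).clm_apply (hasFDerivAt_const (stdVec j) _)
  have h3 : ∑ k, christoffelAt H.γ s k i j * H.γ s (X s) (bvec s k) =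
      matBil (chartComp H.γ s (extChartAt (𝓡 3) s s)) (fieldRep s X (extChartAt (𝓡 3) s s))
        (H.inducedConn s (extChartAt (𝓡 3) s s) (stdVec i) (stdVec j)) := by
    rw [inducedConn, ← sum_stdVec_mul (F := fun u => matBil (chartComp H.γ s
      (extChartAt (𝓡 3) s s)) (fieldRep s X (extChartAt (𝓡 3) s s)) u) ⟨by simp, by simp⟩]
    refine Finset.sum_congr rfl fun k _ => ?_
    rw [matConn_stdVec, mul_comm]
    refine congrArg₂ (· * ·) ?_ rfl
    exact (H.isBilinear_γ.eq_matBil_self s (X s) (bvec s k)).trans (by rw [fieldRep_self]; rfl)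
  rw [covDerivLower, h3, pd, fderiv_congr_apply h1, h2.fderiv]
  have hc := h.isLocalHypersurface.induced.compat
    (fieldRep s X (extChartAt (𝓡 3) s s)) (stdVec j) (stdVec i)
  simp only [add_apply, ContinuousLinearMap.comp_apply, ContinuousLinearMap.flip_apply,
    zero_apply, map_zero, zero_add, map_add]
  linear_combination hc

lemma conformalKilling_eq (hX : IsConformalKilling H.γ X) (s : S) : ∃ lam : ℝ, ∀ u v : 𝔼³,
    matBil (chartComp H.γ s (extChartAt (𝓡 3) s s))
      (fderiv ℝ (fieldRep s X) (extChartAt (𝓡 3) s s) u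
        + H.inducedConn s (extChartAt (𝓡 3) s s) u (fieldRep s X (extChartAt (𝓡 3) s s))) v
    + matBil (chartComp H.γ s (extChartAt (𝓡 3) s s))
      (fderiv ℝ (fieldRep s X) (extChartAt (𝓡 3) s s) v
        + H.inducedConn s (extChartAt (𝓡 3) s s) v (fieldRep s X (extChartAt (𝓡 3) s s))) u =
    lam * matBil (chartComp H.γ s (extChartAt (𝓡 3) s s)) u v := by
  obtain ⟨lam, hlam⟩ := hX.eqn
  refine ⟨lam s, fun u v => ?_⟩
  let D : 𝔼³ →L[ℝ] 𝔼³ := fderiv ℝ (fieldRep s X) (extChartAt (𝓡 3) s s) +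
    (H.inducedConn s (extChartAt (𝓡 3) s s)).flip (fieldRep s X (extChartAt (𝓡 3) s s))
  let m := chartComp H.γ s (extChartAt (𝓡 3) s s)
  let B : 𝔼³ →ₗ[ℝ] 𝔼³ →ₗ[ℝ] ℝ := LinearMap.mk₂ ℝ
    (fun u v => matBil m (D u) v + matBil m (D v) u)
    (by intros; simp only [map_add, add_apply]; ring)
    (by intros; simp only [map_smul, smul_apply, smul_eq_mul]; ring)
    (by intros; simp only [map_add, add_apply]; ring)
    (by intros; simp only [map_smul, smul_apply, smul_eq_mul]; ring)
  have h1 := matBil_eq_of_stdVec (m := lam s • m) (B := B) (fun i j => by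
    have h2 := hlam s i j
    rw [covDerivLower_eq hX.smooth, covDerivLower_eq hX.smooth, H.isBilinear_γ.comp_eq] at h2
    rw [add_comm] at h2
    rw [Matrix.smul_apply, smul_eq_mul, ← h2]
    rfl) u v
  change _ = matBil m (D u) v + matBil m (D v) u at h1
  refine h1.symm.trans ?_
  rw [matBil_apply, matBil_apply, Finset.mul_sum]
  refine Finset.sum_congr rfl fun i _ => ?_
  rw [Finset.mul_sum]
  refine Finset.sum_congr rfl fun i _ => ?_
  simp [m, mul_assoc]

variable (H T X) in
/-- The vector density whose flux is the charge, in the preferred chart at `s`. -/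
def fluxDensity (s : S) (z : 𝔼³) : 𝔼³ := H.density ε s z • fieldRep s (H.contract T X) z

lemma contDiffAt_fluxDensity (hT : IsBilinear T)
    (hTs : ∀ i j, ContDiffAt ℝ ∞ (fun z => chartComp T s z i j) (extChartAt (𝓡 3) s s))
    (hX : IsConformalKilling H.γ X) :
    ContDiffAt ℝ ∞ (H.fluxDensity ε T X s) (extChartAt (𝓡 3) s s) := by
  have h := isGood_self (H := H) s
  exact (h.isLocalVolume ε).smooth.smul (h.contDiffAt_contract hT hTs
    (contDiffAt_fieldRep hX.smooth h.1))

lemma divergence_fluxDensity (hT : IsBilinear T)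
    (hTs : ∀ i j, ContDiffAt ℝ ∞ (fun z => chartComp T s z i j) (extChartAt (𝓡 3) s s))
    (hX : IsConformalKilling H.γ X) {e : Fin 3 → 𝔼³}
    (he : IsOrthoFrame (matBil (chartComp H.γ s (extChartAt (𝓡 3) s s))) e 1)
    (hsymm : ∀ i j, T s (e i) (e j) = T s (e j) (e i)) (htr : ∑ i, T s (e i) (e i) = 0)
    (hdiv : ∀ v, divergence H.γ T s v = 0) :
    ∑ l, fderiv ℝ (H.fluxDensity ε T X s) (extChartAt (𝓡 3) s s) (stdVec l) l = 0 := by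
  have h := isGood_self (H := H) s
  have hXs := contDiffAt_fieldRep hX.smooth h.1
  obtain ⟨lam, hlam⟩ := conformalKilling_eq hX s
  have hTe : ∀ i j, matBil (chartComp T s (extChartAt (𝓡 3) s s)) (e i) (e j) = T s (e i) (e j) :=
    fun i j => (hT.eq_matBil_self s _ _).symm
  exact (h.isLocalVolume ε).divergence_density_eq_zero (contDiffAt_matBil hTs).diffAt he
    (fun i j => by rw [hTe, hTe]; exact hsymm i j) (by simp only [hTe]; exact htr)
    (fun v => (divergence_eq_sum H.isBilinear_γ hT hTs he v).symm.trans (hdiv v))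
    hXs.diffAt (h.contDiffAt_contract hT hTs hXs).diffAt hlam
    (h.eventually.mono fun z hz => hz.matBil_contract hT)

/-- The trace is Λ from the electric part of the Riemann tensor minus three times Λ/3. -/
lemma E_symm_trace {Λ : ℝ} (hg : EinsteinVacuum g Λ) {e : Fin 3 → 𝔼³}
    (he : IsOrthoFrame (matBil (chartComp H.γ s (extChartAt (𝓡 3) s s))) e 1) :
    (∀ i j, H.E s (e i) (e j) = H.E s (e j) (e i)) ∧ ∑ i, H.E s (e i) (e i) = 0 := by
  have h := isGood_self (H := H) s
  have h1 : ∀ i j, H.E s (e i) (e j) = electric (g.bil (H.ι s)) (g.conn (H.ι s)) (H.rep s)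
      (H.normalRep s) (extChartAt (𝓡 3) s s) (e i) (e j) - Λ / 3 * if i = j then 1 else 0 :=
    fun i j => by
      refine (H.isBilinear_E.eq_matBil_self s _ _).trans ((h.matBil_E hg _ _).trans ?_)
      rw [he.orth]; rfl
  refine ⟨fun i j => ?_, ?_⟩
  · rw [h1, h1, h.isLocalHypersurface.electric_symm]
    simp only [eq_comm]
  · simp only [h1]
    rw [Finset.sum_sub_distrib, h.isLocalHypersurface.electric_trace he (h.ricci hg).self_of_nhds]
    simp
    ring

lemma B_symm_trace {Λ : ℝ} (hg : EinsteinVacuum g Λ) {e : Fin 3 → 𝔼³}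
    (he : IsOrthoFrame (matBil (chartComp H.γ s (extChartAt (𝓡 3) s s))) e 1) :
    (∀ i j, H.B ε s (e i) (e j) = H.B ε s (e j) (e i)) ∧ ∑ i, H.B ε s (e i) (e i) = 0 := by
  have h := isGood_self (H := H) s
  have h1 : ∀ i j, H.B ε s (e i) (e j) = magnetic (g.bil (H.ι s)) (g.conn (H.ι s))
      (chartComp H.γ s) (H.rep s) (H.normalRep s) (H.density ε s) (extChartAt (𝓡 3) s s)
      (e i) (e j) :=
    fun i j => ((H.isBilinear_B ε).eq_matBil_self s _ _).trans (h.matBil_B ε hg _ _)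
  refine ⟨fun i j => ?_, ?_⟩
  · rw [h1, h1, h.isLocalHypersurface.magnetic_symm (h.isLocalVolume ε) he
      (h.ricci hg).self_of_nhds]
  · simp only [h1]
    exact h.isLocalHypersurface.magnetic_trace (h.isLocalVolume ε) he

end SpacelikeHypersurface

/-! ### The flux 2-form and its pullbacks -/

section Flux

variable {M : Type*} [TopologicalSpace M] [ChartedSpace (EuclideanSpace ℝ (Fin 4)) M]
  [IsManifold (𝓡 4) ∞ M] {S : Type*} [TopologicalSpace S]
  [ChartedSpace (EuclideanSpace ℝ (Fin 3)) S] {g : LorentzMetric M}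
  (H : SpacelikeHypersurface S g) (ε : VolumeForm g)
  (T : Tensor2 3 S) (X : ∀ s : S, TangentSpace (𝓡 3) s)
  {P Q : Type*} [NormedAddCommGroup P] [NormedSpace ℝ P] [NormedAddCommGroup Q] [NormedSpace ℝ Q]

local notation "𝔼³" => EuclideanSpace ℝ (Fin 3)

/-- The pullback of the flux 2-form by a map. -/
def fluxForm (Φ : P → S) (K : Set P) (t a b : P) : ℝ :=
  H.vol ε (Φ t) (H.contract T X (Φ t)) (mfderivWithin 𝓘(ℝ, P) (𝓡 3) Φ K t a)
    (mfderivWithin 𝓘(ℝ, P) (𝓡 3) Φ K t b)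

lemma fluxForm_comp {Φ : P → S} {K : Set P} {L : Q → P} {K' : Set Q} {t : Q}
    (hΦ : MDifferentiableWithinAt 𝓘(ℝ, P) (𝓡 3) Φ K (L t)) (hL : DifferentiableAt ℝ L t)
    (hK : Set.MapsTo L K' K) (ht : UniqueDiffWithinAt ℝ K' t) (a b : Q) :
    fluxForm H ε T X (Φ ∘ L) K' t a b =
      fluxForm H ε T X Φ K (L t) (fderiv ℝ L t a) (fderiv ℝ L t b) := by
  have h1 : mfderivWithin 𝓘(ℝ, Q) 𝓘(ℝ, P) L K' t = fderiv ℝ L t := by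
    rw [mfderivWithin_eq_fderivWithin, hL.fderivWithin ht]
  rw [fluxForm, mfderivWithin_comp t hΦ hL.mdifferentiableAt.mdifferentiableWithinAt hK
    ht.uniqueMDiffWithinAt, h1]
  rfl

variable {T X} [IsManifold (𝓡 3) ∞ S]

omit [IsManifold (𝓡 3) ∞ S] in
lemma contDiffWithinAt_chart {Φ : P → S} {K : Set P} (hΦ : ContMDiffOn 𝓘(ℝ, P) (𝓡 3) ∞ Φ K) {t₀ : P}
    (ht : t₀ ∈ K) : ContDiffWithinAt ℝ ∞ (fun t => extChartAt (𝓡 3) (Φ t₀) (Φ t)) K t₀ := by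
  rw [← contMDiffWithinAt_iff_contDiffWithinAt]
  exact (contMDiffAt_extChartAt (I := 𝓡 3) (x := Φ t₀)).comp_contMDiffWithinAt t₀ (hΦ t₀ ht)

/-- Passes to the single chart at Φ t₀, where the form is a determinant of coordinate functions and
can be differentiated. -/
lemma fluxForm_eventuallyEq {Φ : P → S} {K : Set P} (hΦ : ContMDiffOn 𝓘(ℝ, P) (𝓡 3) ∞ Φ K)
    (hK : UniqueDiffOn ℝ K) {t₀ : P} (ht : t₀ ∈ K) : ∀ᶠ t in 𝓝[K] t₀, ∀ a b,
    fluxForm H ε T X Φ K t a b =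
      det3 (H.fluxDensity ε T X (Φ t₀) (extChartAt (𝓡 3) (Φ t₀) (Φ t)))
        (fderivWithin ℝ (fun t => extChartAt (𝓡 3) (Φ t₀) (Φ t)) K t a)
        (fderivWithin ℝ (fun t => extChartAt (𝓡 3) (Φ t₀) (Φ t)) K t b) := by
  have h1 : ∀ᶠ t in 𝓝[K] t₀, Φ t ∈ (extChartAt (𝓡 3) (Φ t₀)).source :=
    (hΦ t₀ ht).continuousWithinAt.eventually (extChartAt_source_mem_nhds (I := 𝓡 3) (Φ t₀))
  filter_upwards [h1, self_mem_nhdsWithin] with t hs htK a b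
  have hd : ∀ a, fderivWithin ℝ (fun t => extChartAt (𝓡 3) (Φ t₀) (Φ t)) K t a =
      toChart (Φ t₀) (Φ t) (mfderivWithin 𝓘(ℝ, P) (𝓡 3) Φ K t a) := fun a => by
    rw [← mfderivWithin_eq_fderivWithin]
    have h2 := mfderiv_comp_mfderivWithin t (mdifferentiableAt_extChartAt (I := 𝓡 3)
      (by rwa [← extChartAt_source (𝓡 3)])) ((hΦ t htK).mdifferentiableWithinAt (by simp))
      (hK t htK).uniqueMDiffWithinAt
    exact congrArg (fun L => L a) h2
  rw [fluxForm, SpacelikeHypersurface.vol_toChart ε hs, hd, hd, SpacelikeHypersurface.fluxDensity,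
    SpacelikeHypersurface.fieldRep, (extChartAt (𝓡 3) (Φ t₀)).left_inv hs]
  simp only [det3, PiLp.smul_apply, smul_eq_mul]
  ring

lemma contDiffWithinAt_det3 {n : ℕ∞ω} {A B C : P → 𝔼³} {K : Set P} {t : P}
    (hA : ContDiffWithinAt ℝ n A K t)
    (hB : ContDiffWithinAt ℝ n B K t) (hC : ContDiffWithinAt ℝ n C K t) :
    ContDiffWithinAt ℝ n (fun t => det3 (A t) (B t) (C t)) K t := by
  have h : ∀ {F : P → 𝔼³}, ContDiffWithinAt ℝ n F K t → ∀ i,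
    ContDiffWithinAt ℝ n (fun t => F t i) K t := fun hF i =>
    (EuclideanSpace.proj (𝕜 := ℝ) i).contDiff.contDiffAt.comp_contDiffWithinAt t hF
  simp only [det3]
  exact (((h hA 0).mul (((h hB 1).mul (h hC 2)).sub ((h hB 2).mul (h hC 1)))).sub
    ((h hA 1).mul (((h hB 0).mul (h hC 2)).sub ((h hB 2).mul (h hC 0))))).add
    ((h hA 2).mul (((h hB 0).mul (h hC 1)).sub ((h hB 1).mul (h hC 0))))

lemma contDiffWithinAt_fluxForm {Φ : P → S} {K : Set P} (hΦ : ContMDiffOn 𝓘(ℝ, P) (𝓡 3) ∞ Φ K)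
    (hK : UniqueDiffOn ℝ K) {t₀ : P} (ht : t₀ ∈ K)
    (hZ : ContDiffAt ℝ ∞ (H.fluxDensity ε T X (Φ t₀)) (extChartAt (𝓡 3) (Φ t₀) (Φ t₀))) (a b : P) :
    ContDiffWithinAt ℝ ∞ (fun t => fluxForm H ε T X Φ K t a b) K t₀ := by
  have hF := contDiffWithinAt_chart hΦ ht
  have hd := hF.fderivWithin_right hK (m := ∞) (by simp) ht
  have h1 : (fun t => fluxForm H ε T X Φ K t a b) =ᶠ[𝓝[K] t₀] fun t =>
      det3 (H.fluxDensity ε T X (Φ t₀) (extChartAt (𝓡 3) (Φ t₀) (Φ t)))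
        (fderivWithin ℝ (fun t => extChartAt (𝓡 3) (Φ t₀) (Φ t)) K t a)
        (fderivWithin ℝ (fun t => extChartAt (𝓡 3) (Φ t₀) (Φ t)) K t b) :=
    (fluxForm_eventuallyEq H ε (T := T) (X := X) hΦ hK ht).mono fun t h => h a b
  refine ContDiffWithinAt.congr_of_eventuallyEq_of_mem ?_ h1 ht
  have hA : ContDiffWithinAt ℝ ∞ (fun t =>
      H.fluxDensity ε T X (Φ t₀) (extChartAt (𝓡 3) (Φ t₀) (Φ t))) K t₀ :=
    ContDiffAt.comp_contDiffWithinAt (g := H.fluxDensity ε T X (Φ t₀))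
      (f := fun t => extChartAt (𝓡 3) (Φ t₀) (Φ t)) t₀ hZ hF
  exact contDiffWithinAt_det3 hA (hd.clm_apply contDiffWithinAt_const) (hd.clm_apply contDiffWithinAt_const)

lemma fluxForm_closed {Φ : P → S} {K : Set P} (hΦ : ContMDiffOn 𝓘(ℝ, P) (𝓡 3) ∞ Φ K)
    (hK : UniqueDiffOn ℝ K) {t₀ : P} (ht : K ∈ 𝓝 t₀)
    (hZ : ContDiffAt ℝ ∞ (H.fluxDensity ε T X (Φ t₀)) (extChartAt (𝓡 3) (Φ t₀) (Φ t₀)))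
    (hdiv : ∑ l, fderiv ℝ (H.fluxDensity ε T X (Φ t₀)) (extChartAt (𝓡 3) (Φ t₀) (Φ t₀))
      (stdVec l) l = 0) (a b c : P) :
    fderiv ℝ (fun t => fluxForm H ε T X Φ K t b c) t₀ a
      - fderiv ℝ (fun t => fluxForm H ε T X Φ K t a c) t₀ b
      + fderiv ℝ (fun t => fluxForm H ε T X Φ K t a b) t₀ c = 0 := by
  have hF := (contDiffWithinAt_chart hΦ (mem_of_mem_nhds ht)).contDiffAt ht
  have h1 : ∀ a b, (fun t => fluxForm H ε T X Φ K t a b) =ᶠ[𝓝 t₀] fun t =>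
      det3 (H.fluxDensity ε T X (Φ t₀) (extChartAt (𝓡 3) (Φ t₀) (Φ t)))
        (fderiv ℝ (fun t => extChartAt (𝓡 3) (Φ t₀) (Φ t)) t a)
        (fderiv ℝ (fun t => extChartAt (𝓡 3) (Φ t₀) (Φ t)) t b) := fun a b => by
    have h2 := fluxForm_eventuallyEq H ε (T := T) (X := X) hΦ hK (mem_of_mem_nhds ht)
    rw [nhdsWithin_eq_nhds.2 ht] at h2
    filter_upwards [h2, eventually_mem_nhds_iff.2 ht] with t h3 h4
    rw [h3, fderivWithin_of_mem_nhds h4]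
  rw [fderiv_congr_apply (h1 b c), fderiv_congr_apply (h1 a c), fderiv_congr_apply (h1 a b)]
  exact flux_closed hF hZ.diffAt hdiv a b c

end Flux

/-! ### Stokes' theorem for singular cubes and chains -/

section Cubes

variable {M : Type*} [TopologicalSpace M] [ChartedSpace (EuclideanSpace ℝ (Fin 4)) M]
  [IsManifold (𝓡 4) ∞ M] {S : Type*} [TopologicalSpace S]
  [ChartedSpace (EuclideanSpace ℝ (Fin 3)) S] {g : LorentzMetric M}
  (H : SpacelikeHypersurface S g) (ε : VolumeForm g)
  {T : Tensor2 3 S} {X : ∀ s : S, TangentSpace (𝓡 3) s}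

local notation "I³" => Set.Icc (0 : Fin 3 → ℝ) 1
local notation "I²" => Set.Icc (0 : Fin 2 → ℝ) 1

lemma uniqueDiffOn_cube (k : ℕ) : UniqueDiffOn ℝ (Set.Icc (0 : Fin k → ℝ) 1) := by
  rw [← Set.pi_univ_Icc]
  exact UniqueDiffOn.univ_pi fun i => uniqueDiffOn_Icc (by simp)

lemma SmoothCube.ext'_face (c : SmoothCube S 3) (i : Fin 3) (a : Set.Icc (0 : ℝ) 1) :
    (c.face i a).ext' = c.ext' ∘ fun x : Fin 2 → ℝ => (i.insertNth (a : ℝ) x : Fin 3 → ℝ) := by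
  funext x
  simp only [SmoothCube.ext', SmoothCube.face, Function.comp]
  congr 1
  funext j
  refine Fin.succAboveCases i ?_ (fun j => ?_) j
  · simp
  · simp

lemma SmoothCube.contMDiffOn_ext' {k : ℕ} (c : SmoothCube S k) :
    ContMDiffOn 𝓘(ℝ, Fin k → ℝ) (𝓡 3) ∞ c.ext' (Set.Icc 0 1) := c.smooth

lemma hasFDerivAt_insertNth (i : Fin 3) (a : ℝ) (t : Fin 2 → ℝ) :
    HasFDerivAt (fun x : Fin 2 → ℝ => (i.insertNth a x : Fin 3 → ℝ))
      (ContinuousLinearMap.pi (i.insertNth (0 : (Fin 2 → ℝ) →L[ℝ] ℝ)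
        fun j => ContinuousLinearMap.proj j)) t := by
  rw [hasFDerivAt_pi']
  intro j
  refine Fin.succAboveCases i ?_ (fun j => ?_) j
  · simpa using hasFDerivAt_const a t
  · simpa using hasFDerivAt_apply j t

lemma insertNth_mem_cube (i : Fin 3) (a : Set.Icc (0 : ℝ) 1) :
    Set.MapsTo (fun x : Fin 2 → ℝ => (i.insertNth (a : ℝ) x : Fin 3 → ℝ)) I² I³ := by
  intro x hx
  refine ⟨fun j => ?_, fun j => ?_⟩
  · refine Fin.succAboveCases i ?_ (fun j => ?_) j
    · simpa using a.2.1
    · simpa using hx.1 j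
  · refine Fin.succAboveCases i ?_ (fun j => ?_) j
    · simpa using a.2.2
    · simpa using hx.2 j

/-- The chain rule for the affine inclusion of a face, which sends each coordinate vector to the one
with index shifted past i. -/
lemma face_integrand (c : SmoothCube S 3) (i : Fin 3) (a : Set.Icc (0 : ℝ) 1) {t : Fin 2 → ℝ}
    (ht : t ∈ I²) :
    H.vol ε ((c.face i a).ext' t) (H.contract T X ((c.face i a).ext' t))
      ((c.face i a).velocity t 0) ((c.face i a).velocity t 1) =
    fluxForm H ε T X c.ext' I³ (i.insertNth (a : ℝ) t) (Pi.single (i.succAbove 0) 1)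
      (Pi.single (i.succAbove 1) 1) := by
  change fluxForm H ε T X (c.face i a).ext' I² t (Pi.single 0 1) (Pi.single 1 1) = _
  have hd := hasFDerivAt_insertNth i a t
  have hs : ∀ j, fderiv ℝ (fun x : Fin 2 → ℝ => (i.insertNth (a : ℝ) x : Fin 3 → ℝ)) t
      (Pi.single j 1) = Pi.single (i.succAbove j) 1 := fun j => by
    rw [hd.fderiv]
    funext l
    refine Fin.succAboveCases i ?_ (fun l => ?_) l
    · simp [(Fin.succAbove_ne i j).symm]
    · simp [Pi.single_apply]
  rw [SmoothCube.ext'_face, fluxForm_comp H ε T X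
    ((c.contMDiffOn_ext'.mdifferentiableOn (by simp)) _ (insertNth_mem_cube i a ht)) hd.differentiableAt
    (insertNth_mem_cube i a) (uniqueDiffOn_cube 2 t ht), hs, hs]

/-- The integral of the flux form over a square. -/
def squareCharge (T : Tensor2 3 S) (X : ∀ s : S, TangentSpace (𝓡 3) s) (c : SmoothCube S 2) : ℝ :=
  ∫ t in I², H.vol ε (c.ext' t) (H.contract T X (c.ext' t)) (c.velocity t 0) (c.velocity t 1)

/-- The charge as a homomorphism on chains. -/
def chargeHom (T : Tensor2 3 S) (X : ∀ s : S, TangentSpace (𝓡 3) s) : SmoothChain S 2 →+ ℝ :=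
  Finsupp.liftAddHom fun c =>
    (AddMonoidHom.mulRight (squareCharge H ε T X c)).comp (Int.castAddHom ℝ)

lemma chargeHom_apply (A : SmoothChain S 2) : chargeHom H ε T X A = charge H ε T X A := rfl

lemma chargeHom_single (c : SmoothCube S 2) :
    chargeHom H ε T X (Finsupp.single c 1) = squareCharge H ε T X c := by
  simp [chargeHom]

variable [IsManifold (𝓡 3) ∞ S]

/-- Stokes' theorem for the flux form on a cube. -/
lemma chargeHom_cubeBoundary (c : SmoothCube S 3)
    (hZ : ∀ t ∈ I³, ContDiffAt ℝ ∞ (H.fluxDensity ε T X (c.ext' t))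
      (extChartAt (𝓡 3) (c.ext' t) (c.ext' t)))
    (hdiv : ∀ t ∈ I³, ∑ l, fderiv ℝ (H.fluxDensity ε T X (c.ext' t))
      (extChartAt (𝓡 3) (c.ext' t) (c.ext' t)) (stdVec l) l = 0) :
    chargeHom H ε T X (cubeBoundary c) = 0 := by
  -- The component of the pulled-back 2-form omitting direction i, with the sign (−1)^i: the
  -- divergence of f is the coefficient of the exterior derivative, and the signs agree with those
  -- of the cubical boundary.
  let f : Fin 3 → (Fin 3 → ℝ) → ℝ := fun i t => (-1 : ℝ) ^ (i : ℕ) * fluxForm H ε T X c.ext' I³ t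
    (Pi.single (i.succAbove 0) 1) (Pi.single (i.succAbove 1) 1)
  let U : Set (Fin 3 → ℝ) := Set.pi Set.univ fun i => Set.Ioo ((0 : Fin 3 → ℝ) i) ((1 : Fin 3 → ℝ) i)
  have hU : ∀ t ∈ U, I³ ∈ 𝓝 t := fun t ht => by
    refine Filter.mem_of_superset ((isOpen_set_pi Set.finite_univ fun i _ => isOpen_Ioo).mem_nhds ht) ?_
    intro x hx
    exact ⟨fun i => (hx i (Set.mem_univ i)).1.le, fun i => (hx i (Set.mem_univ i)).2.le⟩
  have hsm : ∀ i, ∀ t ∈ I³, ContDiffWithinAt ℝ ∞ (f i) I³ t := fun i t ht =>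
    contDiffWithinAt_const.mul (contDiffWithinAt_fluxForm H ε c.contMDiffOn_ext' (uniqueDiffOn_cube 3) ht
      (hZ t ht) _ _)
  classical
  -- The derivative is needed only in the open cube. The value 0 elsewhere makes the divergence
  -- vanish identically, so its integrability is immediate.
  let f' : Fin 3 → (Fin 3 → ℝ) → (Fin 3 → ℝ) →L[ℝ] ℝ := fun i t => if t ∈ U then fderiv ℝ (f i) t else 0
  have hsum : ∀ t, ∑ i, f' i t (Pi.single i 1) = 0 := fun t => by
    by_cases ht : t ∈ U
    · have h1 := fluxForm_closed H ε c.contMDiffOn_ext' (uniqueDiffOn_cube 3) (hU t ht)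
        (hZ t (mem_of_mem_nhds (hU t ht))) (hdiv t (mem_of_mem_nhds (hU t ht)))
        (Pi.single 0 1) (Pi.single 1 1) (Pi.single 2 1)
      have hd : ∀ a b, DifferentiableAt ℝ (fun t => fluxForm H ε T X c.ext' I³ t a b) t := fun a b =>
        ((contDiffWithinAt_fluxForm H ε c.contMDiffOn_ext' (uniqueDiffOn_cube 3) (mem_of_mem_nhds (hU t ht))
          (hZ t (mem_of_mem_nhds (hU t ht))) a b).contDiffAt (hU t ht)).diffAt
      have h2 : ∀ i, f' i t (Pi.single i 1) = (-1 : ℝ) ^ (i : ℕ) *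
          fderiv ℝ (fun t => fluxForm H ε T X c.ext' I³ t
            (Pi.single (i.succAbove 0) 1) (Pi.single (i.succAbove 1) 1)) t (Pi.single i 1) := fun i => by
        simp only [f', if_pos ht, f]
        rw [fderiv_const_mul (hd _ _)]
        simp
      simp only [h2, Fin.sum_univ_three]
      have e1 : (1 : Fin 3).succAbove (0 : Fin 2) = 0 := rfl
      have e2 : (1 : Fin 3).succAbove (1 : Fin 2) = 2 := rfl
      have e3 : (2 : Fin 3).succAbove (0 : Fin 2) = 0 := rfl
      have e4 : (2 : Fin 3).succAbove (1 : Fin 2) = 1 := rfl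
      have e5 : (0 : Fin 3).succAbove (0 : Fin 2) = 1 := rfl
      have e6 : (0 : Fin 3).succAbove (1 : Fin 2) = 2 := rfl
      rw [e1, e2, e3, e4, e5, e6]
      simp only [Fin.val_zero, Fin.val_one, Fin.val_two, pow_zero, pow_one, one_mul, neg_mul]
      linear_combination h1
    · simp [f', ht]
  have hdvg := MeasureTheory.integral_divergence_of_hasFDerivAt_off_countable'
    (0 : Fin 3 → ℝ) 1 zero_le_one f f' ∅ Set.countable_empty
    (fun i t ht => (hsm i t ht).continuousWithinAt) (fun t ht i => by
      have ht' : t ∈ U := ht.1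
      simp only [f', if_pos ht']
      exact ((hsm i t (mem_of_mem_nhds (hU t ht'))).contDiffAt (hU t ht')).diffAt.hasFDerivAt)
    (by simp only [hsum]; exact MeasureTheory.integrableOn_zero)
  simp only [hsum, MeasureTheory.integral_zero] at hdvg
  have hface : ∀ (i : Fin 3) (a : Set.Icc (0 : ℝ) 1), (-1 : ℝ) ^ (i : ℕ) *
      squareCharge H ε T X (c.face i a) = ∫ t in I², f i (i.insertNth (a : ℝ) t) := fun i a => by
    rw [squareCharge, ← MeasureTheory.integral_const_mul]
    refine MeasureTheory.setIntegral_congr_fun measurableSet_Icc fun t ht => ?_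
    exact congrArg _ (face_integrand H ε c i a ht)
  rw [cubeBoundary, map_sum]
  refine Eq.trans (Finset.sum_congr rfl fun i _ => ?_) hdvg.symm
  rw [map_zsmul, map_sub, chargeHom_single, chargeHom_single, zsmul_eq_mul, mul_sub]
  push_cast
  rw [hface, hface]
  rfl

/-- By additivity it suffices to treat each cube of V. Vanishing divergence is therefore required
only at points of those cubes, while smoothness of the density is available everywhere. -/
lemma charge_eq_of_boundary {V : SmoothChain S 3} {A₁ A₂ : SmoothChain S 2}
    (hV : boundary V = A₁ - A₂)
    (hZ : ∀ s, ContDiffAt ℝ ∞ (H.fluxDensity ε T X s) (extChartAt (𝓡 3) s s))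
    (hdiv : ∀ c ∈ V.support, ∀ t, ∑ l, fderiv ℝ (H.fluxDensity ε T X (c.toFun t))
      (extChartAt (𝓡 3) (c.toFun t) (c.toFun t)) (stdVec l) l = 0) :
    charge H ε T X A₁ = charge H ε T X A₂ := by
  rw [← sub_eq_zero, ← chargeHom_apply, ← chargeHom_apply, ← map_sub, ← hV, boundary, Finsupp.sum,
    map_sum]
  refine Finset.sum_eq_zero fun c hc => ?_
  rw [map_zsmul, chargeHom_cubeBoundary H ε c (fun t _ => hZ _) (fun t _ => hdiv c hc _), smul_zero]

end Cubes

end WeylCharge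

end

theorem mainTheorem3
    {M : Type*} [TopologicalSpace M] [ChartedSpace (EuclideanSpace ℝ (Fin 4)) M]
    [IsManifold (𝓡 4) ∞ M]
    {S : Type*} [TopologicalSpace S] [ChartedSpace (EuclideanSpace ℝ (Fin 3)) S]
    [IsManifold (𝓡 3) ∞ S]
    (g : LorentzMetric M) (ε : VolumeForm g) (Λ : ℝ) (hg : EinsteinVacuum g Λ)
    (H : SpacelikeHypersurface S g) :
    (∀ (s : S) (v : TangentSpace (𝓡 3) s),
      divergence H.γ H.E s v = H.wedge ε H.K (H.B ε) s v) ∧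
    (∀ (s : S) (v : TangentSpace (𝓡 3) s),
      divergence H.γ (H.B ε) s v = -H.wedge ε H.K H.E s v) ∧
    (∀ X : ∀ s : S, TangentSpace (𝓡 3) s, IsConformalKilling H.γ X →
      ∀ (A₁ A₂ : SmoothChain S 2) (V : SmoothChain S 3), boundary V = A₁ - A₂ →
        ((∀ c ∈ V.support, ∀ t, H.wedge ε H.K (H.B ε) (c.toFun t) = 0) →
          charge H ε H.E X A₁ = charge H ε H.E X A₂) ∧
        ((∀ c ∈ V.support, ∀ t, H.wedge ε H.K H.E (c.toFun t) = 0) →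
          charge H ε (H.B ε) X A₁ = charge H ε (H.B ε) X A₂)) := by
  refine ⟨fun s v => SpacelikeHypersurface.divergence_E ε hg v,
    fun s v => SpacelikeHypersurface.divergence_B ε hg v, fun X hX A₁ A₂ V hV =>
      ⟨fun h => charge_eq_of_boundary H ε hV (fun s =>
        SpacelikeHypersurface.contDiffAt_fluxDensity ε H.isBilinear_E
          ((SpacelikeHypersurface.isGood_self s).contDiffAt_E hg) hX) fun c hc t => ?_,
      fun h => charge_eq_of_boundary H ε hV (fun s =>
        SpacelikeHypersurface.contDiffAt_fluxDensity ε (H.isBilinear_B ε)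
          ((SpacelikeHypersurface.isGood_self s).contDiffAt_B ε hg) hX) fun c hc t => ?_⟩⟩
  -- At a point of V the wedge hypothesis and the divergence identity make T divergence-free there,
  -- which is all that the pointwise conservation law needs.
  · obtain ⟨e, he⟩ := exists_orthoFrame
      (SpacelikeHypersurface.isGood_self (H := H) (c.toFun t)).posDef
    obtain ⟨hs, ht⟩ := SpacelikeHypersurface.E_symm_trace hg he
    refine SpacelikeHypersurface.divergence_fluxDensity ε H.isBilinear_E
      ((SpacelikeHypersurface.isGood_self _).contDiffAt_E hg) hX he hs ht fun v => ?_
    rw [SpacelikeHypersurface.divergence_E ε hg v, h c hc t]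
    rfl
  · obtain ⟨e, he⟩ := exists_orthoFrame
      (SpacelikeHypersurface.isGood_self (H := H) (c.toFun t)).posDef
    obtain ⟨hs, ht⟩ := SpacelikeHypersurface.B_symm_trace ε hg he
    refine SpacelikeHypersurface.divergence_fluxDensity ε (H.isBilinear_B ε)
      ((SpacelikeHypersurface.isGood_self _).contDiffAt_B ε hg) hX he hs ht fun v => ?_
    rw [SpacelikeHypersurface.divergence_B ε hg v, h c hc t]
    exact neg_zero
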